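/- **Setting.** Let $G$ be a locally compact second countable group, equipped with a left-invariant metric inducing its topology and a Haar measure $\mu$. Assume that $G$ is unimodular and that $\mu$ is locally doubling: for every $R>0$ there is $C\ge 1$ with $0<\mu(B(x,2r))\le C\mu(B(x,r))<\infty$ for all $x\in G$ and $0<r<R$. Let $S\subset G$ be compact and symmetric ($S^{-1}=S$), and suppose that $S$ contains an open neighbourhood of $1$ that generates $G$. Let $\phi:\mathbb R\to[0,\infty)$ be an $N$-function, i.e. a continuous, convex, even function with $\phi(t)=0$ iff $t=0$, $\phi(t)/t\to0$ as $t\to0$ and $\phi(t)/t\to\infty$ as $t\to+\infty$. Assume that $\phi$ is strictly convex, differentiable at every $t\ne0$ (put $\phi'(0)=0$), and doubling: $\phi(2t)\le D\phi(t)$ for all $t\ge0$ and some constant $D\ge 2$. Assume also that its convex conjugate $\psi(s)=\sup_{t\ge0}(t|s|-\phi(t))$ is doubling. For a measure space $(Z,\nu)$, $L^\phi(Z,\nu)$ is the space of classes of measurable $f:Z\to\mathbb R$ with $\int_Z\phi(f/\alpha)\,d\nu<\infty$ for some $\alpha>0$, with the Luxemburg norm $\|f\|_\phi=\inf\{\alpha>0:\int_Z\phi(f/\alpha)\,d\nu\le1\}$.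 Let $D_\phi(G)$ be the space of classes of measurable functions $f:G\to\mathbb R$ such that $$\|f\|_{\phi,S}=\inf\Big\{\alpha>0:\int_S\int_G\phi\Big(\frac{f(xs)-f(x)}{\alpha}\Big)dx\,ds\le1\Big\}<\infty .$$ Let $\mathcal D_\phi(G)=D_\phi(G)/\mathbb R$ be its quotient by the a.e. constant functions, with the norm induced by $\|\cdot\|_{\phi,S}$, and let $\mathcal L^\phi(G)$ be the image of $L^\phi(G)=L^\phi(G,\mu)$ in $\mathcal D_\phi(G)$. For $f\in D_\phi(G)$ put $\Delta_\phi f(x)=\int_S\phi'(f(xs)-f(x))\,ds$. A class in $\mathcal D_\phi(G)$ is called $\phi$-harmonic if it is the class of a function $h$ for which, for almost every $x$, the integrand defining $\Delta_\phi h(x)$ is integrable and $\Delta_\phi h(x)=0$. Let $(\pi(g)f)(x)=f(xg)$. Let $\overline H^1(G,L^\phi(G))$ be the reduced continuous cohomology: the kernel of $d_1$ modulo the closure of the image of $d_0$, on the complex of $G$-invariant continuous cochains $C(G^{k+1},L^\phi(G))^G$ with the compact-open topology. A class $[h]\in\mathcal D_\phi(G)$ represents $c\in\overline H^1(G,L^\phi(G))$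 if $(x_0,x_1)\mapsto\pi(x_1)h-\pi(x_0)h$ is a continuous invariant $L^\phi(G)$-valued cocycle with class $c$. **Theorem.** 1. For every $[f]\in\mathcal D_\phi(G)$ there exist $[u]\in\overline{\mathcal L^\phi(G)}$ (closure in $\mathcal D_\phi(G)$) and a $\phi$-harmonic class $[h]\in\mathcal D_\phi(G)$ such that $[f]=[u]+[h]$. 2. Every element of $\mathcal D_\phi(G)/\overline{\mathcal L^\phi(G)}$ contains exactly one $\phi$-harmonic class $[h]\in\mathcal D_\phi(G)$. 3. Every class in $\overline H^1(G,L^\phi(G))$ is represented by exactly one $\phi$-harmonic class $[h]\in\mathcal D_\phi(G)$. -/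

import Mathlib

open MeasureTheory Filter Topology
open scoped ENNReal Pointwise

noncomputable section

namespace OrliczCoh

/-! ### Young functions -/

/-- A Young function: a convex even function `ℝ → [0, ∞)` that vanishes exactly at `0`. -/
structure YoungFunction where
  toFun : ℝ → ℝ
  nonneg : ∀ t, 0 ≤ toFun t
  convex : ConvexOn ℝ Set.univ toFun
  even : ∀ t, toFun (-t) = toFun t
  eq_zero_iff : ∀ t, toFun t = 0 ↔ t = 0

instance : CoeFun YoungFunction (fun _ => ℝ → ℝ) := ⟨YoungFunction.toFun⟩

/-- An `N`-function: a continuous Young function with `φ(t)/t → 0` at `0` and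
`φ(t)/t → ∞` at infinity. -/
structure YoungFunction.IsNFunction (φ : YoungFunction) : Prop where
  continuous : Continuous φ
  tendsto_zero : Tendsto (fun t => φ t / t) (𝓝[≠] 0) (𝓝 0)
  tendsto_atTop : Tendsto (fun t => φ t / t) atTop atTop

/-- The doubling condition `φ(2t) ≤ D φ(t)` for all `t ≥ 0`. -/
def IsDoubling (φ : ℝ → ℝ) : Prop :=
  ∃ D : ℝ, 2 ≤ D ∧ ∀ t, 0 ≤ t → φ (2 * t) ≤ D * φ t

/-- The convex conjugate `ψ(s) = sup {t|s| - φ(t) : t ≥ 0}`. For an `N`-function the supremum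
is finite, see `YoungFunction.IsNFunction.isLUB_conjugate`. -/
def YoungFunction.conjugate (φ : YoungFunction) (s : ℝ) : ℝ :=
  sSup {y | ∃ t : ℝ, 0 ≤ t ∧ y = t * |s| - φ t}

theorem YoungFunction.IsNFunction.isLUB_conjugate {φ : YoungFunction} (hφ : φ.IsNFunction)
    (s : ℝ) : IsLUB {y | ∃ t : ℝ, 0 ≤ t ∧ y = t * |s| - φ t} (φ.conjugate s) := by
  refine isLUB_csSup ⟨_, 0, le_rfl, rfl⟩ ?_
  obtain ⟨T, hT⟩ := (hφ.tendsto_atTop.eventually_ge_atTop |s|).exists_forall_of_atTop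
  refine ⟨max T 0 * |s|, ?_⟩
  rintro y ⟨t, ht, rfl⟩
  have h0 := φ.nonneg t
  rcases le_total t (max T 0) with h | h
  · have := mul_le_mul_of_nonneg_right h (abs_nonneg s)
    linarith
  · rcases ht.eq_or_lt with rfl | ht
    · have : 0 ≤ max T 0 * |s| := by positivity
      linarith
    · have h1 := hT t ((le_max_left _ _).trans h)
      rw [le_div_iff₀ ht] at h1
      have : 0 ≤ max T 0 * |s| := by positivity
      linarith

theorem YoungFunction.map_zero (φ : YoungFunction) : φ 0 = 0 := (φ.eq_zero_iff 0).2 rfl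

theorem YoungFunction.continuous' (φ : YoungFunction) : Continuous φ :=
  continuousOn_univ.1 (φ.convex.continuousOn isOpen_univ)

theorem YoungFunction.measurable (φ : YoungFunction) :
    Measurable (fun t => ENNReal.ofReal (φ t)) :=
  φ.continuous'.measurable.ennreal_ofReal

theorem YoungFunction.map_mul_le (φ : YoungFunction) {c : ℝ} (h0 : 0 ≤ c) (h1 : c ≤ 1) (t : ℝ) :
    φ (c * t) ≤ c * φ t := by
  have := φ.convex.2 (Set.mem_univ t) (Set.mem_univ 0) h0 (sub_nonneg.2 h1) (by ring)
  simpa [φ.map_zero] using this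

/-! ### Orlicz spaces -/

section Orlicz

variable {Z : Type*} [MeasurableSpace Z]

/-- The modular `ρ_φ(f) = ∫ φ(f) dν`, as an element of `[0, ∞]`. -/
def modular (φ : YoungFunction) (ν : Measure Z) (f : Z → ℝ) : ℝ≥0∞ :=
  ∫⁻ z, ENNReal.ofReal (φ (f z)) ∂ν

variable (φ : YoungFunction) (ν : Measure Z)

theorem modular_congr {f g : Z → ℝ} (h : f =ᵐ[ν] g) : modular φ ν f = modular φ ν g :=
  lintegral_congr_ae (h.mono fun z hz => by simp only [hz])

theorem coeFn_zero_ae : ((0 : Z →ₘ[ν] ℝ) : Z → ℝ) =ᵐ[ν] fun _ => 0 :=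
  AEEqFun.coeFn_mk _ _

theorem modular_zero (α : ℝ) : modular φ ν (fun z => (0 : Z →ₘ[ν] ℝ) z / α) = 0 := by
  rw [modular_congr φ ν (g := fun _ => 0)
    ((coeFn_zero_ae ν).mono fun z hz => by simp only [hz, zero_div])]
  simp [modular, φ.map_zero]

theorem modular_smul_le {c : ℝ} (h0 : 0 ≤ c) (h1 : c ≤ 1) (f : Z → ℝ) :
    modular φ ν (fun z => c * f z) ≤ ENNReal.ofReal c * modular φ ν f := by
  unfold modular
  rw [← lintegral_const_mul' _ _ ENNReal.ofReal_ne_top]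
  refine lintegral_mono fun z => ?_
  rw [← ENNReal.ofReal_mul h0]
  exact ENNReal.ofReal_le_ofReal (φ.map_mul_le h0 h1 _)

theorem modular_add_le {a b : ℝ} (ha : 0 < a) (hb : 0 < b) {f g : Z → ℝ}
    (hf : AEMeasurable f ν) :
    modular φ ν (fun z => (f z + g z) / (a + b)) ≤
      ENNReal.ofReal (a / (a + b)) * modular φ ν (fun z => f z / a) +
        ENNReal.ofReal (b / (a + b)) * modular φ ν (fun z => g z / b) := by
  unfold modular
  rw [← lintegral_const_mul' _ _ ENNReal.ofReal_ne_top,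
    ← lintegral_const_mul' _ _ ENNReal.ofReal_ne_top, ← lintegral_add_left']
  · refine lintegral_mono fun z => ?_
    have h1 : 0 ≤ a / (a + b) := by positivity
    have h2 : 0 ≤ b / (a + b) := by positivity
    rw [← ENNReal.ofReal_mul h1, ← ENNReal.ofReal_mul h2,
      ← ENNReal.ofReal_add (mul_nonneg h1 (φ.nonneg _)) (mul_nonneg h2 (φ.nonneg _))]
    apply ENNReal.ofReal_le_ofReal
    have := φ.convex.2 (Set.mem_univ (f z / a)) (Set.mem_univ (g z / b)) h1 h2
      (by field_simp)
    simp only [smul_eq_mul] at this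
    refine le_trans (le_of_eq ?_) this
    congr 1
    field_simp
  · exact (φ.measurable.comp_aemeasurable (hf.div_const a)).const_mul _

/-- The Orlicz space `L^φ(Z, ν)`: classes of functions `f` with `ρ_φ(f/α) < ∞` for
some `α > 0`. -/
def orlicz : Submodule ℝ (Z →ₘ[ν] ℝ) where
  carrier := {f | ∃ α : ℝ, 0 < α ∧ modular φ ν (fun z => f z / α) < ∞}
  zero_mem' := by
    refine ⟨1, one_pos, ?_⟩
    rw [modular_zero]
    exact ENNReal.zero_lt_top
  add_mem' := by
    rintro f g ⟨a, ha, hf⟩ ⟨b, hb, hg⟩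
    refine ⟨a + b, by positivity, ?_⟩
    have : modular φ ν (fun z => (f + g) z / (a + b)) =
        modular φ ν (fun z => (f z + g z) / (a + b)) :=
      modular_congr φ ν ((AEEqFun.coeFn_add f g).mono fun z hz => by simp [hz])
    rw [this]
    refine (modular_add_le φ ν ha hb f.aemeasurable).trans_lt ?_
    exact ENNReal.add_lt_top.2 ⟨ENNReal.mul_lt_top ENNReal.ofReal_lt_top hf,
      ENNReal.mul_lt_top ENNReal.ofReal_lt_top hg⟩
  smul_mem' := by
    rintro c f ⟨a, ha, hf⟩
    have hc : 0 < |c| + 1 := by positivity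
    refine ⟨(|c| + 1) * a, by positivity, ?_⟩
    have h1 : modular φ ν (fun z => (c • f) z / ((|c| + 1) * a)) =
        modular φ ν (fun z => |c| / (|c| + 1) * (f z / a)) := by
      refine lintegral_congr_ae ((AEEqFun.coeFn_smul c f).mono fun z hz => ?_)
      simp only [hz, Pi.smul_apply, smul_eq_mul]
      congr 1
      have h2 : |c| / (|c| + 1) * (f z / a) = |c| * (f z / ((|c| + 1) * a)) := by
        field_simp
      rw [h2, mul_div_assoc]
      rcases abs_choice c with h | h
      · rw [h]
      · rw [h, neg_mul, φ.even]
    rw [h1]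
    refine (modular_smul_le φ ν (by positivity) ?_ _).trans_lt
      (ENNReal.mul_lt_top ENNReal.ofReal_lt_top hf)
    rw [div_le_one hc]
    linarith

/-- The set of admissible constants in the Luxemburg norm. -/
def luxSet (f : Z →ₘ[ν] ℝ) : Set ℝ :=
  {α | 0 < α ∧ modular φ ν (fun z => f z / α) ≤ 1}

/-- The Luxemburg norm `‖f‖_φ = inf {α > 0 : ρ_φ(f/α) ≤ 1}`. -/
def luxNorm (f : Z →ₘ[ν] ℝ) : ℝ := sInf (luxSet φ ν f)

theorem luxSet_nonneg (f : Z →ₘ[ν] ℝ) : ∀ α ∈ luxSet φ ν f, 0 ≤ α := fun _ h => h.1.le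

theorem luxSet_bddBelow (f : Z →ₘ[ν] ℝ) : BddBelow (luxSet φ ν f) :=
  ⟨0, fun _ h => h.1.le⟩

theorem luxSet_nonempty {f : Z →ₘ[ν] ℝ} (hf : f ∈ orlicz φ ν) : (luxSet φ ν f).Nonempty := by
  obtain ⟨a, ha, hf⟩ := hf
  set M := (modular φ ν (fun z => f z / a)).toReal with hM
  have hM0 : 0 ≤ M := ENNReal.toReal_nonneg
  have hc : 0 < M + 1 := by positivity
  refine ⟨(M + 1) * a, by positivity, ?_⟩
  have h1 : modular φ ν (fun z => f z / ((M + 1) * a)) =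
      modular φ ν (fun z => (M + 1)⁻¹ * (f z / a)) := by
    congr 1
    funext z
    field_simp
  rw [h1]
  refine (modular_smul_le φ ν (by positivity) (inv_le_one_of_one_le₀ (by linarith)) _).trans ?_
  rw [← ENNReal.ofReal_toReal hf.ne, ← hM, ← ENNReal.ofReal_mul (by positivity),
    ENNReal.ofReal_le_one, inv_mul_le_one₀ hc]
  linarith

theorem luxNorm_nonneg (f : Z →ₘ[ν] ℝ) : 0 ≤ luxNorm φ ν f :=
  Real.sInf_nonneg (luxSet_nonneg φ ν f)

theorem luxNorm_add_le {f g : Z →ₘ[ν] ℝ} (hf : f ∈ orlicz φ ν) (hg : g ∈ orlicz φ ν) :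
    luxNorm φ ν (f + g) ≤ luxNorm φ ν f + luxNorm φ ν g := by
  have key : ∀ a ∈ luxSet φ ν f, ∀ b ∈ luxSet φ ν g, luxNorm φ ν (f + g) ≤ a + b := by
    rintro a ⟨ha, hfa⟩ b ⟨hb, hgb⟩
    refine csInf_le (luxSet_bddBelow φ ν _) ⟨by positivity, ?_⟩
    have : modular φ ν (fun z => (f + g) z / (a + b)) =
        modular φ ν (fun z => (f z + g z) / (a + b)) :=
      modular_congr φ ν ((AEEqFun.coeFn_add f g).mono fun z hz => by simp [hz])
    rw [this]
    calc _ ≤ _ := modular_add_le φ ν ha hb f.aemeasurable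
      _ ≤ ENNReal.ofReal (a / (a + b)) * 1 + ENNReal.ofReal (b / (a + b)) * 1 := by gcongr
      _ = 1 := by
        rw [mul_one, mul_one, ← ENNReal.ofReal_add (by positivity) (by positivity), ← add_div,
          div_self (by positivity), ENNReal.ofReal_one]
  have h1 : ∀ a ∈ luxSet φ ν f, luxNorm φ ν (f + g) - a ≤ luxNorm φ ν g := fun a ha =>
    le_csInf (luxSet_nonempty φ ν hg) fun b hb => by linarith [key a ha b hb]
  have h2 : luxNorm φ ν (f + g) - luxNorm φ ν g ≤ luxNorm φ ν f :=
    le_csInf (luxSet_nonempty φ ν hf) fun a ha => by linarith [h1 a ha]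
  linarith

theorem luxNorm_zero : luxNorm φ ν (0 : Z →ₘ[ν] ℝ) = 0 := by
  have : luxSet φ ν (0 : Z →ₘ[ν] ℝ) = Set.Ioi 0 := by
    ext α
    refine ⟨fun h => h.1, fun h => ⟨h, ?_⟩⟩
    rw [modular_zero]
    exact zero_le_one
  rw [luxNorm, this, csInf_Ioi]

theorem luxNorm_smul (c : ℝ) (f : Z →ₘ[ν] ℝ) :
    luxNorm φ ν (c • f) = |c| * luxNorm φ ν f := by
  rcases eq_or_ne c 0 with rfl | hc
  · simp [luxNorm_zero]
  have hc' : 0 < |c| := abs_pos.2 hc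
  have : luxSet φ ν (c • f) = |c| • luxSet φ ν f := by
    ext α
    rw [Set.mem_smul_set_iff_inv_smul_mem₀ hc'.ne']
    have h1 : modular φ ν (fun z => (c • f) z / α) =
        modular φ ν (fun z => f z / (|c|⁻¹ • α)) := by
      refine lintegral_congr_ae ((AEEqFun.coeFn_smul c f).mono fun z hz => ?_)
      simp only [hz, Pi.smul_apply, smul_eq_mul]
      congr 1
      have h2 : f z / (|c|⁻¹ * α) = |c| * (f z / α) := by field_simp
      rw [h2, mul_div_assoc]
      rcases abs_choice c with h | h
      · rw [h]
      · rw [h, neg_mul, φ.even]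
    simp only [luxSet, Set.mem_ofPred_eq, h1, smul_eq_mul]
    have h3 : 0 < |c|⁻¹ * α ↔ 0 < α := by simp [hc']
    rw [h3]
  rw [luxNorm, this, Real.sInf_smul_of_nonneg hc'.le, smul_eq_mul, luxNorm]

theorem eq_zero_of_luxNorm_eq_zero {f : Z →ₘ[ν] ℝ} (hf : f ∈ orlicz φ ν)
    (h : luxNorm φ ν f = 0) : f = 0 := by
  have h0 : modular φ ν f = 0 := by
    refine le_antisymm (le_of_forall_pos_le_add fun ε hε => ?_) (zero_le)
    rw [zero_add]
    obtain ⟨r, hr0, hrε⟩ : ∃ r : ℝ, 0 < r ∧ ENNReal.ofReal r ≤ ε := by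
      rcases eq_or_ne ε ∞ with rfl | hε'
      · exact ⟨1, one_pos, le_top⟩
      · exact ⟨ε.toReal, ENNReal.toReal_pos hε.ne' hε', by rw [ENNReal.ofReal_toReal hε']⟩
    have hlt : sInf (luxSet φ ν f) < min r 1 := by
      have : luxNorm φ ν f < min r 1 := by rw [h]; positivity
      exact this
    obtain ⟨α, ⟨hα0, hα⟩, hαr⟩ := exists_lt_of_csInf_lt (luxSet_nonempty φ ν hf) hlt
    have h1 : modular φ ν f = modular φ ν (fun z => α * (f z / α)) := by
      congr 1
      funext z
      field_simp
    rw [h1]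
    calc _ ≤ _ := modular_smul_le φ ν hα0.le (hαr.le.trans (min_le_right _ _)) _
      _ ≤ ENNReal.ofReal r * 1 := by
        gcongr
        exact hαr.le.trans (min_le_left _ _)
      _ ≤ ε := by rwa [mul_one]
  have hm : AEMeasurable (fun z => ENNReal.ofReal (φ (f z))) ν :=
    φ.measurable.comp_aemeasurable f.aemeasurable
  rw [modular, lintegral_eq_zero_iff' hm] at h0
  refine AEEqFun.ext (EventuallyEq.trans (h0.mono fun z hz => ?_) (coeFn_zero_ae ν).symm)
  simp only [Pi.zero_apply, ENNReal.ofReal_eq_zero] at hz ⊢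
  exact (φ.eq_zero_iff _).1 (le_antisymm hz (φ.nonneg _))

instance : Norm (orlicz φ ν) := ⟨fun f => luxNorm φ ν (f : Z →ₘ[ν] ℝ)⟩

theorem orlicz_core : NormedSpace.Core ℝ (orlicz φ ν) where
  norm_nonneg f := luxNorm_nonneg φ ν _
  norm_smul c f := luxNorm_smul φ ν c _
  norm_triangle f g := luxNorm_add_le φ ν f.2 g.2
  norm_eq_zero_iff f := by
    refine ⟨fun h => Subtype.ext (eq_zero_of_luxNorm_eq_zero φ ν f.2 h), ?_⟩
    rintro rfl
    exact luxNorm_zero φ ν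

/-- `L^φ(Z, ν)` with the Luxemburg norm. -/
instance : NormedAddCommGroup (orlicz φ ν) := NormedAddCommGroup.ofCore (orlicz_core φ ν)

instance : NormedSpace ℝ (orlicz φ ν) := NormedSpace.ofCore (orlicz_core φ ν)

end Orlicz

/-! ### Continuous group cohomology -/

section Cohomology

variable (G : Type*) [Group G] [TopologicalSpace G] [IsTopologicalGroup G]
  {V : Type*} [AddCommGroup V] [Module ℝ V] [TopologicalSpace V] [IsTopologicalAddGroup V]
  [ContinuousSMul ℝ V]

/-- The formal derivative `d_k : C(G^{k+1}, V) → C(G^{k+2}, V)`,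
`(d_k ω)(x₀, …, x_{k+1}) = ∑ᵢ (-1)ⁱ ω(x₀, …, x̂ᵢ, …, x_{k+1})`. The spaces of continuous maps
carry the compact-open topology. -/
def cobound (V : Type*) [AddCommGroup V] [Module ℝ V] [TopologicalSpace V]
    [IsTopologicalAddGroup V] [ContinuousSMul ℝ V] (k : ℕ) :
    C(Fin (k + 1) → G, V) →ₗ[ℝ] C(Fin (k + 2) → G, V) where
  toFun ω :=
    { toFun := fun x => ∑ i : Fin (k + 2), (-1 : ℝ) ^ (i : ℕ) • ω (fun j => x (i.succAbove j))
      continuous_toFun := by fun_prop }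
  map_add' ω η := by
    ext x
    simp [Finset.sum_add_distrib]
  map_smul' c ω := by
    ext x
    simp [Finset.smul_sum, smul_comm c]

variable {G}

/-- The `G`-invariant cochains: `π(g)(ω(g⁻¹x₀, …, g⁻¹x_k)) = ω(x₀, …, x_k)`. -/
def invCochains (π : Representation ℝ G V) (k : ℕ) : Submodule ℝ C(Fin (k + 1) → G, V) where
  carrier := {ω | ∀ (g : G) (x : Fin (k + 1) → G), π g (ω (fun j => g⁻¹ * x j)) = ω x}
  zero_mem' := by intro g x; simp
  add_mem' := by
    intro ω η h1 h2 g x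
    simp [h1 g x, h2 g x]
  smul_mem' := by
    intro c ω h g x
    simp [h g x]

/-- The invariant `k`-cocycles, the kernel of `d_k` on `C(G^{k+1}, V)^G`. -/
def cocycles (π : Representation ℝ G V) (k : ℕ) : Submodule ℝ C(Fin (k + 1) → G, V) :=
  invCochains π k ⊓ LinearMap.ker (cobound G V k)

/-- The invariant `(k+1)`-coboundaries, the image of `d_k` on `C(G^{k+1}, V)^G`. -/
def coboundaries (π : Representation ℝ G V) (k : ℕ) : Submodule ℝ C(Fin (k + 2) → G, V) :=
  (invCochains π k).map (cobound G V k)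

/-- Reduced continuous cohomology in degree `k + 1`:
`Ker d_{k+1}` modulo the closure of `Im d_k`. -/
abbrev ReducedCohomologySucc (π : Representation ℝ G V) (k : ℕ) : Type _ :=
  ↥(cocycles π (k + 1)) ⧸ (coboundaries π k).topologicalClosure.submoduleOf (cocycles π (k + 1))

end Cohomology

/-! ### The right regular representation, Dirichlet functions, harmonic functions -/

section Group

variable {G : Type*} [Group G] [TopologicalSpace G] [IsTopologicalGroup G]
  [SecondCountableTopology G] [MeasurableSpace G] [BorelSpace G]
  (μ : Measure G) [SFinite μ] [μ.IsMulRightInvariant]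

/-- Right translation `(π(g) f)(x) = f(xg)` on classes of measurable functions. -/
def rightTranslate : Representation ℝ G (G →ₘ[μ] ℝ) where
  toFun g :=
    { toFun := fun f => f.compMeasurePreserving (· * g) (measurePreserving_mul_right μ g)
      map_add' := fun f₁ f₂ => AEEqFun.induction_on₂ f₁ f₂ fun _ _ _ _ => rfl
      map_smul' := fun _ f => AEEqFun.induction_on f fun _ _ => rfl }
  map_one' := by
    ext1 f
    induction f using AEEqFun.induction_on with
    | _ f hf =>
      change AEEqFun.mk _ _ = AEEqFun.mk _ _
      congr 1
      funext x
      simp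
  map_mul' g h := by
    ext1 f
    induction f using AEEqFun.induction_on with
    | _ f hf =>
      change AEEqFun.mk _ _ = AEEqFun.mk _ _
      congr 1
      funext x
      simp [mul_assoc]

theorem coeFn_rightTranslate (g : G) (f : G →ₘ[μ] ℝ) :
    rightTranslate μ g f =ᵐ[μ] fun x => f (x * g) :=
  AEEqFun.coeFn_compMeasurePreserving f (measurePreserving_mul_right μ g)

theorem modular_rightTranslate (φ : YoungFunction) (g : G) (f : G →ₘ[μ] ℝ) (α : ℝ) :
    modular φ μ (fun x => rightTranslate μ g f x / α) = modular φ μ (fun x => f x / α) := by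
  rw [modular_congr φ μ (g := fun x => f (x * g) / α)
    ((coeFn_rightTranslate μ g f).mono fun x hx => by simp only [hx])]
  exact lintegral_mul_right_eq_self (fun x => ENNReal.ofReal (φ (f x / α))) g

/-- The right regular representation of a unimodular group `G` on `L^φ(G)`,
`(π(g) f)(x) = f(xg)`. -/
def rightRegular (φ : YoungFunction) : Representation ℝ G (orlicz φ μ) where
  toFun g := (rightTranslate μ g).restrict (p := orlicz φ μ) (q := orlicz φ μ) (by
    rintro f ⟨α, hα, hf⟩
    exact ⟨α, hα, by rwa [modular_rightTranslate]⟩)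
  map_one' := by
    ext1 f
    apply Subtype.ext
    simp [LinearMap.restrict_apply]
  map_mul' g h := by
    ext1 f
    apply Subtype.ext
    simp [LinearMap.restrict_apply]

variable (S : Set G)

theorem quasiMeasurePreserving_mul_restrict :
    Measure.QuasiMeasurePreserving (fun p : G × G => p.2 * p.1) ((μ.restrict S).prod μ) μ :=
  (Measure.quasiMeasurePreserving_snd (μ := μ.restrict S) (ν := μ)).comp
    (measurePreserving_prod_mul_right (μ.restrict S) μ).quasiMeasurePreserving

/-- The difference map `f ↦ ((s, x) ↦ f(xs) - f(x))`, from classes of measurable functions on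
`G` to classes of measurable functions on `S × G`. -/
def diffMap : (G →ₘ[μ] ℝ) →ₗ[ℝ] (G × G →ₘ[(μ.restrict S).prod μ] ℝ) where
  toFun f :=
    f.compQuasiMeasurePreserving (fun p : G × G => p.2 * p.1)
        (quasiMeasurePreserving_mul_restrict μ S) -
      f.compQuasiMeasurePreserving Prod.snd Measure.quasiMeasurePreserving_snd
  map_add' f₁ f₂ := by
    refine AEEqFun.induction_on₂ f₁ f₂ fun u hu v hv => ?_
    rw [AEEqFun.mk_add_mk]
    simp only [AEEqFun.compQuasiMeasurePreserving_mk, AEEqFun.mk_add_mk, ← AEEqFun.mk_sub]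
    congr 1
    funext p
    simp only [Function.comp_apply, Pi.add_apply, Pi.sub_apply]
    ring
  map_smul' c f := by
    refine AEEqFun.induction_on f fun u hu => ?_
    simp only [RingHom.id_apply, AEEqFun.smul_mk, AEEqFun.compQuasiMeasurePreserving_mk, ← AEEqFun.mk_sub]
    congr 1
    funext p
    simp only [Function.comp_apply, Pi.smul_apply, Pi.sub_apply, smul_eq_mul]
    ring

theorem coeFn_diffMap (f : G →ₘ[μ] ℝ) :
    diffMap μ S f =ᵐ[(μ.restrict S).prod μ] fun p => f (p.2 * p.1) - f p.2 := by
  refine (AEEqFun.coeFn_sub _ _).trans ?_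
  filter_upwards [AEEqFun.coeFn_compQuasiMeasurePreserving f
      (quasiMeasurePreserving_mul_restrict μ S),
    AEEqFun.coeFn_compQuasiMeasurePreserving f
      (Measure.quasiMeasurePreserving_snd (μ := μ.restrict S) (ν := μ))] with p h1 h2
  simp only [Pi.sub_apply, h1, h2, Function.comp_apply]

/-- The modular of the difference map is
`ρ_{φ,S}(f/α) = ∫_S ∫_G φ((f(xs) - f(x))/α) dx ds`. -/
theorem modular_diffMap (φ : YoungFunction) (f : G →ₘ[μ] ℝ) (α : ℝ) :
    modular φ ((μ.restrict S).prod μ) (fun p => diffMap μ S f p / α) =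
      ∫⁻ s in S, ∫⁻ x, ENNReal.ofReal (φ ((f (x * s) - f x) / α)) ∂μ ∂μ := by
  have h : (fun p => diffMap μ S f p / α) =ᵐ[(μ.restrict S).prod μ]
      fun p => (f (p.2 * p.1) - f p.2) / α :=
    (coeFn_diffMap μ S f).mono fun p hp => by simp only [hp]
  rw [modular_congr φ _ h, modular, lintegral_prod]
  exact φ.measurable.comp_aemeasurable
    (((diffMap μ S f).aemeasurable.div_const α).congr h)

variable (φ : YoungFunction)

/-- The space `D_φ(G)` of `φ`-Dirichlet functions: classes of measurable `f` with
`∫_S ∫_G φ((f(xs) - f(x))/α) dx ds < ∞` for some `α > 0`, i.e. with finite `‖f‖_{φ,S}`. -/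
def dirichlet : Submodule ℝ (G →ₘ[μ] ℝ) :=
  (orlicz φ ((μ.restrict S).prod μ)).comap (diffMap μ S)

/-- The map `D_φ(G) → L^φ(S × G)`, `f ↦ ((s, x) ↦ f(xs) - f(x))`. -/
def dirichletToOrlicz : dirichlet μ S φ →ₗ[ℝ] orlicz φ ((μ.restrict S).prod μ) :=
  (diffMap μ S).restrict fun _ hf => hf

/-- `D_φ(G)` with the seminorm `‖f‖_{φ,S}`, the Luxemburg norm of `(s, x) ↦ f(xs) - f(x)`. -/
instance : SeminormedAddCommGroup (dirichlet μ S φ) :=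
  SeminormedAddCommGroup.induced _ _ (dirichletToOrlicz μ S φ)

instance : NormedSpace ℝ (dirichlet μ S φ) :=
  NormedSpace.induced _ _ _ (dirichletToOrlicz μ S φ)

/-- The almost everywhere constant functions, as a subspace of `D_φ(G)`. -/
def constants : Submodule ℝ (dirichlet μ S φ) where
  carrier := {f | ∃ c : ℝ, (f : G →ₘ[μ] ℝ) = AEEqFun.const G c}
  zero_mem' := ⟨0, rfl⟩
  add_mem' := by
    rintro f g ⟨a, ha⟩ ⟨b, hb⟩
    exact ⟨a + b, by rw [Submodule.coe_add, ha, hb]; rfl⟩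
  smul_mem' := by
    rintro c f ⟨a, ha⟩
    exact ⟨c * a, by rw [Submodule.coe_smul, ha]; rfl⟩

/-- `𝒟_φ(G) = D_φ(G)/ℝ`, with the (quotient) norm `‖·‖_{φ,S}`. -/
abbrev DirichletMod : Type _ := ↥(dirichlet μ S φ) ⧸ constants μ S φ

/-- The image `𝓛^φ(G)` of `L^φ(G)` in `𝒟_φ(G)`. -/
def orliczMod : Submodule ℝ (DirichletMod μ S φ) :=
  ((orlicz φ μ).submoduleOf (dirichlet μ S φ)).map (constants μ S φ).mkQ

/-- A function `f` is `φ`-harmonic if its `φ`-Laplacian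
`Δ_φ f(x) = ∫_S φ'(f(xs) - f(x)) ds` is defined (the integrand is integrable) and equal to `0`
for almost every `x`. -/
def IsHarmonic (f : G → ℝ) : Prop :=
  ∀ᵐ x ∂μ, IntegrableOn (fun s => deriv φ (f (x * s) - f x)) S μ ∧
    ∫ s in S, deriv φ (f (x * s) - f x) ∂μ = 0

/-- A class in `𝒟_φ(G)` is `φ`-harmonic if it is the class of a `φ`-harmonic function. -/
def IsHarmonicClass (h : DirichletMod μ S φ) : Prop :=
  ∃ f : dirichlet μ S φ, Submodule.Quotient.mk f = h ∧
    IsHarmonic μ S φ (f : G →ₘ[μ] ℝ)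

/-- The class `h = [f] ∈ 𝒟_φ(G)` represents the reduced cohomology class `c` in degree `1`: the
function `(x₀, x₁) ↦ π(x₁) f - π(x₀) f` is a continuous `G`-invariant `L^φ(G)`-valued cocycle
with class `c`. (It is the homogeneous form of the inhomogeneous cocycle `g ↦ π(g) f - f`.) -/
def Represents (h : DirichletMod μ S φ)
    (c : ReducedCohomologySucc (rightRegular μ φ) 0) : Prop :=
  ∃ f : dirichlet μ S φ, Submodule.Quotient.mk f = h ∧
    ∃ ω : cocycles (rightRegular μ φ) 1, Submodule.Quotient.mk ω = c ∧
      ∀ x : Fin 2 → G, ((ω.1 x : orlicz φ μ) : G →ₘ[μ] ℝ) =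
        rightTranslate μ (x 1) (f : G →ₘ[μ] ℝ) - rightTranslate μ (x 0) (f : G →ₘ[μ] ℝ)

end Group

/-- The measure `μ` is locally doubling: for every `R > 0` there is `C ≥ 1` with
`0 < μ(B(x, 2r)) ≤ C μ(B(x, r)) < ∞` for all `x` and `0 < r < R`. -/
def IsLocallyDoubling {X : Type*} [MetricSpace X] [MeasurableSpace X] (μ : Measure X) : Prop :=
  ∀ R : ℝ, 0 < R → ∃ C : ℝ, 1 ≤ C ∧ ∀ (x : X) (r : ℝ), 0 < r → r < R →
    0 < μ (Metric.ball x (2 * r)) ∧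
    μ (Metric.ball x (2 * r)) ≤ ENNReal.ofReal C * μ (Metric.ball x r) ∧
    ENNReal.ofReal C * μ (Metric.ball x r) < ∞

end OrliczCoh

end

set_option linter.unusedSectionVars false
noncomputable section

namespace OrliczCoh

/-! ### Pointwise inequalities for Young functions -/

namespace YoungFunction

variable (φ : YoungFunction)

/-! The proof is the direct method of the calculus of variations for the energy ∫_S ∫_G φ(f(xs) -
f(x)) dx ds on the affine class f + L^φ(G). Write df for the difference function (s, x) ↦ f(xs) -
f(x). Midpoints of a minimizing sequence stay in the class, so the integrated midpoint defect of φ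
tends to 0. Strict convexity then yields a subsequence whose differences converge almost everywhere
(`exists_subseq_ae_tendsto`). Doubling of the conjugate, in the form φ(ℓt) ≥ 2ℓφ(t), lets the defect
control φ(v - w) wherever |v| is much larger than |w|, and this upgrades the convergence to
convergence in modular (`exists_subseq_tendsto_modular`). Because S contains a generating
neighbourhood of 1, the limit is again of the form dh (`exists_diffMap_eq_of_ae_tendsto`), and h
minimizes the energy on h + L^φ (`exists_minimal`).

Differentiating the energy at h and summing by parts (S is symmetric, μ is unimodular, φ' is odd)
gives Δ_φ h = 0. Conversely, if h is harmonic, the functional g ↦ ∫ φ'(dh) dg vanishes on L^φ and,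
being continuous, on its closure. If the difference of two harmonic functions lies in that closure,
then ∫ (φ'(dh₁) - φ'(dh₂))(dh₁ - dh₂) = 0, so dh₁ = dh₂ by strict monotonicity of φ', and h₁ - h₂ is
constant. This settles the statements on Dirichlet classes.

For cohomology, f is sent to the cocycle π(x₁)f - π(x₀)f. Every continuous cocycle has a measurable
primitive (`exists_primitive`), which is a Dirichlet function since S is compact. In the other
direction f ↦ π(g)f - f is bounded from D_φ to L^φ locally uniformly in g
(`exists_nhds_luxNorm_le`), and it tends to 0 as g → 1. Under this dictionary the closure of L^φ
corresponds to the closure of the coboundaries (`isOrliczLimit_of_mem_closure_coboundaries`,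
`mem_closure_coboundaries`). -/

theorem map_abs (t : ℝ) : φ |t| = φ t := by
  rcases abs_choice t with h | h
  · rw [h]
  · rw [h, φ.even]

theorem map_le_map_of_abs_le {a b : ℝ} (h : |a| ≤ |b|) : φ a ≤ φ b := by
  rw [← φ.map_abs a, ← φ.map_abs b]
  rcases (abs_nonneg b).eq_or_lt with hb | hb
  · have : |a| = |b| := le_antisymm h (hb ▸ abs_nonneg a)
    rw [this]
  · have h1 : |a| = |a| / |b| * |b| := by field_simp
    have h2 : |a| / |b| ≤ 1 := (div_le_one hb).2 h
    rw [h1]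
    refine (φ.map_mul_le (by positivity) h2 _).trans ?_
    exact mul_le_of_le_one_left (φ.nonneg _) h2

theorem pos_of_ne_zero {t : ℝ} (h : t ≠ 0) : 0 < φ t :=
  (φ.nonneg t).lt_of_ne fun h' => h ((φ.eq_zero_iff t).1 h'.symm)

/-- The midpoint convexity defect. -/
def defect (a b : ℝ) : ℝ := (φ a + φ b) / 2 - φ ((a + b) / 2)

theorem defect_nonneg (a b : ℝ) : 0 ≤ φ.defect a b := by
  have := φ.convex.2 (Set.mem_univ a) (Set.mem_univ b) (by norm_num : (0 : ℝ) ≤ 1 / 2)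
    (by norm_num : (0 : ℝ) ≤ 1 / 2) (by norm_num)
  simp only [smul_eq_mul] at this
  have h : (a + b) / 2 = 1 / 2 * a + 1 / 2 * b := by ring
  rw [defect, h]
  linarith

theorem continuous_defect : Continuous fun p : ℝ × ℝ => φ.defect p.1 p.2 := by
  have := φ.continuous'
  unfold defect
  fun_prop

/-- `φ(2t) ≤ D φ(t)` for all real `t`. -/
def DoublingWith (D : ℝ) : Prop := 1 ≤ D ∧ ∀ t, φ (2 * t) ≤ D * φ t

variable {φ}

theorem exists_doublingWith (h : IsDoubling φ) : ∃ D, φ.DoublingWith D := by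
  obtain ⟨D, hD, h⟩ := h
  refine ⟨D, by linarith, fun t => ?_⟩
  have := h |t| (abs_nonneg t)
  rwa [φ.map_abs, ← φ.map_abs, abs_mul, abs_abs, ← abs_mul, φ.map_abs] at this

variable {D : ℝ} (hD : φ.DoublingWith D)
include hD

theorem DoublingWith.pos : 0 < D := by linarith [hD.1]

theorem DoublingWith.map_add_le (a b : ℝ) : φ (a + b) ≤ D * (φ a + φ b) := by
  have h1 := φ.defect_nonneg a b
  have h2 := hD.2 ((a + b) / 2)
  rw [defect] at h1
  have h3 : 2 * ((a + b) / 2) = a + b := by ring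
  rw [h3] at h2
  have := mul_le_mul_of_nonneg_left (sub_nonneg.1 h1) hD.pos.le
  nlinarith [mul_nonneg hD.pos.le (add_nonneg (φ.nonneg a) (φ.nonneg b))]

theorem DoublingWith.map_abs_add_le (a b : ℝ) : φ (|a| + |b|) ≤ D * (φ a + φ b) := by
  simpa only [φ.map_abs] using hD.map_add_le |a| |b|

theorem DoublingWith.map_sub_le (a b : ℝ) : φ (a - b) ≤ D * (φ a + φ b) := by
  simpa only [φ.even, sub_eq_add_neg] using hD.map_add_le a (-b)

theorem DoublingWith.map_two_pow_mul_le (k : ℕ) (t : ℝ) : φ (2 ^ k * t) ≤ D ^ k * φ t := by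
  induction k with
  | zero => simp
  | succ k ih =>
    calc φ (2 ^ (k + 1) * t) = φ (2 * (2 ^ k * t)) := by ring_nf
      _ ≤ D * φ (2 ^ k * t) := hD.2 _
      _ ≤ D * (D ^ k * φ t) := mul_le_mul_of_nonneg_left ih hD.pos.le
      _ = D ^ (k + 1) * φ t := by ring

theorem DoublingWith.map_mul_le_pow {k : ℕ} {c : ℝ} (hc : |c| ≤ 2 ^ k) (t : ℝ) :
    φ (c * t) ≤ D ^ k * φ t := by
  refine le_trans (φ.map_le_map_of_abs_le ?_) (hD.map_two_pow_mul_le k t)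
  rw [abs_mul, abs_mul, abs_of_pos (by positivity : (0 : ℝ) < 2 ^ k)]
  exact mul_le_mul_of_nonneg_right hc (abs_nonneg t)

/-- A perturbation of size `φ(2 ^ k b)` changes `φ(a)` only by the factor `1 + 2⁻ᵏ D`. -/
theorem DoublingWith.map_add_le_add (k : ℕ) (a b : ℝ) :
    φ (a + b) ≤ (1 + 2⁻¹ ^ k * D) * φ a + D ^ (k + 1) * φ b := by
  have hl0 : (0 : ℝ) ≤ 2⁻¹ ^ k := by positivity
  have hl1 : (2⁻¹ : ℝ) ^ k ≤ 1 := pow_le_one₀ (by norm_num) (by norm_num)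
  -- The point `a + b` sits at parameter 2⁻ᵏ on the segment from `a` to `a + 2 ^ k * b`; the small
  -- weight of the far end keeps the coefficient of `φ a` close to 1.
  have h := φ.convex.2 (Set.mem_univ a) (Set.mem_univ (a + 2 ^ k * b)) (sub_nonneg.2 hl1) hl0
    (by ring)
  simp only [smul_eq_mul] at h
  have h1 : (1 - 2⁻¹ ^ k) * a + 2⁻¹ ^ k * (a + 2 ^ k * b) = a + b := by
    have : (2⁻¹ : ℝ) ^ k * 2 ^ k = 1 := by rw [← mul_pow]; norm_num
    linear_combination b * this
  rw [h1] at h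
  have h2 := hD.map_add_le a (2 ^ k * b)
  have h3 := hD.map_two_pow_mul_le k b
  have h4 : (2⁻¹ : ℝ) ^ k * φ (a + 2 ^ k * b) ≤ 2⁻¹ ^ k * (D * (φ a + D ^ k * φ b)) := by
    refine mul_le_mul_of_nonneg_left (h2.trans ?_) hl0
    exact mul_le_mul_of_nonneg_left (by linarith) hD.pos.le
  have h5 : (2⁻¹ : ℝ) ^ k * (D ^ (k + 1) * φ b) ≤ D ^ (k + 1) * φ b :=
    mul_le_of_le_one_left (mul_nonneg (pow_nonneg hD.pos.le _) (φ.nonneg b)) hl1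
  have h6 : (1 - 2⁻¹ ^ k) * φ a ≤ φ a := by nlinarith [φ.nonneg a]
  calc φ (a + b) ≤ _ := h
    _ ≤ φ a + 2⁻¹ ^ k * (D * (φ a + D ^ k * φ b)) := add_le_add h6 h4
    _ = (1 + 2⁻¹ ^ k * D) * φ a + 2⁻¹ ^ k * (D ^ (k + 1) * φ b) := by ring
    _ ≤ _ := by linarith

omit hD

/-! ### The derivative of an `N`-function -/

theorem IsNFunction.hasDerivAt_zero (hφ : φ.IsNFunction) : HasDerivAt φ 0 0 := by
  rw [hasDerivAt_iff_tendsto_slope]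
  refine hφ.tendsto_zero.congr' ?_
  filter_upwards with t
  simp [slope_def_field, φ.map_zero]

theorem IsNFunction.differentiable (hφ : φ.IsNFunction)
    (hd : ∀ t : ℝ, t ≠ 0 → DifferentiableAt ℝ φ t) : Differentiable ℝ φ := fun t => by
  rcases eq_or_ne t 0 with rfl | h
  · exact hφ.hasDerivAt_zero.differentiableAt
  · exact hd t h

theorem tangent_le (hd : Differentiable ℝ φ) (a b : ℝ) :
    φ a + deriv φ a * (b - a) ≤ φ b := by
  rcases lt_trichotomy a b with h | rfl | h
  · have := φ.convex.deriv_le_slope (Set.mem_univ a) (Set.mem_univ b) h (hd a)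
    rw [slope_def_field, le_div_iff₀ (sub_pos.2 h)] at this
    linarith
  · simp
  · have := φ.convex.slope_le_deriv (Set.mem_univ b) (Set.mem_univ a) h (hd a)
    rw [slope_def_field, div_le_iff₀ (sub_pos.2 h)] at this
    linarith

theorem deriv_neg' (t : ℝ) : deriv φ (-t) = -deriv φ t := by
  have h : (fun x => φ (-x)) = φ := funext φ.even
  have := deriv_comp_neg (f := φ.toFun) (x := t)
  rw [h] at this
  rw [this, neg_neg]

/-- Plays the role of Young's inequality without the conjugate: the tangent at `a` lies below the
graph at `a ± b`, and the term `φ a ≥ 0` is dropped. -/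
theorem abs_deriv_mul_le (hd : Differentiable ℝ φ) (a b : ℝ) :
    |deriv φ a * b| ≤ φ (|a| + |b|) := by
  have key : ∀ c : ℝ, |c| = |b| → deriv φ a * c ≤ φ (|a| + |b|) := fun c hc => by
    have h := tangent_le hd a (a + c)
    have h2 : φ (a + c) ≤ φ (|a| + |b|) := φ.map_le_map_of_abs_le <| by
      rw [abs_of_nonneg (by positivity : 0 ≤ |a| + |b|), ← hc]
      exact abs_add_le a c
    have := φ.nonneg a
    rw [add_sub_cancel_left] at h
    linarith
  rw [abs_le']
  refine ⟨key b rfl, ?_⟩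
  rw [← mul_neg]
  exact key (-b) (abs_neg b)

theorem DoublingWith.abs_deriv_mul_le (hD : φ.DoublingWith D) (hd : Differentiable ℝ φ)
    (a b : ℝ) : |deriv φ a * b| ≤ D * (φ a + φ b) :=
  (YoungFunction.abs_deriv_mul_le hd a b).trans (hD.map_abs_add_le a b)

theorem strictMono_deriv (hc : StrictConvexOn ℝ Set.univ φ) (hd : Differentiable ℝ φ) :
    StrictMono (deriv φ) :=
  fun _ _ h => hc.strictMonoOn_deriv (fun x _ => hd x) (Set.mem_univ _) (Set.mem_univ _) h

theorem deriv_sub_mul_sub_nonneg (hc : StrictConvexOn ℝ Set.univ φ) (hd : Differentiable ℝ φ)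
    (a b : ℝ) : 0 ≤ (deriv φ a - deriv φ b) * (a - b) := by
  have hm := (strictMono_deriv hc hd).monotone
  rcases le_total a b with h | h
  · exact mul_nonneg_of_nonpos_of_nonpos (sub_nonpos.2 (hm h)) (sub_nonpos.2 h)
  · exact mul_nonneg (sub_nonneg.2 (hm h)) (sub_nonneg.2 h)

theorem eq_of_deriv_sub_mul_sub_eq_zero (hc : StrictConvexOn ℝ Set.univ φ)
    (hd : Differentiable ℝ φ) {a b : ℝ} (h : (deriv φ a - deriv φ b) * (a - b) = 0) :
    a = b := by
  rcases mul_eq_zero.1 h with h | h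
  · exact (strictMono_deriv hc hd).injective (sub_eq_zero.1 h)
  · exact sub_eq_zero.1 h

/-! ### Lower bounds for the convexity defect -/

/-- If the conjugate of `φ` is doubling, then `φ(ℓt) ≥ 2ℓ φ(t)` for some `ℓ ≥ 2`. -/
theorem IsNFunction.exists_two_mul_le (hφ : φ.IsNFunction) (hd : Differentiable ℝ φ)
    (hψ : IsDoubling φ.conjugate) : ∃ l : ℝ, 2 ≤ l ∧ ∀ t, 2 * l * φ t ≤ φ (l * t) := by
  obtain ⟨K', hK', hψ⟩ := hψ
  -- Enlarging the doubling constant to at least 4 makes `l = K / 2` at least 2.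
  set K := max K' 4 with hK
  have hK4 : 4 ≤ K := le_max_right _ _
  have hψ0 : ∀ s, 0 ≤ φ.conjugate s := fun s =>
    (hφ.isLUB_conjugate s).1 ⟨0, le_rfl, by simp [φ.map_zero]⟩
  refine ⟨K / 2, by linarith, ?_⟩
  have key : ∀ t, 0 ≤ t → 2 * (K / 2) * φ t ≤ φ (K / 2 * t) := fun t ht => by
    -- At the slope s = φ'(t) Young's inequality is an equality, ψ(s) = ts - φ(t). Testing ψ(2s) at
    -- the point (K/2)t and using ψ(2s) ≤ Kψ(s), the terms Kts cancel and leave Kφ(t) ≤ φ((K/2)t).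
    set s := deriv φ t
    have hs : 0 ≤ s := by
      have := (φ.convex.monotoneOn_deriv fun x _ => hd x) (Set.mem_univ 0) (Set.mem_univ t) ht
      rwa [hφ.hasDerivAt_zero.deriv] at this
    have h1 : φ.conjugate s ≤ t * s - φ t := by
      refine (hφ.isLUB_conjugate s).2 ?_
      rintro y ⟨r, -, rfl⟩
      have := tangent_le hd t r
      rw [abs_of_nonneg hs]
      linarith
    have h2 : φ.conjugate (2 * s) ≤ K * φ.conjugate s :=
      (hψ s hs).trans (mul_le_mul_of_nonneg_right (le_max_left _ _) (hψ0 s))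
    have h3 : K / 2 * t * |2 * s| - φ (K / 2 * t) ≤ φ.conjugate (2 * s) :=
      (hφ.isLUB_conjugate (2 * s)).1 ⟨K / 2 * t, by positivity, rfl⟩
    rw [abs_of_nonneg (by positivity)] at h3
    have h4 : K * φ.conjugate s ≤ K * (t * s - φ t) :=
      mul_le_mul_of_nonneg_left h1 (by linarith)
    linarith
  intro t
  have := key |t| (abs_nonneg t)
  rwa [φ.map_abs, ← φ.map_abs (K / 2 * |t|), abs_mul, abs_abs, ← abs_mul, φ.map_abs] at this

/-- For |a| much smaller than |b| the midpoint is about b/2. Convexity alone gives φ(b/2) ≤ φ(b)/2;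
interpolating between b and b/l, where φ(b/l) ≤ φ(b)/(2l), improves the factor 1/2 strictly. No
bound on the size of b is needed. -/
theorem exists_mul_le_defect {l : ℝ} (hl : 2 ≤ l) (h : ∀ t, 2 * l * φ t ≤ φ (l * t)) :
    ∃ L c : ℝ, 0 < L ∧ 0 < c ∧ ∀ a b, L * |a| ≤ |b| → c * φ b ≤ φ.defect a b := by
  set κ := 1 / (2 * l - 2) with hκ
  have hκ0 : 0 < κ := by rw [hκ]; apply one_div_pos.2; linarith
  have hκl : κ * (2 * l - 2) = 1 := by rw [hκ]; exact one_div_mul_cancel (by linarith)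
  -- The chord from (1/l, 1/(2l)) to (1, 1) has slope 1 + κ and at 1/2 lies κ/2 below 1/2. The value
  -- of `L` is such that moving from 1/2 to τ = (1 + 1/L)/2 gives back only κ/4 of this gain.
  refine ⟨2 * (1 + κ) / κ, κ / 4, by positivity, by positivity, fun a b hab => ?_⟩
  have ha : |a| ≤ κ / (2 * (1 + κ)) * |b| := by
    calc |a| = κ / (2 * (1 + κ)) * (2 * (1 + κ) / κ * |a|) := by field_simp
      _ ≤ _ := mul_le_mul_of_nonneg_left hab (by positivity)
  set τ := (1 + κ / (2 * (1 + κ))) / 2 with hτ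
  set r := (1 - τ) * (l / (l - 1)) with hr
  have hl1 : 0 < l - 1 := by linarith
  have hq : κ / (2 * (1 + κ)) ≤ 1 / 2 := by
    rw [div_le_div_iff₀ (by positivity) (by norm_num)]; linarith
  have hq0 : 0 < κ / (2 * (1 + κ)) := by positivity
  have h1 : φ ((a + b) / 2) ≤ φ (τ * b) := by
    apply φ.map_le_map_of_abs_le
    have hτ0 : 0 < τ := by rw [hτ]; linarith
    rw [abs_div, abs_mul, abs_of_pos (by norm_num : (0 : ℝ) < 2), abs_of_pos hτ0]
    have := abs_add_le a b
    rw [hτ]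
    linarith
  have h2 : φ (l⁻¹ * b) ≤ (2 * l)⁻¹ * φ b := by
    have := h (l⁻¹ * b)
    rw [← mul_assoc, mul_inv_cancel₀ (by linarith), one_mul] at this
    rw [inv_mul_eq_div (2 * l), le_div_iff₀ (by linarith), mul_comm]
    exact this
  have hr0 : 0 ≤ r := mul_nonneg (by rw [hτ]; linarith) (by positivity)
  have hr1 : r ≤ 1 := by
    rw [hr, mul_div_assoc', div_le_one hl1]
    have : τ = 1 / 2 + κ / (2 * (1 + κ)) / 2 := by rw [hτ]; ring
    have hx : κ / (2 * (1 + κ)) * (2 * (1 + κ)) = κ := by field_simp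
    set q := κ / (2 * (1 + κ))
    have h5 : q * (2 * (1 + κ)) * (2 * l - 2) = 1 := by rw [hx]; exact hκl
    have h6 : q * (4 * l - 2) = 1 := by
      have : (2 * (1 + κ)) * (2 * l - 2) = 4 * l - 2 := by linear_combination 2 * hκl
      rw [← this, ← mul_assoc, h5]
    nlinarith
  have h3 := φ.convex.2 (Set.mem_univ (l⁻¹ * b)) (Set.mem_univ b) hr0 (sub_nonneg.2 hr1) (by ring)
  simp only [smul_eq_mul] at h3
  have h4 : r * (l⁻¹ * b) + (1 - r) * b = τ * b := by
    rw [hr]; field_simp; ring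
  rw [h4] at h3
  have h5 : r * φ (l⁻¹ * b) ≤ r * ((2 * l)⁻¹ * φ b) := mul_le_mul_of_nonneg_left h2 hr0
  have h6 : r * (2 * l)⁻¹ + (1 - r) = 1 / 2 - κ / 4 := by
    have e1 : r * (1 - (2 * l)⁻¹) = (1 - τ) * (1 + κ) := by
      rw [hr, hκ]
      have : l - 1 ≠ 0 := hl1.ne'
      have : 2 * l - 2 ≠ 0 := by linarith
      have : 2 * l - 2 = 2 * (l - 1) := by ring
      rw [this]
      field_simp
      ring
    have e2 : (1 - τ) * (1 + κ) = 1 / 2 + κ / 4 := by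
      rw [hτ]; field_simp; ring
    linarith
  have h7 : φ ((a + b) / 2) ≤ (1 / 2 - κ / 4) * φ b := by
    rw [← h6]; linarith
  have := φ.nonneg a
  rw [defect]
  linarith

/-- Compactness: the defect is continuous and, by strict convexity, positive off the diagonal. This
covers bounded values, where `exists_mul_le_defect` says nothing about comparable `a` and `b`. -/
theorem exists_le_defect (hc : StrictConvexOn ℝ Set.univ φ) (M : ℝ) {ε : ℝ} (hε : 0 < ε) :
    ∃ δ, 0 < δ ∧ ∀ a b, |a| ≤ M → |b| ≤ M → ε ≤ |a - b| → δ ≤ φ.defect a b := by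
  set K : Set (ℝ × ℝ) := (Metric.closedBall 0 M ×ˢ Metric.closedBall 0 M) ∩ {p | ε ≤ |p.1 - p.2|}
    with hK
  have hKc : IsCompact K := ((isCompact_closedBall 0 M).prod (isCompact_closedBall 0 M)).inter_right
    (isClosed_le continuous_const (by fun_prop))
  have hmem : ∀ a b, |a| ≤ M → |b| ≤ M → ε ≤ |a - b| → (a, b) ∈ K := fun a b h1 h2 h3 =>
    ⟨⟨by simpa using h1, by simpa using h2⟩, h3⟩
  rcases K.eq_empty_or_nonempty with h | h
  · exact ⟨1, one_pos, fun a b h1 h2 h3 => by simpa [h] using hmem a b h1 h2 h3⟩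
  · obtain ⟨p, hp, hmin⟩ := hKc.exists_isMinOn h φ.continuous_defect.continuousOn
    refine ⟨φ.defect p.1 p.2, ?_, fun a b h1 h2 h3 => hmin (hmem a b h1 h2 h3)⟩
    have hne : p.1 ≠ p.2 := fun h => by
      have := hp.2
      simp only [Set.mem_ofPred_eq, h, sub_self, abs_zero] at this
      linarith
    have := hc.2 (Set.mem_univ p.1) (Set.mem_univ p.2) hne (by norm_num : (0 : ℝ) < 1 / 2)
      (by norm_num : (0 : ℝ) < 1 / 2) (by norm_num)
    simp only [smul_eq_mul] at this
    have h : (p.1 + p.2) / 2 = 1 / 2 * p.1 + 1 / 2 * p.2 := by ring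
    rw [defect, h]
    linarith

end YoungFunction


/-! ### Modulars and Luxemburg norms of doubling Young functions -/

section Modular

variable {Z : Type*} [MeasurableSpace Z] {φ : YoungFunction} {ν : Measure Z} {D : ℝ}

theorem aemeasurable_ofReal_young {f : Z → ℝ} (hf : AEMeasurable f ν) :
    AEMeasurable (fun z => ENNReal.ofReal (φ (f z))) ν :=
  φ.measurable.comp_aemeasurable hf

theorem modular_mono {f g : Z → ℝ} (h : ∀ z, |f z| ≤ |g z|) : modular φ ν f ≤ modular φ ν g :=
  lintegral_mono fun z => ENNReal.ofReal_le_ofReal (φ.map_le_map_of_abs_le (h z))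

theorem modular_neg (f : Z → ℝ) : modular φ ν (fun z => -f z) = modular φ ν f := by
  simp only [modular, φ.even]

theorem ofReal_young_add_le (hD : φ.DoublingWith D) (a b : ℝ) :
    ENNReal.ofReal (φ (a + b)) ≤
      ENNReal.ofReal D * (ENNReal.ofReal (φ a) + ENNReal.ofReal (φ b)) := by
  rw [← ENNReal.ofReal_add (φ.nonneg _) (φ.nonneg _), ← ENNReal.ofReal_mul hD.pos.le]
  exact ENNReal.ofReal_le_ofReal (hD.map_add_le a b)

theorem modular_add_le_of_doubling (hD : φ.DoublingWith D) {f : Z → ℝ} (hf : AEMeasurable f ν)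
    (g : Z → ℝ) : modular φ ν (fun z => f z + g z) ≤
      ENNReal.ofReal D * (modular φ ν f + modular φ ν g) := by
  unfold modular
  rw [← lintegral_add_left' (aemeasurable_ofReal_young hf),
    ← lintegral_const_mul' _ _ ENNReal.ofReal_ne_top]
  exact lintegral_mono fun z => ofReal_young_add_le hD _ _

theorem modular_sub_le_of_doubling (hD : φ.DoublingWith D) {f : Z → ℝ} (hf : AEMeasurable f ν)
    (g : Z → ℝ) : modular φ ν (fun z => f z - g z) ≤
      ENNReal.ofReal D * (modular φ ν f + modular φ ν g) := by
  simpa only [sub_eq_add_neg, modular_neg] using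
    modular_add_le_of_doubling hD hf (fun z => -g z)

theorem modular_const_mul_le (hD : φ.DoublingWith D) {k : ℕ} {c : ℝ} (hc : |c| ≤ 2 ^ k)
    (f : Z → ℝ) :
    modular φ ν (fun z => c * f z) ≤ ENNReal.ofReal (D ^ k) * modular φ ν f := by
  unfold modular
  rw [← lintegral_const_mul' _ _ ENNReal.ofReal_ne_top]
  refine lintegral_mono fun z => ?_
  rw [← ENNReal.ofReal_mul (pow_nonneg hD.pos.le _)]
  exact ENNReal.ofReal_le_ofReal (hD.map_mul_le_pow hc _)

theorem exists_modular_const_mul_le (hD : φ.DoublingWith D) (c : ℝ) :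
    ∃ C : ℝ, 0 < C ∧ ∀ {Z : Type*} [MeasurableSpace Z] (ν : Measure Z) (f : Z → ℝ),
      modular φ ν (fun z => c * f z) ≤ ENNReal.ofReal C * modular φ ν f := by
  obtain ⟨k, hk⟩ := pow_unbounded_of_one_lt |c| (one_lt_two : (1 : ℝ) < 2)
  exact ⟨D ^ k, pow_pos hD.pos _, fun ν f => modular_const_mul_le hD hk.le f⟩

theorem modular_const_mul_lt_top (hD : φ.DoublingWith D) (c : ℝ) {f : Z → ℝ}
    (hf : modular φ ν f < ∞) : modular φ ν (fun z => c * f z) < ∞ := by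
  obtain ⟨C, -, hC⟩ := exists_modular_const_mul_le hD c
  exact (hC ν f).trans_lt (ENNReal.mul_lt_top ENNReal.ofReal_lt_top hf)

theorem modular_add_lt_top (hD : φ.DoublingWith D) {f g : Z → ℝ} (hfm : AEMeasurable f ν)
    (hf : modular φ ν f < ∞) (hg : modular φ ν g < ∞) :
    modular φ ν (fun z => f z + g z) < ∞ :=
  (modular_add_le_of_doubling hD hfm g).trans_lt
    (ENNReal.mul_lt_top ENNReal.ofReal_lt_top (ENNReal.add_lt_top.2 ⟨hf, hg⟩))

theorem mem_orlicz_iff (hD : φ.DoublingWith D) (f : Z →ₘ[ν] ℝ) :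
    f ∈ orlicz φ ν ↔ modular φ ν f < ∞ := by
  refine ⟨?_, fun h => ⟨1, one_pos, by simpa using h⟩⟩
  rintro ⟨α, hα, hf⟩
  have := modular_const_mul_lt_top hD α hf
  convert this using 2
  funext z
  field_simp

theorem luxNorm_le_of_modular_le {f : Z →ₘ[ν] ℝ} {α : ℝ} (hα : 0 < α)
    (h : modular φ ν (fun z => f z / α) ≤ 1) : luxNorm φ ν f ≤ α :=
  csInf_le (luxSet_bddBelow φ ν f) ⟨hα, h⟩

theorem modular_div_le_one_of_luxNorm_lt {f : Z →ₘ[ν] ℝ} (hf : f ∈ orlicz φ ν) {α : ℝ}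
    (h : luxNorm φ ν f < α) : modular φ ν (fun z => f z / α) ≤ 1 := by
  obtain ⟨β, ⟨hβ0, hβ⟩, hβα⟩ := exists_lt_of_csInf_lt (luxSet_nonempty φ ν hf) h
  refine (modular_mono fun z => ?_).trans hβ
  rw [abs_div, abs_div, abs_of_pos hβ0, abs_of_pos (hβ0.trans hβα)]
  exact div_le_div_of_nonneg_left (abs_nonneg _) hβ0 hβα.le

theorem modular_le_of_luxNorm_lt {f : Z →ₘ[ν] ℝ} (hf : f ∈ orlicz φ ν) {ε : ℝ} (hε : ε ≤ 1)
    (h : luxNorm φ ν f < ε) : modular φ ν f ≤ ENNReal.ofReal ε := by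
  have h0 : 0 < ε := (luxNorm_nonneg φ ν f).trans_lt h
  have h1 : modular φ ν f = modular φ ν (fun z => ε * (f z / ε)) := by
    congr 1
    funext z
    field_simp
  rw [h1]
  calc _ ≤ _ := modular_smul_le φ ν h0.le hε _
    _ ≤ ENNReal.ofReal ε * 1 := by gcongr; exact modular_div_le_one_of_luxNorm_lt hf h
    _ = _ := mul_one _

/-- Doubling bounds the modular of f/ε by C times that of f, so δ = 1/C works, for all measure
spaces at once. Hence convergence to 0 in modular implies convergence in norm. -/
theorem exists_luxNorm_le_of_modular_le (hD : φ.DoublingWith D) {ε : ℝ} (hε : 0 < ε) :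
    ∃ δ : ℝ≥0∞, 0 < δ ∧ ∀ {Z : Type*} [MeasurableSpace Z] (ν : Measure Z) (f : Z →ₘ[ν] ℝ),
      modular φ ν f ≤ δ → luxNorm φ ν f ≤ ε := by
  obtain ⟨C, hC0, hC⟩ := exists_modular_const_mul_le hD ε⁻¹
  refine ⟨ENNReal.ofReal C⁻¹, ENNReal.ofReal_pos.2 (inv_pos.2 hC0), fun ν f hf =>
    luxNorm_le_of_modular_le hε ?_⟩
  simp only [div_eq_inv_mul]
  refine (hC ν f).trans ?_
  calc _ ≤ ENNReal.ofReal C * ENNReal.ofReal C⁻¹ := by gcongr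
    _ = 1 := by rw [← ENNReal.ofReal_mul hC0.le, mul_inv_cancel₀ hC0.ne', ENNReal.ofReal_one]

theorem tendsto_luxNorm_zero (hD : φ.DoublingWith D) {ι : Type*} {l : Filter ι}
    {f : ι → Z →ₘ[ν] ℝ} (h : Tendsto (fun i => modular φ ν (f i)) l (𝓝 0)) :
    Tendsto (fun i => luxNorm φ ν (f i)) l (𝓝 0) := by
  rw [Metric.tendsto_nhds]
  intro ε hε
  obtain ⟨δ, hδ, H⟩ := exists_luxNorm_le_of_modular_le hD (half_pos hε)
  filter_upwards [h.eventually_le_const hδ] with i hi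
  rw [Real.dist_0_eq_abs, abs_of_nonneg (luxNorm_nonneg φ ν _)]
  linarith [H ν (f i) hi]

/-- A factor `C ≥ 1` between modulars, valid at every scale, becomes the same factor between norms
because φ(t/C) ≤ φ(t)/C. -/
theorem luxNorm_le_mul {Z' : Type*} [MeasurableSpace Z'] {ν' : Measure Z'} {C : ℝ} (hC : 1 ≤ C)
    {f : Z →ₘ[ν] ℝ} {g : Z' →ₘ[ν'] ℝ} (hg : g ∈ orlicz φ ν')
    (h : ∀ α : ℝ, 0 < α → modular φ ν (fun z => f z / α) ≤
      ENNReal.ofReal C * modular φ ν' (fun z => g z / α)) :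
    luxNorm φ ν f ≤ C * luxNorm φ ν' g := by
  have hC0 : 0 < C := by linarith
  rw [← div_le_iff₀' hC0]
  refine le_of_forall_gt_imp_ge_of_dense fun α hα => ?_
  have hα0 := (luxNorm_nonneg φ ν' g).trans_lt hα
  rw [div_le_iff₀' hC0]
  refine luxNorm_le_of_modular_le (mul_pos hC0 hα0) ?_
  have h1 : (fun z => f z / (C * α)) = fun z => C⁻¹ * (f z / α) := by
    funext z
    field_simp
  rw [h1]
  calc _ ≤ ENNReal.ofReal C⁻¹ * modular φ ν (fun z => f z / α) :=
        modular_smul_le φ ν (inv_nonneg.2 hC0.le) (inv_le_one_of_one_le₀ hC) _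
    _ ≤ ENNReal.ofReal C⁻¹ * (ENNReal.ofReal C * 1) := by
        gcongr
        exact (h α hα0).trans (by gcongr; exact modular_div_le_one_of_luxNorm_lt hg hα)
    _ = 1 := by
        rw [mul_one, ← ENNReal.ofReal_mul (inv_nonneg.2 hC0.le), inv_mul_cancel₀ hC0.ne',
          ENNReal.ofReal_one]

/-! ### Convergence of minimizing sequences -/

theorem lintegral_defect_add (v w : Z → ℝ) (hv : AEMeasurable v ν) (hw : AEMeasurable w ν) :
    ∫⁻ z, ENNReal.ofReal (φ.defect (v z) (w z)) ∂ν + modular φ ν (fun z => (v z + w z) / 2) =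
      2⁻¹ * (modular φ ν v + modular φ ν w) := by
  have hm : AEMeasurable (fun z => ENNReal.ofReal (φ ((v z + w z) / 2))) ν :=
    aemeasurable_ofReal_young ((hv.add hw).div_const 2)
  unfold modular
  rw [← lintegral_add_left' (aemeasurable_ofReal_young hv),
    ← lintegral_const_mul' _ _ (by simp), ← lintegral_add_right' _ hm]
  refine lintegral_congr fun z => ?_
  rw [← ENNReal.ofReal_add (φ.defect_nonneg _ _) (φ.nonneg _),
    ← ENNReal.ofReal_add (φ.nonneg _) (φ.nonneg _)]
  have : (2⁻¹ : ℝ≥0∞) = ENNReal.ofReal 2⁻¹ := by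
    rw [ENNReal.ofReal_inv_of_pos two_pos, ENNReal.ofReal_ofNat]
  rw [this, ← ENNReal.ofReal_mul (by norm_num), YoungFunction.defect]
  congr 1
  ring

theorem aemeasurable_defect {v w : Z → ℝ} (hv : AEMeasurable v ν) (hw : AEMeasurable w ν) :
    AEMeasurable (fun z => ENNReal.ofReal (φ.defect (v z) (w z))) ν :=
  (φ.continuous_defect.measurable.comp_aemeasurable (hv.prodMk hw)).ennreal_ofReal

/-- Markov's inequality with φ(2ʲ) ≥ 2ʲφ(1). The geometric decay in `j` is what the Borel–Cantelli
argument below sums. -/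
theorem measure_two_pow_le_abs_le (f : Z → ℝ) (hf : AEMeasurable f ν) (j : ℕ) :
    ν {z | 2 ^ j ≤ |f z|} ≤ modular φ ν f * (ENNReal.ofReal (φ 1))⁻¹ * 2⁻¹ ^ j := by
  have h1 : 0 < φ 1 := φ.pos_of_ne_zero one_ne_zero
  have hp : (0 : ℝ) < 2 ^ j := by positivity
  have hj : 2 ^ j * φ 1 ≤ φ (2 ^ j) := by
    have := φ.map_mul_le (c := (2 ^ j)⁻¹) (by positivity)
      (inv_le_one_of_one_le₀ (one_le_pow₀ one_le_two)) (2 ^ j)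
    rwa [inv_mul_cancel₀ hp.ne', ← div_eq_inv_mul, le_div_iff₀ hp, mul_comm] at this
  have hsub : {z | 2 ^ j ≤ |f z|} ⊆
      {z | ENNReal.ofReal (2 ^ j * φ 1) ≤ ENNReal.ofReal (φ (f z))} := fun z hz =>
    ENNReal.ofReal_le_ofReal (hj.trans (φ.map_le_map_of_abs_le (by rwa [abs_of_pos hp])))
  refine (measure_mono hsub).trans
    ((meas_ge_le_lintegral_div (aemeasurable_ofReal_young hf) ?_ ENNReal.ofReal_ne_top).trans_eq ?_)
  · exact (ENNReal.ofReal_pos.2 (by positivity)).ne'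
  · rw [ENNReal.ofReal_mul hp.le, ENNReal.ofReal_pow zero_le_two, ENNReal.ofReal_ofNat,
      ENNReal.div_eq_inv_mul, ENNReal.mul_inv (Or.inl (by positivity))
        (Or.inl (by finiteness)), ENNReal.inv_pow, modular]
    ring

/-- A sequence which becomes minimizing for the midpoint defect has an a.e. convergent
subsequence. -/
theorem exists_subseq_ae_tendsto (hc : StrictConvexOn ℝ Set.univ φ) {v : ℕ → Z → ℝ}
    (hv : ∀ n, AEMeasurable (v n) ν) {M : ℝ≥0∞} (hM : M ≠ ∞)
    (hb : ∀ᶠ n in atTop, modular φ ν (v n) ≤ M)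
    (hd : ∀ ε : ℝ≥0∞, 0 < ε → ∃ N, ∀ n ≥ N, ∀ k ≥ N,
      ∫⁻ z, ENNReal.ofReal (φ.defect (v n z) (v k z)) ∂ν ≤ ε) :
    ∃ ns : ℕ → ℕ, StrictMono ns ∧
      ∀ᵐ z ∂ν, ∃ a, Tendsto (fun j => v (ns j) z) atTop (𝓝 a) := by
  choose δ hδ0 hδ using fun j : ℕ => YoungFunction.exists_le_defect hc (2 ^ j)
    (by positivity : (0 : ℝ) < 2⁻¹ ^ j)
  obtain ⟨N₀, hN₀⟩ := eventually_atTop.1 hb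
  -- The threshold δⱼ 2⁻ʲ is chosen so that, by Markov, the set where the defect exceeds δⱼ has
  -- measure at most 2⁻ʲ.
  obtain ⟨ns, hns, H⟩ := extraction_forall_of_eventually' (P := fun j k : ℕ =>
      N₀ ≤ k ∧ ∀ n ≥ k, ∀ n' ≥ k, ∫⁻ z, ENNReal.ofReal (φ.defect (v n z) (v n' z)) ∂ν ≤
        ENNReal.ofReal (δ j) * 2⁻¹ ^ j) fun j => by
    obtain ⟨N, hN⟩ := hd (ENNReal.ofReal (δ j) * 2⁻¹ ^ j)
      (ENNReal.mul_pos (ENNReal.ofReal_pos.2 (hδ0 j)).ne' (by simp))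
    exact ⟨max N N₀, fun k hk => ⟨(le_max_right _ _).trans hk, fun n hn n' hn' =>
      hN n ((le_max_left _ _).trans (hk.trans hn)) n' ((le_max_left _ _).trans (hk.trans hn'))⟩⟩
  refine ⟨ns, hns, ?_⟩
  set C : ℝ≥0∞ := M * (ENNReal.ofReal (φ 1))⁻¹ with hC
  have hCt : C ≠ ∞ := ENNReal.mul_ne_top hM (ENNReal.inv_ne_top.2
    (ENNReal.ofReal_pos.2 (φ.pos_of_ne_zero one_ne_zero)).ne')
  -- Outside the bad set `B j` both values are below 2ʲ and the defect is below δⱼ, so consecutive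
  -- terms differ by less than 2⁻ʲ. The measures of the bad sets are summable, hence almost every
  -- point lies in finitely many of them and its sequence is Cauchy.
  set B : ℕ → Set Z := fun j => {z | 2 ^ j ≤ |v (ns j) z|} ∪ {z | 2 ^ j ≤ |v (ns (j + 1)) z|} ∪
    {z | ENNReal.ofReal (δ j) ≤ ENNReal.ofReal (φ.defect (v (ns j) z) (v (ns (j + 1)) z))} with hB
  have hBm : ∀ j, ν (B j) ≤ (C + C + 1) * 2⁻¹ ^ j := fun j => by
    have hl : ns j ≤ ns (j + 1) := hns.monotone j.le_succ
    have e1 : ∀ n, N₀ ≤ n → ν {z | 2 ^ j ≤ |v n z|} ≤ C * 2⁻¹ ^ j := fun n hn =>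
      (measure_two_pow_le_abs_le (φ := φ) (v n) (hv n) j).trans (by rw [hC]; gcongr; exact hN₀ n hn)
    have e2 : ν {z | ENNReal.ofReal (δ j) ≤
        ENNReal.ofReal (φ.defect (v (ns j) z) (v (ns (j + 1)) z))} ≤ 2⁻¹ ^ j := by
      have hp := ENNReal.ofReal_pos.2 (hδ0 j)
      refine (meas_ge_le_lintegral_div (aemeasurable_defect (hv _) (hv _)) hp.ne'
        ENNReal.ofReal_ne_top).trans ?_
      rw [ENNReal.div_le_iff' hp.ne' ENNReal.ofReal_ne_top]
      exact (H j).2 _ le_rfl _ hl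
    calc ν (B j) ≤ C * 2⁻¹ ^ j + C * 2⁻¹ ^ j + 2⁻¹ ^ j :=
          (measure_union_le _ _).trans (add_le_add ((measure_union_le _ _).trans
            (add_le_add (e1 _ (H j).1) (e1 _ ((H j).1.trans hl)))) e2)
      _ = _ := by ring
  have hsum : ∑' j, ν (B j) ≠ ∞ := by
    refine ne_top_of_le_ne_top ?_ (ENNReal.tsum_le_tsum hBm)
    rw [ENNReal.tsum_mul_left, ENNReal.tsum_geometric]
    refine ENNReal.mul_ne_top (by finiteness) ?_
    rw [ENNReal.one_sub_inv_two, inv_inv]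
    exact ENNReal.ofNat_ne_top
  filter_upwards [ae_eventually_notMem hsum] with z hz
  refine cauchySeq_tendsto_of_complete (cauchySeq_of_summable_dist ?_)
  refine Summable.of_norm_bounded_eventually_nat (g := fun j : ℕ => (2⁻¹ : ℝ) ^ j)
    (summable_geometric_of_lt_one (by norm_num) (by norm_num)) ?_
  filter_upwards [hz] with j hj
  simp only [hB, Set.mem_union, Set.mem_ofPred_eq, not_or, not_le] at hj
  rw [Real.norm_of_nonneg dist_nonneg, Real.dist_eq]
  by_contra! hlt
  exact absurd hj.2 (not_lt.2 (ENNReal.ofReal_le_ofReal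
    (hδ j _ _ hj.1.1.le hj.1.2.le hlt.le)))

theorem lintegral_le_of_ae_tendsto {f : ℕ → Z → ℝ≥0∞} {g : Z → ℝ≥0∞} {C : ℝ≥0∞}
    (hf : ∀ n, AEMeasurable (f n) ν) (hC : ∀ᶠ n in atTop, ∫⁻ z, f n z ∂ν ≤ C)
    (h : ∀ᵐ z ∂ν, Tendsto (fun n => f n z) atTop (𝓝 (g z))) : ∫⁻ z, g z ∂ν ≤ C :=
  calc ∫⁻ z, g z ∂ν = ∫⁻ z, liminf (fun n => f n z) atTop ∂ν :=
        lintegral_congr_ae (h.mono fun _ hz => hz.liminf_eq.symm)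
    _ ≤ liminf (fun n => ∫⁻ z, f n z ∂ν) atTop := lintegral_liminf_le' hf
    _ ≤ C := liminf_le_of_frequently_le' hC.frequently

/-- A minimizing sequence of the modular on a midpoint convex set has a subsequence which
converges almost everywhere and in modular. -/
theorem exists_subseq_tendsto_modular (hD : φ.DoublingWith D)
    (hc : StrictConvexOn ℝ Set.univ φ) {l : ℝ} (hl : 2 ≤ l) (hφl : ∀ t, 2 * l * φ t ≤ φ (l * t))
    {v : ℕ → Z → ℝ} (hv : ∀ n, AEMeasurable (v n) ν) {m : ℝ≥0∞} (hm : m ≠ ∞)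
    (hlim : Tendsto (fun n => modular φ ν (v n)) atTop (𝓝 m))
    (hmid : ∀ n k, m ≤ modular φ ν (fun z => (v n z + v k z) / 2)) :
    ∃ ns : ℕ → ℕ, StrictMono ns ∧ ∃ w : Z → ℝ, Measurable w ∧
      (∀ᵐ z ∂ν, Tendsto (fun j => v (ns j) z) atTop (𝓝 (w z))) ∧
      Tendsto (fun j => modular φ ν (fun z => v (ns j) z - w z)) atTop (𝓝 0) ∧
      modular φ ν w ≤ m := by
  -- The defect integrates to the average of the two modulars minus the modular of the midpoint. The
  -- averages tend to `m` and midpoints have modular at least `m`.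
  have hd : ∀ ε : ℝ≥0∞, 0 < ε → ∃ N, ∀ n ≥ N, ∀ k ≥ N,
      ∫⁻ z, ENNReal.ofReal (φ.defect (v n z) (v k z)) ∂ν ≤ ε := fun ε hε => by
    obtain ⟨N, hN⟩ := eventually_atTop.1 (hlim.eventually_le_const (ENNReal.lt_add_right hm hε.ne'))
    refine ⟨N, fun n hn k hk => ?_⟩
    have := lintegral_defect_add (φ := φ) (v n) (v k) (hv n) (hv k)
    refine ENNReal.le_of_add_le_add_right hm ?_
    calc _ ≤ _ := add_le_add_right (hmid n k) _
      _ ≤ 2⁻¹ * ((m + ε) + (m + ε)) := by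
          rw [this]; gcongr <;> [exact hN n hn; exact hN k hk]
      _ = ε + m := by
          rw [← two_mul, ← mul_assoc, ENNReal.inv_mul_cancel two_ne_zero ENNReal.ofNat_ne_top,
            one_mul, add_comm]
  have hb : ∀ᶠ n in atTop, modular φ ν (v n) ≤ m + 1 :=
    hlim.eventually_le_const (ENNReal.lt_add_right hm one_ne_zero)
  obtain ⟨ns, hns, hns'⟩ := exists_subseq_ae_tendsto hc hv (by finiteness) hb hd
  obtain ⟨w, hwm, hw⟩ := measurable_limit_of_tendsto_metrizable_ae (fun j => hv (ns j)) hns'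
  have hρw : modular φ ν w ≤ m := by
    refine le_of_forall_gt_imp_ge_of_dense fun C hC => ?_
    refine lintegral_le_of_ae_tendsto (f := fun j z => ENNReal.ofReal (φ (v (ns j) z)))
      (fun j => aemeasurable_ofReal_young (hv _))
      ((hlim.comp hns.tendsto_atTop).eventually_le_const hC) ?_
    filter_upwards [hw] with z hz
    exact ENNReal.tendsto_ofReal ((φ.continuous'.tendsto _).comp hz)
  refine ⟨ns, hns, w, hwm, hw, ?_, hρw⟩
  -- Fatou's lemma in one of the two indices replaces that term of the sequence by the limit `w`.
  have hdef : Tendsto (fun j => ∫⁻ z, ENNReal.ofReal (φ.defect (w z) (v (ns j) z)) ∂ν) atTop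
      (𝓝 0) := by
    rw [ENNReal.tendsto_nhds_zero]
    intro ε hε
    obtain ⟨N, hN⟩ := hd ε hε
    filter_upwards [hns.tendsto_atTop.eventually_ge_atTop N] with j hj
    refine lintegral_le_of_ae_tendsto
      (f := fun k z => ENNReal.ofReal (φ.defect (v (ns k) z) (v (ns j) z)))
      (fun k => aemeasurable_defect (hv _) (hv _))
      ((hns.tendsto_atTop.eventually_ge_atTop N).mono fun k hk => hN _ hk _ hj) ?_
    filter_upwards [hw] with z hz
    exact ENNReal.tendsto_ofReal ((φ.continuous_defect.tendsto (w z, v (ns j) z)).comp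
      (hz.prodMk_nhds tendsto_const_nhds))
  obtain ⟨L', c, -, hc0, hL'⟩ := YoungFunction.exists_mul_le_defect hl hφl
  set L := max L' 1
  have hL1 : 1 ≤ L := le_max_right _ _
  set g : Z → ℝ≥0∞ := fun z => ENNReal.ofReal D *
    (ENNReal.ofReal (φ (L * w z)) + ENNReal.ofReal (φ (w z))) with hg
  -- Where |v| ≥ L|w|, the defect controls φ(v) and hence φ(v - w). Elsewhere φ(v - w) is below the
  -- integrable function `g`, so dominated convergence handles the truncation by `g`.
  have hpt : ∀ j z, ENNReal.ofReal (φ (v (ns j) z - w z)) ≤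
      ENNReal.ofReal (2 * D / c) * ENNReal.ofReal (φ.defect (w z) (v (ns j) z)) +
        min (ENNReal.ofReal (φ (v (ns j) z - w z))) (g z) := fun j z => by
    rcases le_total (L * |w z|) |v (ns j) z| with h | h
    · refine le_add_right ?_
      rw [← ENNReal.ofReal_mul (by have := hD.pos; positivity)]
      apply ENNReal.ofReal_le_ofReal
      have h1 := hL' (w z) (v (ns j) z)
        ((mul_le_mul_of_nonneg_right (le_max_left _ _) (abs_nonneg _)).trans h)
      have h2 : φ (w z) ≤ φ (v (ns j) z) := φ.map_le_map_of_abs_le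
        ((le_mul_of_one_le_left (abs_nonneg _) hL1).trans h)
      calc _ ≤ D * (φ (v (ns j) z) + φ (w z)) := hD.map_sub_le _ _
        _ ≤ D * (2 * φ (v (ns j) z)) := mul_le_mul_of_nonneg_left (by linarith) hD.pos.le
        _ = 2 * D / c * (c * φ (v (ns j) z)) := by field_simp
        _ ≤ _ := mul_le_mul_of_nonneg_left h1 (by have := hD.pos; positivity)
    · refine le_add_left (le_min le_rfl ?_)
      simp only [hg]
      rw [← ENNReal.ofReal_add (φ.nonneg _) (φ.nonneg _), ← ENNReal.ofReal_mul hD.pos.le]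
      apply ENNReal.ofReal_le_ofReal
      refine (hD.map_sub_le _ _).trans (mul_le_mul_of_nonneg_left ?_ hD.pos.le)
      gcongr
      apply φ.map_le_map_of_abs_le
      have hL0 : 0 < L := by linarith
      rwa [abs_mul, abs_of_pos hL0]
  have hgm : AEMeasurable g ν := ((aemeasurable_ofReal_young
    (hwm.aemeasurable.const_mul L)).add (aemeasurable_ofReal_young hwm.aemeasurable)).const_mul _
  have hwt : modular φ ν w < ∞ := hρw.trans_lt hm.lt_top
  have hgt : ∫⁻ z, g z ∂ν ≠ ∞ := by
    rw [hg, lintegral_const_mul' _ _ ENNReal.ofReal_ne_top,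
      lintegral_add_left' (aemeasurable_ofReal_young (hwm.aemeasurable.const_mul L))]
    exact (ENNReal.mul_lt_top ENNReal.ofReal_lt_top
      (ENNReal.add_lt_top.2 ⟨modular_const_mul_lt_top hD L hwt, hwt⟩)).ne
  have hmin : Tendsto (fun j => ∫⁻ z, min (ENNReal.ofReal (φ (v (ns j) z - w z))) (g z) ∂ν) atTop
      (𝓝 0) := by
    rw [← lintegral_zero (μ := ν)]
    refine tendsto_lintegral_of_dominated_convergence' g (fun j => (aemeasurable_ofReal_young
      ((hv _).sub hwm.aemeasurable)).min hgm) (fun j => ae_of_all _ fun z => min_le_right _ _)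
      hgt ?_
    filter_upwards [hw] with z hz
    have h0 : Tendsto (fun j => ENNReal.ofReal (φ (v (ns j) z - w z))) atTop (𝓝 0) := by
      have := ENNReal.tendsto_ofReal ((φ.continuous'.tendsto _).comp (hz.sub_const (w z)))
      simpa [φ.map_zero] using this
    exact tendsto_of_tendsto_of_tendsto_of_le_of_le tendsto_const_nhds h0
      (fun _ => zero_le) fun _ => min_le_left _ _
  refine tendsto_of_tendsto_of_tendsto_of_le_of_le tendsto_const_nhds ?_ (fun _ => zero_le)
    (fun j => (lintegral_mono (hpt j)).trans_eq (lintegral_add_left'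
      ((aemeasurable_defect hwm.aemeasurable (hv _)).const_mul _) _))
  have := (ENNReal.Tendsto.const_mul (a := ENNReal.ofReal (2 * D / c)) hdef
    (Or.inr ENNReal.ofReal_ne_top)).add hmin
  simp only [mul_zero, add_zero] at this
  refine this.congr fun j => ?_
  rw [lintegral_const_mul' _ _ ENNReal.ofReal_ne_top]

/-- Lower bounds of the modular pass to limits in modular. -/
theorem le_modular_of_tendsto (hD : φ.DoublingWith D) {m : ℝ≥0∞} {f : Z → ℝ}
    (hf : AEMeasurable f ν) {g : ℕ → Z → ℝ}
    (h : ∀ n, m ≤ modular φ ν (fun z => f z + g n z))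
    (hg : Tendsto (fun n => modular φ ν (g n)) atTop (𝓝 0)) : m ≤ modular φ ν f := by
  -- With `k` fixed, n → ∞ removes the term with `g n` despite its large factor D^(k+1); only then
  -- does k → ∞ bring the remaining factor to 1.
  have h1 : ∀ k : ℕ, m ≤ ENNReal.ofReal (1 + 2⁻¹ ^ k * D) * modular φ ν f := fun k => by
    have h2 : ∀ n, m ≤ ENNReal.ofReal (1 + 2⁻¹ ^ k * D) * modular φ ν f +
        ENNReal.ofReal (D ^ (k + 1)) * modular φ ν (g n) := fun n => by
      refine (h n).trans ?_
      have hk : 0 ≤ 1 + 2⁻¹ ^ k * D := by have := hD.pos; positivity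
      unfold modular
      rw [← lintegral_const_mul' _ _ ENNReal.ofReal_ne_top,
        ← lintegral_const_mul' _ _ ENNReal.ofReal_ne_top,
        ← lintegral_add_left' ((aemeasurable_ofReal_young hf).const_mul _)]
      refine lintegral_mono fun z => ?_
      rw [← ENNReal.ofReal_mul hk, ← ENNReal.ofReal_mul (pow_nonneg hD.pos.le _),
        ← ENNReal.ofReal_add (mul_nonneg hk (φ.nonneg _))
          (mul_nonneg (pow_nonneg hD.pos.le _) (φ.nonneg _))]
      exact ENNReal.ofReal_le_ofReal (hD.map_add_le_add k _ _)
    have h3 := (ENNReal.Tendsto.const_mul (a := ENNReal.ofReal (D ^ (k + 1))) hg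
      (Or.inr ENNReal.ofReal_ne_top)).const_add
        (ENNReal.ofReal (1 + 2⁻¹ ^ k * D) * modular φ ν f)
    simp only [mul_zero, add_zero] at h3
    exact ge_of_tendsto' h3 h2
  rcases eq_or_ne (modular φ ν f) ∞ with ht | ht
  · rw [ht]; exact le_top
  have h4 : Tendsto (fun k : ℕ => ENNReal.ofReal (1 + 2⁻¹ ^ k * D) * modular φ ν f) atTop
      (𝓝 (ENNReal.ofReal (1 + 0 * D) * modular φ ν f)) := by
    refine ENNReal.Tendsto.mul_const (ENNReal.tendsto_ofReal ?_) (Or.inr ht)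
    exact ((tendsto_pow_atTop_nhds_zero_of_lt_one (by norm_num) (by norm_num)).mul_const D).const_add 1
  simp only [zero_mul, add_zero, ENNReal.ofReal_one, one_mul] at h4
  exact ge_of_tendsto' h4 h1

end Modular


/-! ### Difference maps: kernel, closed range, and Laplacian -/

section Diff

variable {G : Type*} [Group G] [TopologicalSpace G] [IsTopologicalGroup G]
  [SecondCountableTopology G] [MeasurableSpace G] [BorelSpace G]
  {μ : Measure G} [SFinite μ] {S U : Set G}

/-- If almost every `x` is equivalent to almost every point of `xS`, where `S` is symmetric and
contains an open generating set, then some equivalence class is conull. -/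
theorem exists_ae_rel [μ.IsMulLeftInvariant] [μ.IsOpenPosMeasure] (hSsymm : S⁻¹ = S) (hUS : U ⊆ S)
    (hUo : IsOpen U) (hU1 : (1 : G) ∈ U) (hUgen : Subgroup.closure U = ⊤)
    {r : G → G → Prop} (hr : Equivalence r)
    (h : ∀ᵐ p ∂(μ.restrict S).prod μ, r p.2 (p.2 * p.1)) : ∃ x₀, ∀ᵐ x ∂μ, r x₀ x := by
  set V : Set G := U ∪ U⁻¹ with hV
  have hVo : IsOpen V := hUo.union hUo.inv
  have hVS : V ⊆ S := Set.union_subset hUS (by rw [← hSsymm]; exact Set.inv_subset_inv.2 hUS)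
  have hVinv : ∀ u ∈ V, u⁻¹ ∈ V := fun u hu => by
    rcases hu with hu | hu
    · exact Or.inr (by simpa using hu)
    · exact Or.inl hu
  have h1 : ∀ᵐ p ∂μ.prod (μ.restrict S), r p.1 (p.1 * p.2) :=
    (Measure.measurePreserving_swap (μ := μ) (ν := μ.restrict S)).quasiMeasurePreserving.ae h
  -- By Fubini and left translation, almost every `x` is related to almost every point of the open
  -- set xV.
  have h2 : ∀ᵐ x ∂μ, ∀ᵐ y ∂μ, x⁻¹ * y ∈ V → r x y := by
    filter_upwards [Measure.ae_ae_of_ae_prod h1] with x hx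
    have hx' := (ae_restrict_iff' hVo.measurableSet).1 (ae_restrict_of_ae_restrict_of_subset hVS hx)
    filter_upwards [(measurePreserving_mul_left μ x⁻¹).quasiMeasurePreserving.ae hx'] with y hy hyV
    simpa using hy hyV
  obtain ⟨x, hx⟩ := h2.exists
  have hnhds : ∀ g u : G, u ∈ V → {y | g⁻¹ * y ∈ V} ∈ 𝓝 (g * u) := fun g u hu =>
    (hVo.preimage (continuous_const_mul g⁻¹)).mem_nhds (by simpa using hu)
  -- `O` consists of the points near which almost everything is related to `x`. It contains `x` and
  -- is stable under right multiplication by the symmetric generating set `V`, so it is all of `G`.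
  set O : Set G := {g | ∃ W ∈ 𝓝 g, ∀ᵐ y ∂μ, y ∈ W → r x y} with hO
  have hOV : ∀ g ∈ O, ∀ u ∈ V, g * u ∈ O := by
    rintro g ⟨W, hW, hg⟩ u hu
    -- A conull set is dense, so some `g'` arbitrarily close to `g` is both related to `x` and
    -- related to almost all of g'V, which is a neighbourhood of `g * u`.
    have hd := Measure.dense_of_ae (hg.and h2)
    have hN : {g' | g'⁻¹ * (g * u) ∈ V} ∈ 𝓝 g :=
      (hVo.preimage (f := fun g' : G => g'⁻¹ * (g * u)) (by fun_prop)).mem_nhds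
        (by simpa using hu)
    obtain ⟨g', hg'1, hg'2, hg'3⟩ := mem_closure_iff_nhds.1 (hd g) _ (inter_mem hW hN)
    refine ⟨{y | g'⁻¹ * y ∈ V}, ?_, ?_⟩
    · have := hnhds g' _ hg'1.2
      rwa [mul_inv_cancel_left] at this
    · filter_upwards [hg'3] with y hy hyV
      exact hr.trans (hg'2 hg'1.1) (hy hyV)
  have hall : ∀ g : G, ∀ g₀, g₀ ∈ O ↔ g₀ * g ∈ O := fun g => by
    have hg : g ∈ Subgroup.closure U := by rw [hUgen]; trivial
    induction hg using Subgroup.closure_induction with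
    | mem u hu =>
      refine fun g₀ => ⟨fun h => hOV g₀ h u (Or.inl hu), fun h => ?_⟩
      simpa using hOV _ h u⁻¹ (hVinv u (Or.inl hu))
    | one => simp
    | mul a b _ _ ha hb => intro g₀; rw [ha, hb, mul_assoc]
    | inv a _ ha => intro g₀; rw [ha (g₀ * a⁻¹), inv_mul_cancel_right]
  have hxO : x ∈ O := by
    have := hnhds x 1 (Or.inl hU1)
    rw [mul_one] at this
    exact ⟨_, this, hx⟩
  -- By second countability a locally null set is null.
  refine ⟨x, measure_null_of_locally_null _ fun g _ => ?_⟩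
  obtain ⟨W, hW, hg⟩ : g ∈ O := by simpa using (hall (x⁻¹ * g) x).1 hxO
  refine ⟨W ∩ {y | r x y}ᶜ, inter_mem (mem_nhdsWithin_of_mem_nhds hW) self_mem_nhdsWithin, ?_⟩
  refine measure_mono_null (fun y hy => ?_) hg
  exact fun hy' => hy.2 (hy' hy.1)

variable [μ.IsMulRightInvariant]

theorem ae_prod_of_ae {p : G → Prop} (h : ∀ᵐ x ∂μ, p x) :
    ∀ᵐ z ∂(μ.restrict S).prod μ, p (z.2 * z.1) ∧ p z.2 :=
  ((quasiMeasurePreserving_mul_restrict μ S).ae h).and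
    (Measure.quasiMeasurePreserving_snd (μ := μ.restrict S) (ν := μ) |>.ae h)

theorem coeFn_diffMap_mk {f : G → ℝ} (hf : AEStronglyMeasurable f μ) :
    diffMap μ S (AEEqFun.mk f hf) =ᵐ[(μ.restrict S).prod μ] fun p => f (p.2 * p.1) - f p.2 := by
  filter_upwards [coeFn_diffMap μ S (AEEqFun.mk f hf), ae_prod_of_ae (AEEqFun.coeFn_mk f hf)]
    with p h1 h2
  rw [h1, h2.1, h2.2]

theorem exists_eq_const_of_diffMap_eq_zero [μ.IsMulLeftInvariant] [μ.IsOpenPosMeasure]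
    (hSsymm : S⁻¹ = S) (hUS : U ⊆ S)
    (hUo : IsOpen U) (hU1 : (1 : G) ∈ U) (hUgen : Subgroup.closure U = ⊤) {f : G →ₘ[μ] ℝ}
    (h : diffMap μ S f = 0) : ∃ c : ℝ, f = AEEqFun.const G c := by
  obtain ⟨x₀, hx₀⟩ := exists_ae_rel (μ := μ) hSsymm hUS hUo hU1 hUgen (r := fun x y => f y = f x)
    ⟨fun _ => rfl, fun h => h.symm, fun h h' => h'.trans h⟩ <| by
      have := coeFn_diffMap μ S f
      rw [h] at this
      filter_upwards [this, coeFn_zero_ae ((μ.restrict S).prod μ)] with p h1 h2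
      rw [h2] at h1
      linarith
  refine ⟨f x₀, AEEqFun.ext ?_⟩
  filter_upwards [hx₀, AEEqFun.coeFn_const (μ := μ) G (f x₀)] with x h1 h2
  rw [h1, h2, Function.const_apply]

theorem diffMap_const (c : ℝ) : diffMap μ S (AEEqFun.const G c) = 0 := by
  refine AEEqFun.ext ((coeFn_diffMap_mk aestronglyMeasurable_const).trans ?_)
  filter_upwards [coeFn_zero_ae ((μ.restrict S).prod μ)] with p hp
  rw [hp, sub_self]

/-- The range of the difference map is closed under almost everywhere convergence. -/
theorem exists_diffMap_eq_of_ae_tendsto [μ.IsMulLeftInvariant] [μ.IsOpenPosMeasure]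
    (hSsymm : S⁻¹ = S) (hUS : U ⊆ S)
    (hUo : IsOpen U) (hU1 : (1 : G) ∈ U) (hUgen : Subgroup.closure U = ⊤) {f : ℕ → G →ₘ[μ] ℝ}
    {w : G × G → ℝ} (h : ∀ᵐ p ∂(μ.restrict S).prod μ,
      Tendsto (fun n => diffMap μ S (f n) p) atTop (𝓝 (w p))) :
    ∃ g : G →ₘ[μ] ℝ, diffMap μ S g =ᵐ[(μ.restrict S).prod μ] w := by
  have h' : ∀ᵐ p ∂(μ.restrict S).prod μ,
      Tendsto (fun n => f n (p.2 * p.1) - f n p.2) atTop (𝓝 (w p)) := by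
    filter_upwards [h, ae_all_iff.2 fun n => coeFn_diffMap μ S (f n)] with p h1 h2
    simpa only [h2] using h1
  -- Convergence of f_n(y) - f_n(x) is an equivalence relation between `x` and `y`. A conull class
  -- makes the functions normalised at `x₀`, namely f_n - f_n(x₀), converge almost everywhere.
  obtain ⟨x₀, hx₀⟩ := exists_ae_rel (μ := μ) hSsymm hUS hUo hU1 hUgen
    (r := fun x y => ∃ a, Tendsto (fun n => f n y - f n x) atTop (𝓝 a))
    ⟨fun x => ⟨0, by simp⟩, fun ⟨a, ha⟩ => ⟨-a, by simpa using ha.neg⟩,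
      fun ⟨a, ha⟩ ⟨b, hb⟩ => ⟨b + a, by simpa using hb.add ha⟩⟩ (h'.mono fun p hp => ⟨w p, hp⟩)
  obtain ⟨g, hgm, hg⟩ := measurable_limit_of_tendsto_metrizable_ae
    (fun n => ((f n).aemeasurable.sub_const (f n x₀))) hx₀
  refine ⟨AEEqFun.mk g hgm.aestronglyMeasurable, (coeFn_diffMap_mk _).trans ?_⟩
  filter_upwards [h', ae_prod_of_ae hg] with p h1 h2
  refine tendsto_nhds_unique (h2.1.sub h2.2) ?_
  simpa using h1

variable {φ : YoungFunction} {D : ℝ}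

theorem modular_snd_prod {f : G → ℝ} (hf : AEMeasurable f μ) :
    modular φ ((μ.restrict S).prod μ) (fun p => f p.2) = μ S * modular φ μ f := by
  unfold modular
  rw [lintegral_prod (fun p : G × G => ENNReal.ofReal (φ (f p.2)))
    (aemeasurable_ofReal_young (hf.comp_quasiMeasurePreserving
      Measure.quasiMeasurePreserving_snd))]
  simp only [lintegral_const, Measure.restrict_apply_univ, mul_comm]

theorem modular_diffMap_le (hD : φ.DoublingWith D) (f : G →ₘ[μ] ℝ) :
    modular φ ((μ.restrict S).prod μ) (diffMap μ S f) ≤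
      ENNReal.ofReal D * (μ S * modular φ μ f + μ S * modular φ μ f) := by
  have h1 : AEMeasurable (fun p : G × G => f (p.2 * p.1)) ((μ.restrict S).prod μ) :=
    f.aemeasurable.comp_quasiMeasurePreserving (quasiMeasurePreserving_mul_restrict μ S)
  rw [modular_congr _ _ (coeFn_diffMap μ S f)]
  refine (modular_sub_le_of_doubling hD h1 _).trans_eq ?_
  rw [modular_snd_prod f.aemeasurable]
  congr 2
  unfold modular
  rw [lintegral_prod _ (aemeasurable_ofReal_young h1)]
  simp only [lintegral_mul_right_eq_self fun x => ENNReal.ofReal (φ (f x))]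
  rw [lintegral_const, Measure.restrict_apply_univ, mul_comm]

theorem orlicz_le_dirichlet (hD : φ.DoublingWith D) (hS : μ S ≠ ∞) :
    orlicz φ μ ≤ dirichlet μ S φ := fun f hf => by
  change diffMap μ S f ∈ orlicz φ _
  rw [mem_orlicz_iff hD] at hf ⊢
  refine (modular_diffMap_le hD f).trans_lt ?_
  have := ENNReal.mul_lt_top hS.lt_top hf
  exact ENNReal.mul_lt_top ENNReal.ofReal_lt_top (ENNReal.add_lt_top.2 ⟨this, this⟩)

end Diff


/-! ### The first variation of the modular -/

section Variation

variable {Z : Type*} [MeasurableSpace Z] {φ : YoungFunction} {ν : Measure Z} {D : ℝ}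

theorem integrable_young {f : Z → ℝ} (hf : AEMeasurable f ν) (h : modular φ ν f < ∞) :
    Integrable (fun z => φ (f z)) ν := by
  refine ⟨(φ.continuous'.measurable.comp_aemeasurable hf).aestronglyMeasurable, ?_⟩
  rw [hasFiniteIntegral_iff_ofReal (ae_of_all _ fun _ => φ.nonneg _)]
  exact h

theorem integral_young {f : Z → ℝ} (hf : AEMeasurable f ν) :
    ∫ z, φ (f z) ∂ν = (modular φ ν f).toReal :=
  integral_eq_lintegral_of_nonneg_ae (ae_of_all _ fun _ => φ.nonneg _)
    (φ.continuous'.measurable.comp_aemeasurable hf).aestronglyMeasurable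

theorem aemeasurable_deriv_mul {f g : Z → ℝ} (hf : AEMeasurable f ν) (hg : AEMeasurable g ν) :
    AEMeasurable (fun z => deriv φ (f z) * g z) ν :=
  ((measurable_deriv φ).comp_aemeasurable hf).mul hg

theorem integrable_deriv_mul (hD : φ.DoublingWith D) (hd : Differentiable ℝ φ) {f g : Z → ℝ}
    (hfm : AEMeasurable f ν) (hgm : AEMeasurable g ν)
    (hf : modular φ ν f < ∞) (hg : modular φ ν g < ∞) :
    Integrable (fun z => deriv φ (f z) * g z) ν :=
  (((integrable_young hfm hf).add (integrable_young hgm hg)).const_mul D).mono'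
    (aemeasurable_deriv_mul hfm hgm).aestronglyMeasurable
    (ae_of_all _ fun z => hD.abs_deriv_mul_le hd (f z) (g z))

/-- Rescaling `g` to modular at most 1 turns the pointwise bound into a norm bound. The resulting
continuity of g ↦ ∫ φ'(f)g is what carries orthogonality from L^φ to its closure. -/
theorem abs_integral_deriv_mul_le (hD : φ.DoublingWith D) (hd : Differentiable ℝ φ) {f : Z → ℝ}
    (hfm : AEMeasurable f ν) (hf : modular φ ν f < ∞) {g : Z →ₘ[ν] ℝ} (hg : g ∈ orlicz φ ν) :
    |∫ z, deriv φ (f z) * g z ∂ν| ≤ D * ((modular φ ν f).toReal + 1) * luxNorm φ ν g := by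
  have hD0 := hD.pos
  refine le_of_forall_gt_imp_ge_of_dense fun b hb => ?_
  have hK : 0 < D * ((modular φ ν f).toReal + 1) := by positivity
  set ε := b / (D * ((modular φ ν f).toReal + 1)) with hε
  have hlt : luxNorm φ ν g < ε := by rwa [hε, lt_div_iff₀' hK]
  have hε0 := (luxNorm_nonneg φ ν g).trans_lt hlt
  have hgε := modular_div_le_one_of_luxNorm_lt hg hlt
  have hgm : AEMeasurable (fun z => g z / ε) ν := g.aemeasurable.div_const ε
  have h1 : ∫ z, deriv φ (f z) * g z ∂ν = ε * ∫ z, deriv φ (f z) * (g z / ε) ∂ν := by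
    rw [← integral_const_mul]
    congr 1
    funext z
    field_simp
  have h2 : |∫ z, deriv φ (f z) * (g z / ε) ∂ν| ≤ D * ((modular φ ν f).toReal + 1) := by
    refine (norm_integral_le_of_norm_le (f := fun z => deriv φ (f z) * (g z / ε)) (g := fun z => D * (φ (f z) + φ (g z / ε)))
      (((integrable_young hfm hf).add
        (integrable_young hgm (hgε.trans_lt ENNReal.one_lt_top))).const_mul D)
      (ae_of_all _ fun z => hD.abs_deriv_mul_le hd (f z) (g z / ε))).trans ?_
    rw [integral_const_mul, integral_add (integrable_young hfm hf)
      (integrable_young hgm (hgε.trans_lt ENNReal.one_lt_top)), integral_young hfm,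
      integral_young hgm]
    gcongr
    exact ENNReal.toReal_le_of_le_ofReal zero_le_one (by simpa using hgε)
  rw [h1, abs_mul, abs_of_pos hε0]
  calc ε * _ ≤ ε * (D * ((modular φ ν f).toReal + 1)) := mul_le_mul_of_nonneg_left h2 hε0.le
    _ = b := by rw [hε]; field_simp

/-- The Euler–Lagrange equation: t ↦ ∫ φ(f + tg) has a minimum at 0, and doubling supplies an
integrable bound on the derivative, uniform in |t| < 1, for differentiating under the integral. -/
theorem integral_deriv_mul_eq_zero_of_minimal (hD : φ.DoublingWith D) (hd : Differentiable ℝ φ)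
    {f g : Z → ℝ} (hfm : AEMeasurable f ν) (hgm : AEMeasurable g ν)
    (hf : modular φ ν f < ∞) (hg : modular φ ν g < ∞)
    (hmin : ∀ t : ℝ, modular φ ν f ≤ modular φ ν (fun z => f z + t * g z)) :
    ∫ z, deriv φ (f z) * g z ∂ν = 0 := by
  have hD0 := hD.pos
  have hm : ∀ t : ℝ, AEMeasurable (fun z => f z + t * g z) ν := fun t =>
    hfm.add (hgm.const_mul t)
  have hfin : ∀ t : ℝ, modular φ ν (fun z => f z + t * g z) < ∞ := fun t =>
    modular_add_lt_top hD hfm hf (modular_const_mul_lt_top hD t hg)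
  have hder := hasDerivAt_integral_of_dominated_loc_of_deriv_le (μ := ν)
    (F := fun t z => φ (f z + t * g z)) (F' := fun t z => deriv φ (f z + t * g z) * g z)
    (x₀ := 0) (s := Metric.ball 0 1)
    (bound := fun z => D * (D * (φ (f z) + φ (g z)) + φ (g z)))
    (Metric.ball_mem_nhds _ one_pos)
    (Eventually.of_forall fun t => (integrable_young (hm t) (hfin t)).aestronglyMeasurable)
    (integrable_young (hm 0) (hfin 0))
    (aemeasurable_deriv_mul (hm 0) hgm).aestronglyMeasurable
    (ae_of_all _ fun z t ht => by
      refine (hD.abs_deriv_mul_le hd _ _).trans (mul_le_mul_of_nonneg_left ?_ hD0.le)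
      gcongr
      refine (hD.map_add_le _ _).trans (mul_le_mul_of_nonneg_left ?_ hD0.le)
      gcongr
      refine φ.map_le_map_of_abs_le ?_
      rw [abs_mul]
      rw [mem_ball_zero_iff, Real.norm_eq_abs] at ht
      exact mul_le_of_le_one_left (abs_nonneg _) ht.le)
    ((((integrable_young hfm hf).add (integrable_young hgm hg)).const_mul D).add
      (integrable_young hgm hg) |>.const_mul D)
    (ae_of_all _ fun z t _ => by
      have h1 : HasDerivAt (fun t => f z + t * g z) (g z) t := by
        simpa using ((hasDerivAt_id t).mul_const (g z)).const_add (f z)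
      exact (hd _).hasDerivAt.comp t h1)
  have hlm : IsLocalMin (fun t : ℝ => ∫ z, φ (f z + t * g z) ∂ν) 0 :=
    Eventually.of_forall fun t => by
      beta_reduce
      rw [integral_young (hm 0), integral_young (hm t)]
      simp only [zero_mul, add_zero]
      exact ENNReal.toReal_mono (hfin t).ne (hmin t)
  simpa using hlm.hasDerivAt_eq_zero hder.2

end Variation

/-! ### Harmonic functions -/

section Harmonic

variable {G : Type*} [Group G] [TopologicalSpace G] [IsTopologicalGroup G]
  [SecondCountableTopology G] [MeasurableSpace G] [BorelSpace G]
  {μ : Measure G} [SFinite μ] {S U : Set G} {φ : YoungFunction} {D : ℝ}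

/-- Right invariance of `μ` makes `μ.inv` left invariant, hence a multiple cμ by uniqueness of Haar
measure. Inverting twice gives c² = 1. -/
theorem isInvInvariant_of_isMulRightInvariant [LocallyCompactSpace G] [T2Space G]
    [μ.IsHaarMeasure] [μ.IsMulRightInvariant] : μ.IsInvInvariant := by
  constructor
  let c : ℝ≥0∞ := Measure.haarScalarFactor μ.inv μ
  have hc : μ.inv = c • μ := Measure.isMulLeftInvariant_eq_smul μ.inv μ
  have : Measure.map Inv.inv (Measure.map Inv.inv μ) = c ^ 2 • μ := by
    rw [← Measure.inv_def μ, hc, Measure.map_smul, ← Measure.inv_def μ, hc, smul_smul, pow_two]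
  have μeq : μ = c ^ 2 • μ := by
    rw [Measure.map_map continuous_inv.measurable continuous_inv.measurable] at this
    simpa only [inv_involutive, Function.Involutive.comp_self, Measure.map_id]
  have K : TopologicalSpace.PositiveCompacts G := Classical.arbitrary _
  have : c ^ 2 * μ K = 1 ^ 2 * μ K := by
    conv_rhs => rw [μeq]
    simp
  have : c ^ 2 = 1 ^ 2 :=
    (ENNReal.mul_left_inj (Measure.measure_pos_of_nonempty_interior _ K.interior_nonempty).ne'
      K.isCompact.measure_lt_top.ne).1 this
  have : c = 1 := (ENNReal.pow_right_strictMono two_ne_zero).injective this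
  rw [hc, this, one_smul]

variable [μ.IsMulRightInvariant]

/-- The involution `(s, x) ↦ (s⁻¹, xs)` preserves the measure of `S × G`. -/
theorem measurePreserving_flip [μ.IsInvInvariant] (hSm : MeasurableSet S) (hSsymm : S⁻¹ = S) :
    MeasurePreserving (fun p : G × G => (p.1⁻¹, p.2 * p.1)) ((μ.restrict S).prod μ)
      ((μ.restrict S).prod μ) := by
  have h1 : MeasurePreserving Inv.inv (μ.restrict S) (μ.restrict S) := by
    have := (Measure.measurePreserving_inv μ).restrict_preimage hSm
    rwa [Set.inv_preimage, hSsymm] at this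
  exact (h1.prod (MeasurePreserving.id μ)).comp (measurePreserving_prod_mul_right (μ.restrict S) μ)

theorem modular_diffMap_lt_top (hD : φ.DoublingWith D) (f : dirichlet μ S φ) :
    modular φ ((μ.restrict S).prod μ) (diffMap μ S f) < ∞ :=
  (mem_orlicz_iff hD _).1 f.2

theorem integrable_deriv_diffMap_mul_snd (hD : φ.DoublingWith D) (hd : Differentiable ℝ φ)
    (hS : μ S ≠ ∞) (h : dirichlet μ S φ) {u : G →ₘ[μ] ℝ} (hu : u ∈ orlicz φ μ) :
    Integrable (fun p => deriv φ (diffMap μ S h p) * u p.2) ((μ.restrict S).prod μ) := by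
  have hu2 : AEMeasurable (fun p : G × G => u p.2) ((μ.restrict S).prod μ) :=
    u.aemeasurable.comp_quasiMeasurePreserving Measure.quasiMeasurePreserving_snd
  refine integrable_deriv_mul hD hd (AEEqFun.aemeasurable _) hu2 (modular_diffMap_lt_top hD h) ?_
  rw [modular_snd_prod u.aemeasurable]
  exact ENNReal.mul_lt_top hS.lt_top ((mem_orlicz_iff hD _).1 hu)

/-- Summation by parts. The flip (s, x) ↦ (s⁻¹, xs) changes the sign of dh and φ' is odd, so the
term with u(xs) equals minus the term with u(x). -/
theorem integral_deriv_diffMap_mul_diffMap [μ.IsInvInvariant] (hD : φ.DoublingWith D)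
    (hd : Differentiable ℝ φ)
    (hSm : MeasurableSet S) (hS : μ S ≠ ∞) (hSsymm : S⁻¹ = S) (h : dirichlet μ S φ)
    {u : G →ₘ[μ] ℝ} (hu : u ∈ orlicz φ μ) :
    ∫ p, deriv φ (diffMap μ S h p) * diffMap μ S u p ∂(μ.restrict S).prod μ =
      -2 * ∫ p, deriv φ (diffMap μ S h p) * u p.2 ∂(μ.restrict S).prod μ := by
  have hT := measurePreserving_flip (μ := μ) hSm hSsymm
  have hTe : MeasurableEmbedding (fun p : G × G => (p.1⁻¹, p.2 * p.1)) := by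
    have hinv : Function.Involutive (fun p : G × G => (p.1⁻¹, p.2 * p.1)) := fun p => by simp
    exact (MeasurableEquiv.ofInvolutive _ hinv hT.measurable).measurableEmbedding
  have hi := integrable_deriv_diffMap_mul_snd hD hd hS h hu
  have hcoe := coeFn_diffMap μ S (h : G →ₘ[μ] ℝ)
  have e : (fun p => deriv φ (diffMap μ S h p) * u (p.2 * p.1))
      =ᵐ[(μ.restrict S).prod μ]
      fun p => -((fun q : G × G => deriv φ (diffMap μ S h q) * u q.2) (p.1⁻¹, p.2 * p.1)) := by
    filter_upwards [hcoe, hT.quasiMeasurePreserving.ae hcoe] with p h1 h2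
    simp only [h1, h2, mul_inv_cancel_right]
    rw [← neg_sub ((h : G →ₘ[μ] ℝ) p.2), YoungFunction.deriv_neg', neg_mul]
  have hi' : Integrable (fun p => deriv φ (diffMap μ S h p) * u (p.2 * p.1))
      ((μ.restrict S).prod μ) := ((hT.integrable_comp_of_integrable hi).neg).congr e.symm
  have hI : ∫ p, deriv φ (diffMap μ S h p) * u (p.2 * p.1) ∂(μ.restrict S).prod μ =
      -∫ p, deriv φ (diffMap μ S h p) * u p.2 ∂(μ.restrict S).prod μ := by
    rw [integral_congr_ae e, integral_neg]
    exact congrArg Neg.neg (hT.integral_comp hTe fun q => deriv φ (diffMap μ S h q) * u q.2)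
  calc _ = ∫ p, (deriv φ (diffMap μ S h p) * u (p.2 * p.1) -
        deriv φ (diffMap μ S h p) * u p.2) ∂(μ.restrict S).prod μ := by
        refine integral_congr_ae ?_
        filter_upwards [coeFn_diffMap μ S u] with p hp
        rw [hp, mul_sub]
    _ = _ := by rw [integral_sub hi' hi, hI]; ring

/-- `diffMap` is only a class on S × G, whereas `IsHarmonic` speaks of individual slices; Fubini
reconciles them for almost every `x`. -/
theorem ae_deriv_diffMap_eq (h : G →ₘ[μ] ℝ) :
    ∀ᵐ x ∂μ, (fun s => deriv φ (diffMap μ S h (s, x))) =ᵐ[μ.restrict S]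
      fun s => deriv φ (h (x * s) - h x) := by
  have := (Measure.measurePreserving_swap (μ := μ) (ν := μ.restrict S)).quasiMeasurePreserving.ae
    (coeFn_diffMap μ S h)
  filter_upwards [Measure.ae_ae_of_ae_prod this] with x hx
  filter_upwards [hx] with s hs
  rw [Prod.swap_prod_mk] at hs
  rw [hs]

/-- Integration by parts for functions whose Laplacian vanishes. -/
theorem integral_deriv_diffMap_mul_diffMap_eq_zero [μ.IsInvInvariant] (hD : φ.DoublingWith D)
    (hd : Differentiable ℝ φ)
    (hSm : MeasurableSet S) (hS : μ S ≠ ∞) (hSsymm : S⁻¹ = S) (h : dirichlet μ S φ)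
    (hh : IsHarmonic μ S φ (h : G →ₘ[μ] ℝ)) {u : G →ₘ[μ] ℝ} (hu : u ∈ orlicz φ μ) :
    ∫ p, deriv φ (diffMap μ S h p) * diffMap μ S u p ∂(μ.restrict S).prod μ = 0 := by
  rw [integral_deriv_diffMap_mul_diffMap hD hd hSm hS hSsymm h hu,
    integral_prod_symm _ (integrable_deriv_diffMap_mul_snd hD hd hS h hu)]
  refine mul_eq_zero_of_right _ ?_
  refine (integral_congr_ae ?_).trans (integral_zero _ _)
  filter_upwards [hh, ae_deriv_diffMap_eq (h : G →ₘ[μ] ℝ)] with x h1 h2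
  rw [integral_mul_const, integral_congr_ae h2, h1.2, zero_mul]

/-- Minimizers of the Dirichlet modular in their class modulo `L^φ` are harmonic. -/
theorem isHarmonic_of_minimal [SigmaFinite μ] [μ.IsInvInvariant] (hD : φ.DoublingWith D)
    (hd : Differentiable ℝ φ)
    (hSm : MeasurableSet S) (hS : μ S ≠ ∞) (hSsymm : S⁻¹ = S) (h : dirichlet μ S φ)
    (hmin : ∀ u ∈ orlicz φ μ, modular φ ((μ.restrict S).prod μ) (diffMap μ S h) ≤
      modular φ ((μ.restrict S).prod μ) (diffMap μ S (h + u))) :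
    IsHarmonic μ S φ (h : G →ₘ[μ] ℝ) := by
  have hzero : ∀ u ∈ orlicz φ μ,
      ∫ p, deriv φ (diffMap μ S h p) * u p.2 ∂(μ.restrict S).prod μ = 0 := fun u hu => by
    have hdu : diffMap μ S u ∈ orlicz φ _ := orlicz_le_dirichlet hD hS hu
    have := integral_deriv_mul_eq_zero_of_minimal hD hd (AEEqFun.aemeasurable _)
      (AEEqFun.aemeasurable _) (modular_diffMap_lt_top hD h) ((mem_orlicz_iff hD _).1 hdu)
      fun t => by
        refine (hmin (t • u) ((orlicz φ μ).smul_mem t hu)).trans_eq (modular_congr _ _ ?_)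
        rw [map_add, map_smul]
        filter_upwards [AEEqFun.coeFn_add (diffMap μ S (h : G →ₘ[μ] ℝ)) (t • diffMap μ S u),
          AEEqFun.coeFn_smul t (diffMap μ S u)] with p h1 h2
        rw [h1, Pi.add_apply, h2, Pi.smul_apply, smul_eq_mul]
    rw [integral_deriv_diffMap_mul_diffMap hD hd hSm hS hSsymm h hu] at this
    linarith
  set k : G × G → ℝ := fun p => deriv φ (diffMap μ S h p) with hk
  -- Indicators of sets of finite measure lie in L^φ. As test functions they yield both the
  -- integrability of almost every slice and the vanishing of the integral of Δ_φ h over each such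
  -- set.
  have hind : ∀ A, MeasurableSet A → μ A < ∞ →
      Integrable (fun p : G × G => k p * A.indicator 1 p.2) ((μ.restrict S).prod μ) ∧
      ∫ p : G × G, k p * A.indicator 1 p.2 ∂(μ.restrict S).prod μ = 0 := fun A hA hμA => by
    have hm : AEStronglyMeasurable (A.indicator (1 : G → ℝ)) μ :=
      (measurable_one.indicator hA).aestronglyMeasurable
    have hu : AEEqFun.mk _ hm ∈ orlicz φ μ := by
      rw [mem_orlicz_iff hD, modular_congr _ _ (AEEqFun.coeFn_mk _ hm)]
      have : modular φ μ (A.indicator 1) = ∫⁻ x, A.indicator (fun _ => ENNReal.ofReal (φ 1)) x ∂μ :=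
        lintegral_congr fun x => by by_cases hx : x ∈ A <;> simp [hx, φ.map_zero]
      rw [this, lintegral_indicator hA, setLIntegral_const]
      exact ENNReal.mul_lt_top ENNReal.ofReal_lt_top hμA
    have he : (fun p : G × G => k p * AEEqFun.mk _ hm p.2) =ᵐ[(μ.restrict S).prod μ]
        fun p => k p * A.indicator 1 p.2 := by
      filter_upwards [ae_prod_of_ae (AEEqFun.coeFn_mk _ hm)] with p hp
      rw [hp.2]
    exact ⟨(integrable_deriv_diffMap_mul_snd hD hd hS h hu).congr he,
      (integral_congr_ae he).symm.trans (hzero _ hu)⟩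
  have hint : ∀ᵐ x ∂μ, Integrable (fun s => k (s, x)) (μ.restrict S) := by
    have := ae_all_iff.2 fun n => ((hind _ (measurableSet_spanningSets μ n)
      (measure_spanningSets_lt_top μ n)).1).prod_left_ae
    filter_upwards [this] with x hx
    obtain ⟨n, hn⟩ : ∃ n, x ∈ spanningSets μ n :=
      Set.mem_iUnion.1 ((iUnion_spanningSets μ).symm ▸ Set.mem_univ x)
    simpa [hn] using hx n
  have hΔ : (fun x => ∫ s in S, k (s, x) ∂μ) =ᵐ[μ] 0 := by
    have e : ∀ (A : Set G) (x : G), ∫ s in S, k (s, x) * A.indicator 1 x ∂μ =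
        A.indicator (fun x => ∫ s in S, k (s, x) ∂μ) x := fun A x => by
      rw [integral_mul_const]
      by_cases hx : x ∈ A <;> simp [hx]
    refine ae_eq_zero_of_forall_setIntegral_eq_of_sigmaFinite (fun A hA hμA => ?_)
      fun A hA hμA => ?_
    · rw [← integrable_indicator_iff hA]
      have := (hind A hA hμA).1.integral_prod_right
      simp only [e] at this
      exact this
    · have := (hind A hA hμA).2
      rw [integral_prod_symm _ (hind A hA hμA).1] at this
      simp only [e] at this
      rwa [integral_indicator hA] at this
  filter_upwards [hint, hΔ, ae_deriv_diffMap_eq (φ := φ) (S := S) (h : G →ₘ[μ] ℝ)] with x h1 h2 h3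
  exact ⟨h1.congr h3, (integral_congr_ae h3).symm.trans h2⟩

/-- Every Dirichlet function is, up to a limit of functions in `L^φ`, a minimizer. -/
theorem exists_minimal [μ.IsMulLeftInvariant] [μ.IsOpenPosMeasure]
    (hD : φ.DoublingWith D) (hc : StrictConvexOn ℝ Set.univ φ) {l : ℝ} (hl : 2 ≤ l)
    (hφl : ∀ t, 2 * l * φ t ≤ φ (l * t))
    (hSsymm : S⁻¹ = S) (hUS : U ⊆ S)
    (hUo : IsOpen U) (hU1 : (1 : G) ∈ U) (hUgen : Subgroup.closure U = ⊤)
    (f : dirichlet μ S φ) :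
    ∃ h : dirichlet μ S φ,
      (∃ u : ℕ → G →ₘ[μ] ℝ, (∀ n, u n ∈ orlicz φ μ) ∧
        Tendsto (fun n => modular φ ((μ.restrict S).prod μ)
          (diffMap μ S ((f : G →ₘ[μ] ℝ) + u n - h))) atTop (𝓝 0)) ∧
      ∀ u ∈ orlicz φ μ, modular φ ((μ.restrict S).prod μ) (diffMap μ S h) ≤
        modular φ ((μ.restrict S).prod μ) (diffMap μ S (h + u)) := by
  set ν := (μ.restrict S).prod μ with hν
  set A : Set ℝ≥0∞ := (fun u => modular φ ν (diffMap μ S ((f : G →ₘ[μ] ℝ) + u))) ''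
    (orlicz φ μ : Set (G →ₘ[μ] ℝ)) with hA
  have hA0 : A.Nonempty := ⟨_, 0, (orlicz φ μ).zero_mem, rfl⟩
  set m := sInf A with hm
  have hle : ∀ u ∈ orlicz φ μ, m ≤ modular φ ν (diffMap μ S ((f : G →ₘ[μ] ℝ) + u)) :=
    fun u hu => sInf_le ⟨u, hu, rfl⟩
  have hmt : m ≠ ∞ := by
    refine ((hle 0 (orlicz φ μ).zero_mem).trans_lt ?_).ne
    rw [add_zero]
    exact modular_diffMap_lt_top hD f
  obtain ⟨a, -, ha, haA⟩ := exists_seq_tendsto_sInf hA0 (OrderBot.bddBelow A)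
  choose u hu hua using haA
  have hsub : ∀ a b : G →ₘ[μ] ℝ, diffMap μ S (a - b) =ᵐ[ν]
      fun p => diffMap μ S a p - diffMap μ S b p := fun a b => by
    rw [map_sub]; exact AEEqFun.coeFn_sub _ _
  have hadd : ∀ a b : G →ₘ[μ] ℝ, diffMap μ S (a + b) =ᵐ[ν]
      fun p => diffMap μ S a p + diffMap μ S b p := fun a b => by
    rw [map_add]; exact AEEqFun.coeFn_add _ _
  set v : ℕ → G × G → ℝ := fun n => diffMap μ S ((f : G →ₘ[μ] ℝ) + u n) with hv
  -- The affine class f + L^φ is convex, so midpoints compete in the minimization.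
  have hmid : ∀ n k, m ≤ modular φ ν (fun z => (v n z + v k z) / 2) := fun n k => by
    refine (hle ((2⁻¹ : ℝ) • (u n + u k)) ((orlicz φ μ).smul_mem _
      ((orlicz φ μ).add_mem (hu n) (hu k)))).trans_eq (modular_congr _ _ ?_)
    have e : (f : G →ₘ[μ] ℝ) + (2⁻¹ : ℝ) • (u n + u k) =
        (2⁻¹ : ℝ) • (((f : G →ₘ[μ] ℝ) + u n) + ((f : G →ₘ[μ] ℝ) + u k)) := by module
    rw [e, map_smul]
    filter_upwards [AEEqFun.coeFn_smul (2⁻¹ : ℝ)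
      (diffMap μ S (((f : G →ₘ[μ] ℝ) + u n) + ((f : G →ₘ[μ] ℝ) + u k))), hadd _ _] with p h1 h2
    rw [h1, Pi.smul_apply, h2, smul_eq_mul, hv]
    ring
  obtain ⟨ns, hns, w, hwm, hw, hlim, hwle⟩ := exists_subseq_tendsto_modular hD hc hl hφl (ν := ν)
    (v := v) (fun n => AEEqFun.aemeasurable _) hmt (by simpa only [hv, hua] using ha) hmid
  obtain ⟨h, hh⟩ := exists_diffMap_eq_of_ae_tendsto hSsymm hUS hUo hU1 hUgen hw
  have hhm : modular φ ν (diffMap μ S h) ≤ m := (modular_congr _ _ hh).trans_le hwle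
  have hlim' : Tendsto (fun j => modular φ ν (diffMap μ S ((f : G →ₘ[μ] ℝ) + u (ns j) - h))) atTop
      (𝓝 0) := by
    refine hlim.congr fun j => modular_congr _ _ ?_
    filter_upwards [hsub ((f : G →ₘ[μ] ℝ) + u (ns j)) h, hh] with p h1 h2
    rw [h1, h2]
  refine ⟨⟨h, (mem_orlicz_iff hD _).2 (hhm.trans_lt hmt.lt_top)⟩, ⟨fun j => u (ns j),
    fun j => hu _, hlim'⟩, fun u' hu' => hhm.trans ?_⟩
  -- The limit `h` need not lie in f + L^φ. However, h + u' is a limit in modular of elements of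
  -- that class, and the lower bound `m` survives such limits.
  refine le_modular_of_tendsto hD (AEEqFun.aemeasurable _) (fun j => ?_) hlim'
  refine (hle (u (ns j) + u') ((orlicz φ μ).add_mem (hu _) hu')).trans_eq (modular_congr _ _ ?_)
  have e : (f : G →ₘ[μ] ℝ) + (u (ns j) + u') = (h + u') + ((f : G →ₘ[μ] ℝ) + u (ns j) - h) := by
    abel
  rw [e]
  exact hadd _ _

/-- Two harmonic Dirichlet functions whose difference is a limit of functions in `L^φ` differ by
a constant. -/
theorem diffMap_sub_eq_zero_of_isHarmonic [μ.IsInvInvariant] (hD : φ.DoublingWith D)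
    (hc : StrictConvexOn ℝ Set.univ φ) (hd : Differentiable ℝ φ)
    (hSm : MeasurableSet S) (hS : μ S ≠ ∞) (hSsymm : S⁻¹ = S) {h₁ h₂ : dirichlet μ S φ}
    (hh₁ : IsHarmonic μ S φ (h₁ : G →ₘ[μ] ℝ)) (hh₂ : IsHarmonic μ S φ (h₂ : G →ₘ[μ] ℝ))
    (happrox : ∀ ε : ℝ, 0 < ε → ∃ u ∈ orlicz φ μ,
      luxNorm φ ((μ.restrict S).prod μ)
        (diffMap μ S ((h₁ : G →ₘ[μ] ℝ) - h₂ - u)) < ε) :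
    diffMap μ S ((h₁ : G →ₘ[μ] ℝ) - h₂) = 0 := by
  set ν := (μ.restrict S).prod μ with hν
  set w : G →ₘ[μ] ℝ := (h₁ : G →ₘ[μ] ℝ) - h₂ with hw
  have hwD : w ∈ dirichlet μ S φ := (dirichlet μ S φ).sub_mem h₁.2 h₂.2
  have hint : ∀ (h : dirichlet μ S φ) {g : G →ₘ[μ] ℝ}, g ∈ dirichlet μ S φ →
      Integrable (fun p => deriv φ (diffMap μ S h p) * diffMap μ S g p) ν := fun h g hg =>
    integrable_deriv_mul hD hd (AEEqFun.aemeasurable _) (AEEqFun.aemeasurable _)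
      (modular_diffMap_lt_top hD h) (modular_diffMap_lt_top hD ⟨g, hg⟩)
  -- The pairing with dw is unchanged on replacing `w` by `w - u` for `u` in L^φ, and the norm of
  -- d(w - u) can be made arbitrarily small.
  have hzero : ∀ h : dirichlet μ S φ, IsHarmonic μ S φ (h : G →ₘ[μ] ℝ) →
      ∫ p, deriv φ (diffMap μ S h p) * diffMap μ S w p ∂ν = 0 := fun h hh => by
    set C := D * ((modular φ ν (diffMap μ S h)).toReal + 1) with hC
    have hC0 : 0 < C := by have := hD.pos; positivity
    refine abs_eq_zero.1 (le_antisymm (le_of_forall_pos_le_add fun ε hε => ?_) (abs_nonneg _))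
    obtain ⟨u, hu, huε⟩ := happrox (ε / C) (by positivity)
    have huD := orlicz_le_dirichlet (S := S) hD hS hu
    have hwu : w - u ∈ dirichlet μ S φ := (dirichlet μ S φ).sub_mem hwD huD
    have e : ∫ p, deriv φ (diffMap μ S h p) * diffMap μ S w p ∂ν =
        ∫ p, deriv φ (diffMap μ S h p) * diffMap μ S (w - u) p ∂ν := by
      have e0 := integral_deriv_diffMap_mul_diffMap_eq_zero hD hd hSm hS hSsymm h hh hu
      rw [← sub_zero (∫ p, deriv φ (diffMap μ S h p) * diffMap μ S w p ∂ν), ← e0,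
        ← integral_sub (hint h hwD) (hint h huD)]
      refine integral_congr_ae ?_
      filter_upwards [(map_sub (diffMap μ S) w u ▸
        AEEqFun.coeFn_sub (diffMap μ S w) (diffMap μ S u) :
        diffMap μ S (w - u) =ᵐ[ν] diffMap μ S w - diffMap μ S u)] with p hp
      rw [hp, Pi.sub_apply, mul_sub]
    rw [e, zero_add]
    calc _ ≤ C * luxNorm φ ν (diffMap μ S (w - u)) :=
          abs_integral_deriv_mul_le hD hd (AEEqFun.aemeasurable _)
            (modular_diffMap_lt_top hD h) hwu
      _ ≤ C * (ε / C) := mul_le_mul_of_nonneg_left huε.le hC0.le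
      _ = ε := by field_simp
  have hsub : diffMap μ S w =ᵐ[ν] fun p => diffMap μ S h₁ p - diffMap μ S h₂ p := by
    rw [hw, map_sub]; exact AEEqFun.coeFn_sub _ _
  -- Subtracting the two orthogonality relations gives a nonnegative integrand with integral 0,
  -- which vanishes only where the two differences agree.
  have hI : ∫ p, (deriv φ (diffMap μ S h₁ p) - deriv φ (diffMap μ S h₂ p)) *
      (diffMap μ S h₁ p - diffMap μ S h₂ p) ∂ν = 0 := by
    refine Eq.trans ?_ ((congrArg₂ (· - ·) (hzero h₁ hh₁) (hzero h₂ hh₂)).trans (sub_zero 0))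
    rw [← integral_sub (hint h₁ hwD) (hint h₂ hwD)]
    refine integral_congr_ae ?_
    filter_upwards [hsub] with p hp
    rw [hp, sub_mul]
  have hIi : Integrable (fun p => (deriv φ (diffMap μ S h₁ p) - deriv φ (diffMap μ S h₂ p)) *
      (diffMap μ S h₁ p - diffMap μ S h₂ p)) ν := by
    refine ((hint h₁ hwD).sub (hint h₂ hwD)).congr ?_
    filter_upwards [hsub] with p hp
    rw [Pi.sub_apply, hp, sub_mul]
  rw [integral_eq_zero_iff_of_nonneg
    (fun p => YoungFunction.deriv_sub_mul_sub_nonneg hc hd _ _) hIi] at hI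
  refine AEEqFun.ext (hsub.trans ?_)
  filter_upwards [hI, coeFn_zero_ae ν] with p h1 h2
  rw [h2, YoungFunction.eq_of_deriv_sub_mul_sub_eq_zero hc hd h1, sub_self]

end Harmonic


/-! ### Continuity of translations for the modular -/

section Translation

variable {X : Type*} [MeasurableSpace X] {φ : YoungFunction} {ν : Measure X} {D : ℝ}

/-- The truncation of a function to the values `t` with `1 / (n + 1) ≤ |t| ≤ n + 1`. -/
def truncate (n : ℕ) (t : ℝ) : ℝ :=
  Set.indicator {t | ((n : ℝ) + 1)⁻¹ ≤ |t| ∧ |t| ≤ n + 1} id t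

theorem measurable_truncate (n : ℕ) : Measurable (truncate n) := by
  refine measurable_id.indicator (MeasurableSet.inter ?_ ?_)
  · exact measurableSet_le measurable_const measurable_abs
  · exact measurableSet_le measurable_abs measurable_const

theorem abs_truncate_le (n : ℕ) (t : ℝ) : |truncate n t| ≤ n + 1 := by
  unfold truncate
  by_cases h : t ∈ {t : ℝ | ((n : ℝ) + 1)⁻¹ ≤ |t| ∧ |t| ≤ n + 1}
  · rw [Set.indicator_of_mem h]; exact h.2
  · rw [Set.indicator_of_notMem h, abs_zero]; positivity

theorem abs_sub_truncate_le (n : ℕ) (t : ℝ) : |t - truncate n t| ≤ |t| := by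
  unfold truncate
  by_cases h : t ∈ {t : ℝ | ((n : ℝ) + 1)⁻¹ ≤ |t| ∧ |t| ≤ n + 1}
  · rw [Set.indicator_of_mem h, id, sub_self, abs_zero]; positivity
  · rw [Set.indicator_of_notMem h, sub_zero]

theorem tendsto_truncate (t : ℝ) : Tendsto (fun n => truncate n t) atTop (𝓝 t) := by
  rcases eq_or_ne t 0 with rfl | ht
  · refine tendsto_const_nhds.congr fun n => ?_
    exact (by simpa using abs_sub_truncate_le n 0 : truncate n 0 = 0).symm
  · refine tendsto_const_nhds.congr' ?_
    have h1 : ∀ᶠ n : ℕ in atTop, ((n : ℝ) + 1)⁻¹ ≤ |t| := by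
      have := tendsto_one_div_add_atTop_nhds_zero_nat (𝕜 := ℝ)
      simp only [one_div] at this
      exact this.eventually_le_const (abs_pos.2 ht)
    filter_upwards [h1, (tendsto_natCast_atTop_atTop (R := ℝ)).eventually_ge_atTop |t|]
      with n hn1 hn2
    have ht : t ∈ {t : ℝ | ((n : ℝ) + 1)⁻¹ ≤ |t| ∧ |t| ≤ n + 1} := ⟨hn1, by linarith⟩
    rw [truncate, Set.indicator_of_mem ht, id]

/-- The lower cutoff matters here: on the support of the truncation φ(F) ≥ φ(1/(n+1)) > 0, so the
bounded truncation is dominated by a multiple of φ(F). -/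
theorem integrable_truncate {F : X → ℝ} (hF : AEMeasurable F ν) (h : modular φ ν F < ∞) (n : ℕ) :
    Integrable (fun x => truncate n (F x)) ν := by
  have hn : (0 : ℝ) < ((n : ℝ) + 1)⁻¹ := by positivity
  have hφ := φ.pos_of_ne_zero hn.ne'
  refine ((integrable_young hF h).const_mul (((n : ℝ) + 1) / φ ((n : ℝ) + 1)⁻¹)).mono'
    ((measurable_truncate n).comp_aemeasurable hF).aestronglyMeasurable (ae_of_all _ fun x => ?_)
  rw [Real.norm_eq_abs]
  by_cases hx : F x ∈ {t : ℝ | ((n : ℝ) + 1)⁻¹ ≤ |t| ∧ |t| ≤ n + 1}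
  · have h1 : φ ((n : ℝ) + 1)⁻¹ ≤ φ (F x) :=
      φ.map_le_map_of_abs_le (by rw [abs_of_pos hn]; exact hx.1)
    refine (abs_truncate_le n _).trans ?_
    rw [div_mul_eq_mul_div, le_div_iff₀ hφ]
    exact mul_le_mul_of_nonneg_left h1 (by positivity)
  · rw [truncate, Set.indicator_of_notMem hx, abs_zero]
    exact mul_nonneg (by positivity) (φ.nonneg _)

theorem tendsto_modular_sub_truncate {F : X → ℝ} (hF : AEMeasurable F ν)
    (h : modular φ ν F < ∞) :
    Tendsto (fun n => modular φ ν (fun x => F x - truncate n (F x))) atTop (𝓝 0) := by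
  rw [← lintegral_zero (μ := ν)]
  refine tendsto_lintegral_of_dominated_convergence' (fun x => ENNReal.ofReal (φ (F x)))
    (fun n => aemeasurable_ofReal_young (hF.sub ((measurable_truncate n).comp_aemeasurable hF)))
    (fun n => ae_of_all _ fun x => ENNReal.ofReal_le_ofReal
      (φ.map_le_map_of_abs_le (abs_sub_truncate_le n _))) h.ne (ae_of_all _ fun x => ?_)
  have := ENNReal.tendsto_ofReal ((φ.continuous'.tendsto _).comp
    ((tendsto_truncate (F x)).const_sub (F x)))
  simpa [φ.map_zero] using this

/-- On [-M, M] convexity puts φ below the chord of slope φ(M)/M, so for uniformly bounded functions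
L¹ convergence implies convergence in modular. -/
theorem modular_le_of_abs_le {f : X → ℝ} {M : ℝ} (hM : 0 < M) (h : ∀ x, |f x| ≤ M) :
    modular φ ν f ≤ ENNReal.ofReal (φ M / M) * ∫⁻ x, ‖f x‖ₑ ∂ν := by
  rw [← lintegral_const_mul' _ _ ENNReal.ofReal_ne_top]
  refine lintegral_mono fun x => ?_
  rw [Real.enorm_eq_ofReal_abs, ← ENNReal.ofReal_mul (div_nonneg (φ.nonneg _) hM.le)]
  apply ENNReal.ofReal_le_ofReal
  have := φ.map_mul_le (c := |f x| / M) (by positivity) ((div_le_one hM).2 (h x)) M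
  rw [div_mul_cancel₀ _ hM.ne', φ.map_abs] at this
  calc _ ≤ _ := this
    _ = _ := by ring

theorem modular_comp_measurePreserving {Y : Type*} [MeasurableSpace Y] {ν' : Measure Y} {g : X → Y}
    (hg : MeasurePreserving g ν ν') {f : Y → ℝ} (hf : AEMeasurable f ν') :
    modular φ ν (fun x => f (g x)) = modular φ ν' f := by
  unfold modular
  have h := aemeasurable_ofReal_young (φ := φ) hf
  rw [← hg.map_eq] at h ⊢
  rw [lintegral_map' h hg.measurable.aemeasurable]

/-- Reduces to the continuity of composition in L¹: the truncation of `F` is bounded and integrable,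
and the error is as small in modular after composing with `g i` as before. -/
theorem tendsto_modular_comp_sub [TopologicalSpace X] [BorelSpace X] [R1Space X]
    [ν.InnerRegularCompactLTTop] [IsLocallyFiniteMeasure ν] (hD : φ.DoublingWith D) {F : X → ℝ}
    (hF : Measurable F) (h : modular φ ν F < ∞) {ι : Type*} {l : Filter ι} {g : ι → C(X, X)}
    (hg : Tendsto g l (𝓝 (ContinuousMap.id X))) (hgm : ∀ i, MeasurePreserving (g i) ν ν) :
    Tendsto (fun i => modular φ ν (fun x => F (g i x) - F x)) l (𝓝 0) := by
  have hFm := hF.aemeasurable (μ := ν)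
  set T : ℕ → X → ℝ := fun n x => truncate n (F x) with hT
  have hTm : ∀ n, Measurable (T n) := fun n => (measurable_truncate n).comp hF
  have hstep : ∀ n i, modular φ ν (fun x => F (g i x) - F x) ≤ ENNReal.ofReal D *
      (modular φ ν (fun x => F x - T n x) + ENNReal.ofReal D *
        (modular φ ν (fun x => T n (g i x) - T n x) + modular φ ν (fun x => F x - T n x))) :=
    fun n i => by
    have hgi := (hgm i).measurable
    have e : (fun x => F (g i x) - F x) = fun x => (F (g i x) - T n (g i x)) +
        ((T n (g i x) - T n x) - (F x - T n x)) := by funext x; ring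
    rw [e]
    refine (modular_add_le_of_doubling hD (f := fun x => F (g i x) - T n (g i x))
      ((hF.comp hgi).sub ((hTm n).comp hgi)).aemeasurable _).trans ?_
    rw [modular_comp_measurePreserving (hgm i) (f := fun x => F x - T n x)
      (hF.sub (hTm n)).aemeasurable]
    gcongr
    exact modular_sub_le_of_doubling hD (f := fun x => T n (g i x) - T n x) (((hTm n).comp hgi).sub (hTm n)).aemeasurable _
  have htr : ∀ n, Tendsto (fun i => modular φ ν (fun x => T n (g i x) - T n x)) l (𝓝 0) :=
    fun n => by
    have hTi : Integrable (T n) ν := integrable_truncate hFm h n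
    set f := hTi.toL1 (T n) with hf
    have hfc := hTi.coeFn_toL1
    have h1 : Tendsto (fun i => Lp.compMeasurePreserving (g i) (hgm i) f) l
        (𝓝 (Lp.compMeasurePreserving (ContinuousMap.id X) (MeasurePreserving.id ν) f)) :=
      Tendsto.compMeasurePreservingLp tendsto_const_nhds hg hgm _ ENNReal.one_ne_top
    have h2 : Lp.compMeasurePreserving (ContinuousMap.id X) (MeasurePreserving.id ν) f = f :=
      Lp.ext (Lp.coeFn_compMeasurePreserving f (MeasurePreserving.id ν))
    rw [h2, tendsto_iff_norm_sub_tendsto_zero] at h1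
    have h3 := ENNReal.tendsto_ofReal h1
    simp only [L1.ofReal_norm_sub_eq_lintegral, ENNReal.ofReal_zero] at h3
    have h4 : ∀ i, ∫⁻ x, ‖Lp.compMeasurePreserving (g i) (hgm i) f x - f x‖ₑ ∂ν =
        ∫⁻ x, ‖T n (g i x) - T n x‖ₑ ∂ν := fun i => by
      refine lintegral_congr_ae ?_
      filter_upwards [Lp.coeFn_compMeasurePreserving f (hgm i), hfc,
        (hgm i).quasiMeasurePreserving.ae hfc] with x e1 e2 e3
      rw [e1, Function.comp_apply, e2, e3]
    simp only [h4] at h3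
    have h5 := ENNReal.Tendsto.const_mul
      (a := ENNReal.ofReal (φ (2 * ((n : ℝ) + 1)) / (2 * ((n : ℝ) + 1)))) h3
      (Or.inr ENNReal.ofReal_ne_top)
    rw [mul_zero] at h5
    refine tendsto_of_tendsto_of_tendsto_of_le_of_le tendsto_const_nhds h5 (fun _ => zero_le)
      fun i => modular_le_of_abs_le (by positivity) fun x => (abs_sub _ _).trans ?_
    linarith [abs_truncate_le n (F (g i x)), abs_truncate_le n (F x)]
  rw [ENNReal.tendsto_nhds_zero]
  intro ε hε
  have hlim := (tendsto_modular_sub_truncate hFm h)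
  have hlim2 : Tendsto (fun n => ENNReal.ofReal D * (modular φ ν (fun x => F x - T n x) +
      ENNReal.ofReal D * modular φ ν (fun x => F x - T n x))) atTop (𝓝 0) := by
    have := ENNReal.Tendsto.const_mul (a := ENNReal.ofReal D) (hlim.add
      (ENNReal.Tendsto.const_mul (a := ENNReal.ofReal D) hlim (Or.inr ENNReal.ofReal_ne_top)))
      (Or.inr ENNReal.ofReal_ne_top)
    simpa only [mul_zero, add_zero] using this
  obtain ⟨n, hn⟩ := (hlim2.eventually_lt_const hε).exists
  have hlim3 : Tendsto (fun i => ENNReal.ofReal D * (modular φ ν (fun x => F x - T n x) +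
      ENNReal.ofReal D * (modular φ ν (fun x => T n (g i x) - T n x) +
        modular φ ν (fun x => F x - T n x)))) l
      (𝓝 (ENNReal.ofReal D * (modular φ ν (fun x => F x - T n x) +
        ENNReal.ofReal D * (0 + modular φ ν (fun x => F x - T n x))))) :=
    ENNReal.Tendsto.const_mul ((ENNReal.Tendsto.const_mul ((htr n).add_const _)
      (Or.inr ENNReal.ofReal_ne_top)).const_add _) (Or.inr ENNReal.ofReal_ne_top)
  rw [zero_add] at hlim3
  filter_upwards [hlim3.eventually_le_const hn] with i hi
  exact (hstep n i).trans hi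

end Translation

/-! ### The cocycle of a Dirichlet function -/

section Cocycle

variable {G : Type*} [Group G] [MetricSpace G] [IsTopologicalGroup G]
  [SecondCountableTopology G] [MeasurableSpace G] [BorelSpace G]
  {μ : Measure G} [SFinite μ] [μ.IsMulRightInvariant] {S U : Set G} {φ : YoungFunction} {D : ℝ}

theorem luxNorm_rightTranslate (g : G) (f : G →ₘ[μ] ℝ) :
    luxNorm φ μ (rightTranslate μ g f) = luxNorm φ μ f := by
  simp only [luxNorm, luxSet, modular_rightTranslate]

theorem rightTranslate_mem_orlicz (g : G) {f : G →ₘ[μ] ℝ} (hf : f ∈ orlicz φ μ) :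
    rightTranslate μ g f ∈ orlicz φ μ := by
  obtain ⟨α, hα, h⟩ := hf
  exact ⟨α, hα, by rwa [modular_rightTranslate]⟩

theorem rightTranslate_mul (g h : G) (f : G →ₘ[μ] ℝ) :
    rightTranslate μ (g * h) f = rightTranslate μ g (rightTranslate μ h f) := by
  rw [map_mul, Module.End.mul_apply]

theorem rightTranslate_mul_sub (g h : G) (f : G →ₘ[μ] ℝ) :
    rightTranslate μ (g * h) f - f =
      rightTranslate μ g (rightTranslate μ h f - f) + (rightTranslate μ g f - f) := by
  rw [rightTranslate_mul, map_sub]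
  abel

theorem coeFn_rightTranslate_sub (g : G) (f : G →ₘ[μ] ℝ) :
    ⇑(rightTranslate μ g f - f) =ᵐ[μ] fun x => f (x * g) - f x := by
  filter_upwards [AEEqFun.coeFn_sub (rightTranslate μ g f) f, coeFn_rightTranslate μ g f]
    with x h1 h2
  rw [h1, Pi.sub_apply, h2]

/-- The difference function `(s, x) ↦ f(xs) - f(x)`, extended by `0` from `S × G` to `G × G`. -/
def extDiff (S : Set G) (f : G → ℝ) : G × G → ℝ :=
  (S ×ˢ Set.univ).indicator fun p => f (p.2 * p.1) - f p.2

theorem measurable_extDiff (hSm : MeasurableSet S) {f : G → ℝ} (hf : Measurable f) :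
    Measurable (extDiff S f) :=
  ((hf.comp (measurable_snd.mul measurable_fst)).sub (hf.comp measurable_snd)).indicator
    (hSm.prod MeasurableSet.univ)

theorem modular_extDiff (hSm : MeasurableSet S) (f : G →ₘ[μ] ℝ) :
    modular φ (μ.prod μ) (extDiff S f) = modular φ ((μ.restrict S).prod μ) (diffMap μ S f) := by
  rw [modular_congr _ _ (coeFn_diffMap μ S f)]
  have h : (μ.restrict S).prod μ = (μ.prod μ).restrict (S ×ˢ Set.univ) := by
    rw [← Measure.prod_restrict, Measure.restrict_univ]
  unfold modular
  rw [h, ← lintegral_indicator (hSm.prod MeasurableSet.univ)]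
  refine lintegral_congr fun p => ?_
  by_cases hp : p ∈ S ×ˢ (Set.univ : Set G)
  · rw [extDiff, Set.indicator_of_mem hp, Set.indicator_of_mem hp]
  · rw [extDiff, Set.indicator_of_notMem hp, Set.indicator_of_notMem hp, φ.map_zero,
      ENNReal.ofReal_zero]

/-- The map `(s, x) ↦ (g⁻¹s, xg)`. -/
def shear (g : G) : C(G × G, G × G) := ⟨fun p => (g⁻¹ * p.1, p.2 * g), by fun_prop⟩

theorem measurePreserving_shear [μ.IsMulLeftInvariant] (g : G) :
    MeasurePreserving (shear g) (μ.prod μ) (μ.prod μ) :=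
  (measurePreserving_mul_left μ g⁻¹).prod (measurePreserving_mul_right μ g)

theorem tendsto_shear : Tendsto (shear (G := G)) (𝓝 1) (𝓝 (ContinuousMap.id (G × G))) := by
  have hc : Continuous (shear (G := G)) := by
    refine ContinuousMap.continuous_of_continuous_uncurry _ ?_
    change Continuous fun q : G × (G × G) => (q.1⁻¹ * q.2.1, q.2.2 * q.1)
    fun_prop
  have h1 : shear (1 : G) = ContinuousMap.id (G × G) := by
    ext p <;> simp [shear]
  exact h1 ▸ hc.tendsto 1

/-- Since (f(xg·g⁻¹s) - f(xg)) - (f(xs) - f(x)) = f(x) - f(xg), the variable `s` disappears over `W`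
and integrating it out produces μ(W). This bounds π(g)f - f by the displacement of the difference
function under `shear`. -/
theorem measure_mul_modular_rightTranslate_sub_le {W : Set G} (hW : MeasurableSet W) {g : G}
    (hWS : W ⊆ S) (hgW : ∀ s ∈ W, g⁻¹ * s ∈ S) (f : G →ₘ[μ] ℝ) :
    μ W * modular φ μ ⇑(rightTranslate μ g f - f) ≤
      modular φ (μ.prod μ) (fun p => extDiff S f (shear g p) - extDiff S f p) := by
  rw [modular_congr _ _ (coeFn_rightTranslate_sub g f)]
  have hm : AEMeasurable (fun x => f (x * g) - f x) μ :=
    (f.aemeasurable.comp_quasiMeasurePreserving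
      (measurePreserving_mul_right μ g).quasiMeasurePreserving).sub f.aemeasurable
  rw [← modular_snd_prod hm]
  have h : (μ.restrict W).prod μ = (μ.prod μ).restrict (W ×ˢ Set.univ) := by
    rw [← Measure.prod_restrict, Measure.restrict_univ]
  unfold modular
  rw [h]
  refine (setLIntegral_mono_ae' (hW.prod MeasurableSet.univ) (ae_of_all _ fun p hp => ?_)).trans
    (setLIntegral_le_lintegral _ _)
  have h1 : p ∈ S ×ˢ (Set.univ : Set G) := ⟨hWS hp.1, trivial⟩
  have h2 : shear g p ∈ S ×ˢ (Set.univ : Set G) := ⟨hgW _ hp.1, trivial⟩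
  beta_reduce
  rw [extDiff, Set.indicator_of_mem h1, Set.indicator_of_mem h2, ← φ.even]
  apply le_of_eq
  congr 2
  simp [shear, mul_assoc]

theorem exists_nhds_modular_le [μ.IsOpenPosMeasure] (hS : μ S ≠ ∞) (hUS : U ⊆ S)
    (hUo : IsOpen U) (hU1 : (1 : G) ∈ U) (φ : YoungFunction) {g : G} (hg : g ∈ U) :
    ∃ V ∈ 𝓝 g, ∃ C : ℝ, 1 ≤ C ∧ ∀ g' ∈ V, ∀ f : G →ₘ[μ] ℝ,
      modular φ μ ⇑(rightTranslate μ g' f - f) ≤ ENNReal.ofReal C *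
        modular φ (μ.prod μ) (fun p => extDiff S f (shear g' p) - extDiff S f p) := by
  have hopen : IsOpen {q : G × G | q.1⁻¹ * q.2 ∈ U ∧ q.2 ∈ U} :=
    (hUo.preimage (f := fun q : G × G => q.1⁻¹ * q.2) (by fun_prop)).inter
      (hUo.preimage continuous_snd)
  -- Both sets are neighbourhoods of `g`: as g⁻¹g = 1 ∈ U, small ones satisfy V⁻¹W ⊆ U and W ⊆ U, so
  -- a single `W` serves every `g'` in `V`.
  obtain ⟨V, W, hVo, hgV, hWo, hgW, hVW⟩ := mem_nhds_prod_iff'.1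
    (hopen.mem_nhds (show (g, g) ∈ _ by simpa using ⟨hU1, hg⟩))
  have hWS : W ⊆ S := fun s hs => hUS (hVW (Set.mk_mem_prod hgV hs)).2
  have hW0 : μ W ≠ 0 := (hWo.measure_pos μ ⟨g, hgW⟩).ne'
  have hWt : μ W ≠ ∞ := measure_ne_top_of_subset hWS hS
  refine ⟨V, hVo.mem_nhds hgV, max 1 (μ W)⁻¹.toReal, le_max_left _ _, fun g' hg' f => ?_⟩
  have := measure_mul_modular_rightTranslate_sub_le (φ := φ) hWo.measurableSet hWS
    (fun s hs => hUS (hVW (Set.mk_mem_prod hg' hs)).1) f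
  rw [mul_comm, ← ENNReal.le_div_iff_mul_le (Or.inl hW0) (Or.inl hWt),
    ENNReal.div_eq_inv_mul] at this
  refine this.trans ?_
  gcongr
  exact (ENNReal.ofReal_toReal (ENNReal.inv_ne_top.2 hW0)).symm.trans_le
    (ENNReal.ofReal_le_ofReal (le_max_right _ _))

theorem modular_extDiff_shear_sub_le [μ.IsMulLeftInvariant] (hD : φ.DoublingWith D)
    (hSm : MeasurableSet S) (g : G) (f : G →ₘ[μ] ℝ) :
    modular φ (μ.prod μ) (fun p => extDiff S f (shear g p) - extDiff S f p) ≤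
      ENNReal.ofReal (2 * D) * modular φ ((μ.restrict S).prod μ) (diffMap μ S f) := by
  have hm := measurable_extDiff hSm f.measurable
  refine (modular_sub_le_of_doubling hD (f := fun p => extDiff S f (shear g p))
    (hm.comp (shear g).continuous.measurable).aemeasurable _).trans_eq ?_
  rw [modular_comp_measurePreserving (measurePreserving_shear g) hm.aemeasurable,
    modular_extDiff hSm, ← two_mul, ← mul_assoc, mul_comm (ENNReal.ofReal D),
    ENNReal.ofReal_mul zero_le_two, ENNReal.ofReal_ofNat]

theorem modular_coe_inv_smul {Z : Type*} [MeasurableSpace Z] {ν : Measure Z} (α : ℝ)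
    (f : Z →ₘ[ν] ℝ) : modular φ ν ⇑(α⁻¹ • f) = modular φ ν (fun z => f z / α) :=
  modular_congr _ _ ((AEEqFun.coeFn_smul α⁻¹ f).mono fun z hz => by
    simp only [hz, Pi.smul_apply, smul_eq_mul, div_eq_inv_mul])

/-- The maps `f ↦ π(g)f - f` are bounded from `D_φ(G)` to `L^φ(G)`, locally uniformly in `g`. -/
theorem exists_nhds_luxNorm_le [μ.IsMulLeftInvariant] [μ.IsOpenPosMeasure]
    (hD : φ.DoublingWith D) (hSm : MeasurableSet S)
    (hS : μ S ≠ ∞) (hUS : U ⊆ S) (hUo : IsOpen U) (hU1 : (1 : G) ∈ U)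
    (hUgen : Subgroup.closure U = ⊤) (g : G) :
    ∃ V ∈ 𝓝 g, ∃ C : ℝ, 0 ≤ C ∧ ∀ g' ∈ V, ∀ f ∈ dirichlet μ S φ,
      rightTranslate μ g' f - f ∈ orlicz φ μ ∧
      luxNorm φ μ (rightTranslate μ g' f - f) ≤
        C * luxNorm φ ((μ.restrict S).prod μ) (diffMap μ S f) := by
  have hU : ∀ g ∈ U, ∃ V ∈ 𝓝 g, ∃ C : ℝ, 0 ≤ C ∧ ∀ g' ∈ V, ∀ f ∈ dirichlet μ S φ,
      rightTranslate μ g' f - f ∈ orlicz φ μ ∧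
      luxNorm φ μ (rightTranslate μ g' f - f) ≤
        C * luxNorm φ ((μ.restrict S).prod μ) (diffMap μ S f) := fun g hg => by
    obtain ⟨V, hV, C, hC, H⟩ := exists_nhds_modular_le (μ := μ) hS hUS hUo hU1 φ hg
    have hC' : 1 ≤ C * (2 * D) := by nlinarith [hD.1]
    have H' : ∀ g' ∈ V, ∀ f : G →ₘ[μ] ℝ, modular φ μ ⇑(rightTranslate μ g' f - f) ≤
        ENNReal.ofReal (C * (2 * D)) *
          modular φ ((μ.restrict S).prod μ) (diffMap μ S f) := fun g' hg' f => by
      rw [ENNReal.ofReal_mul (by linarith), mul_assoc]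
      refine (H g' hg' f).trans ?_
      gcongr
      exact modular_extDiff_shear_sub_le hD hSm g' f
    refine ⟨V, hV, C * (2 * D), by linarith, fun g' hg' f hf => ⟨?_, ?_⟩⟩
    · rw [mem_orlicz_iff hD]
      exact (H' g' hg' f).trans_lt (ENNReal.mul_lt_top ENNReal.ofReal_lt_top
        ((mem_orlicz_iff hD _).1 hf))
    · refine luxNorm_le_mul hC' hf fun α _ => ?_
      -- The modular bound is applied to the Dirichlet function α⁻¹f, for every scale α.
      rw [← modular_coe_inv_smul, ← modular_coe_inv_smul, smul_sub, ← map_smul, ← map_smul]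
      exact H' g' hg' _
  have hg : g ∈ Subgroup.closure U := by rw [hUgen]; trivial
  induction hg using Subgroup.closure_induction with
  | mem u hu => exact hU u hu
  | one => exact hU 1 hU1
  | mul a b _ _ ha hb =>
    obtain ⟨V, hV, C, hC, H⟩ := ha
    obtain ⟨W, hW, C', hC', H'⟩ := hb
    -- The factor `a` stays fixed and only a⁻¹g' varies near `b`; the cocycle identity and the
    -- isometry of translations add the two constants.
    refine ⟨{g' | a⁻¹ * g' ∈ W}, ?_, C' + C, by positivity, fun g' hg' f hf => ?_⟩
    · have : ContinuousAt (fun g' : G => a⁻¹ * g') (a * b) := by fun_prop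
      exact this (by simpa using hW)
    · obtain ⟨h1, h2⟩ := H a (mem_of_mem_nhds hV) f hf
      obtain ⟨h3, h4⟩ := H' _ hg' f hf
      have e := rightTranslate_mul_sub a (a⁻¹ * g') f
      rw [mul_inv_cancel_left] at e
      rw [e]
      have h5 := rightTranslate_mem_orlicz a h3
      refine ⟨(orlicz φ μ).add_mem h5 h1, (luxNorm_add_le φ μ h5 h1).trans ?_⟩
      rw [luxNorm_rightTranslate, add_mul]
      exact add_le_add h4 h2
  | inv a _ ha =>
    obtain ⟨V, hV, C, hC, H⟩ := ha
    refine ⟨V⁻¹, continuous_inv.tendsto a⁻¹ (by simpa using hV), C, hC, fun g' hg' f hf => ?_⟩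
    obtain ⟨h1, h2⟩ := H _ (Set.mem_inv.1 hg') f hf
    have e : rightTranslate μ g' f - f =
        (-1 : ℝ) • rightTranslate μ g' (rightTranslate μ g'⁻¹ f - f) := by
      rw [map_sub, ← rightTranslate_mul, mul_inv_cancel, map_one, Module.End.one_apply]
      module
    rw [e]
    refine ⟨(orlicz φ μ).smul_mem _ (rightTranslate_mem_orlicz _ h1), ?_⟩
    rw [luxNorm_smul, luxNorm_rightTranslate, abs_neg, abs_one, one_mul]
    exact h2

/-- For a Dirichlet function `f`, `π(g)f - f → 0` in `L^φ(G)` as `g → 1`. -/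
theorem tendsto_luxNorm_rightTranslate_sub [LocallyCompactSpace G] [μ.IsHaarMeasure]
    (hD : φ.DoublingWith D) (hSm : MeasurableSet S)
    (hS : μ S ≠ ∞) (hUS : U ⊆ S) (hUo : IsOpen U) (hU1 : (1 : G) ∈ U) {f : G →ₘ[μ] ℝ}
    (hf : f ∈ dirichlet μ S φ) :
    Tendsto (fun g => luxNorm φ μ (rightTranslate μ g f - f)) (𝓝 1) (𝓝 0) := by
  obtain ⟨V, hV, C, hC, H⟩ := exists_nhds_modular_le (μ := μ) hS hUS hUo hU1 φ hU1
  have h1 : modular φ (μ.prod μ) (extDiff S f) < ∞ := by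
    rw [modular_extDiff hSm]
    exact (mem_orlicz_iff hD _).1 hf
  have h2 := tendsto_modular_comp_sub hD (measurable_extDiff hSm f.measurable) h1
    tendsto_shear measurePreserving_shear
  have h3 := ENNReal.Tendsto.const_mul (a := ENNReal.ofReal C) h2 (Or.inr ENNReal.ofReal_ne_top)
  rw [mul_zero] at h3
  refine tendsto_luxNorm_zero hD (tendsto_of_tendsto_of_tendsto_of_le_of_le' tendsto_const_nhds h3
    (Eventually.of_forall fun _ => zero_le) ?_)
  filter_upwards [hV] with g hg
  exact H g hg f

end Cocycle


/-! ### Primitives of cocycles -/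

section Primitive

/-- Finiteness of the sum makes ∑ φ(f_n - w) finite almost everywhere, so its terms tend to 0, and φ
is bounded away from 0 outside each neighbourhood of 0. -/
theorem ae_tendsto_of_tsum_modular_ne_top {X : Type*} [MeasurableSpace X] {ν : Measure X}
    {φ : YoungFunction} {f : ℕ → X → ℝ} (hf : ∀ n, AEMeasurable (f n) ν) {w : X → ℝ}
    (hw : AEMeasurable w ν) (h : ∑' n, modular φ ν (fun x => f n x - w x) ≠ ∞) :
    ∀ᵐ x ∂ν, Tendsto (fun n => f n x) atTop (𝓝 (w x)) := by
  have hm : ∀ n, AEMeasurable (fun x => ENNReal.ofReal (φ (f n x - w x))) ν := fun n =>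
    aemeasurable_ofReal_young ((hf n).sub hw)
  unfold modular at h
  rw [← lintegral_tsum hm] at h
  filter_upwards [ae_lt_top' (AEMeasurable.tsum hm) h] with x hx
  have h0 := ENNReal.tendsto_atTop_zero_of_tsum_ne_top hx.ne
  rw [tendsto_iff_dist_tendsto_zero, Metric.tendsto_nhds]
  intro ε hε
  filter_upwards [h0.eventually_lt_const (ENNReal.ofReal_pos.2 (φ.pos_of_ne_zero hε.ne'))]
    with n hn
  rw [dist_zero_right, Real.norm_of_nonneg dist_nonneg, Real.dist_eq]
  by_contra! hlt
  exact absurd hn (not_lt.2 (ENNReal.ofReal_le_ofReal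
    (φ.map_le_map_of_abs_le (by rwa [abs_of_pos hε]))))

variable {G : Type*} [Group G] [MetricSpace G] [IsTopologicalGroup G]
  [SecondCountableTopology G] [MeasurableSpace G] [BorelSpace G]
  {μ : Measure G} [SFinite μ] {φ : YoungFunction}

/-- A continuous map into `L^φ(G)` is represented by a jointly measurable function. -/
theorem exists_measurable_uncurry {b : G → orlicz φ μ} (hb : Continuous b) :
    ∃ B : G × G → ℝ, Measurable B ∧
      ∀ᵐ g ∂μ, (fun x => B (g, x)) =ᵐ[μ] ((b g : orlicz φ μ) : G →ₘ[μ] ℝ) := by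
  obtain ⟨e, he⟩ : ∃ e : ℕ → G, DenseRange e := ⟨_, TopologicalSpace.denseRange_denseSeq G⟩
  have hex : ∀ n : ℕ, ∃ N : G → ℕ, Measurable N ∧ ∀ g, ‖b g - b (e (N g))‖ < (2⁻¹ : ℝ) ^ n :=
    fun n => by
    have hex : ∀ g : G, ∃ i, ‖b g - b (e i)‖ < (2⁻¹ : ℝ) ^ n := fun g => by
      have ho : IsOpen {g' | ‖b g - b g'‖ < (2⁻¹ : ℝ) ^ n} :=
        isOpen_lt (by fun_prop) continuous_const
      obtain ⟨_, hg', i, rfl⟩ := he.inter_open_nonempty _ ho ⟨g, by simp⟩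
      exact ⟨i, hg'⟩
    have hm : Measurable fun g => Nat.find (hex g) := measurable_find _ fun i =>
      (isOpen_lt (by fun_prop) continuous_const :
        IsOpen {g | ‖b g - b (e i)‖ < (2⁻¹ : ℝ) ^ n}).measurableSet
    exact ⟨_, hm, fun g => Nat.find_spec (hex g)⟩
  choose N hNm hN using hex
  -- In its first variable `B n` factors through the countable index `N n`, hence it is jointly
  -- measurable. For every `g` it approximates `b g` within 2⁻ⁿ, a summable error.
  set B : ℕ → G × G → ℝ := fun n p => ((b (e (N n p.1)) : orlicz φ μ) : G →ₘ[μ] ℝ) p.2 with hB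
  have hBm : ∀ n, Measurable (B n) := fun n => by
    have h1 : Measurable fun q : ℕ × G => ((b (e q.1) : orlicz φ μ) : G →ₘ[μ] ℝ) q.2 :=
      measurable_from_prod_countable_right fun i =>
      AEEqFun.measurable (b (e i) : G →ₘ[μ] ℝ)
    exact h1.comp (((hNm n).comp measurable_fst).prodMk measurable_snd)
  have hconv : ∀ g, ∀ᵐ x ∂μ, Tendsto (fun n => B n (g, x)) atTop
      (𝓝 (((b g : orlicz φ μ) : G →ₘ[μ] ℝ) x)) := fun g => by
    refine ae_tendsto_of_tsum_modular_ne_top (φ := φ)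
      (f := fun n => ⇑(b (e (N n g)) : G →ₘ[μ] ℝ)) (w := ⇑(b g : G →ₘ[μ] ℝ))
      (fun n => (b (e (N n g)) : G →ₘ[μ] ℝ).aemeasurable) (b g : G →ₘ[μ] ℝ).aemeasurable ?_
    have hle : ∀ n, modular φ μ (fun x => (b (e (N n g)) : G →ₘ[μ] ℝ) x - (b g : G →ₘ[μ] ℝ) x) ≤
        2⁻¹ ^ n := fun n => by
      have hlt := hN n g
      rw [norm_sub_rev] at hlt
      have h1 : modular φ μ ⇑((b (e (N n g)) : G →ₘ[μ] ℝ) - (b g : G →ₘ[μ] ℝ)) ≤ _ :=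
        modular_le_of_luxNorm_lt (b (e (N n g)) - b g).2
          (pow_le_one₀ (by norm_num) (by norm_num)) hlt
      rw [ENNReal.ofReal_pow (by norm_num), ENNReal.ofReal_inv_of_pos two_pos,
        ENNReal.ofReal_ofNat] at h1
      exact (modular_congr _ _ (AEEqFun.coeFn_sub _ _)).symm.trans_le h1
    refine ne_top_of_le_ne_top ?_ (ENNReal.tsum_le_tsum hle)
    rw [ENNReal.tsum_geometric, ENNReal.one_sub_inv_two, inv_inv]
    exact ENNReal.ofNat_ne_top
  have hC : MeasurableSet {p : G × G | ∃ a, Tendsto (fun n => B n p) atTop (𝓝 a)} :=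
    measurableSet_exists_tendsto hBm
  have hae : ∀ᵐ p ∂μ.prod μ, ∃ a, Tendsto (fun n => B n p) atTop (𝓝 a) :=
    (Measure.ae_prod_mem_iff_ae_ae_mem hC).2
      (ae_of_all _ fun g => (hconv g).mono fun x hx => ⟨_, hx⟩)
  obtain ⟨B', hB'm, hB'⟩ := measurable_limit_of_tendsto_metrizable_ae
    (fun n => (hBm n).aemeasurable) hae
  refine ⟨B', hB'm, ?_⟩
  filter_upwards [Measure.ae_ae_of_ae_prod hB'] with g hg
  filter_upwards [hg, hconv g] with x h1 h2
  exact tendsto_nhds_unique h1 h2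

variable [μ.IsMulRightInvariant]

/-- A continuous cocycle `b : G → L^φ(G)` has a measurable primitive: `b(g) = π(g)f - f`. -/
theorem exists_primitive [μ.IsMulLeftInvariant] [μ.IsOpenPosMeasure] {b : G → orlicz φ μ}
    (hb : Continuous b)
    (hmul : ∀ g h, (b (g * h) : G →ₘ[μ] ℝ) = b g + rightTranslate μ g (b h)) :
    ∃ f : G →ₘ[μ] ℝ, ∀ g, (b g : G →ₘ[μ] ℝ) = rightTranslate μ g f - f := by
  obtain ⟨B, hBm, hB⟩ := exists_measurable_uncurry hb
  have hq : Measure.QuasiMeasurePreserving (fun p : G × G => p.2 * p.1) (μ.prod μ) μ := by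
    simpa using quasiMeasurePreserving_mul_restrict μ Set.univ
  have h1 : ∀ᵐ q ∂μ.prod μ, ∀ᵐ x ∂μ,
      B (q.2 * q.1, x) = B (q.2, x) + B (q.1, x * q.2) := by
    filter_upwards [hq.ae hB, Measure.quasiMeasurePreserving_fst.ae hB,
      Measure.quasiMeasurePreserving_snd.ae hB] with q e1 e2 e3
    have e4 := (measurePreserving_mul_right μ q.2).quasiMeasurePreserving.ae e2
    have e5 : ((b (q.2 * q.1) : orlicz φ μ) : G →ₘ[μ] ℝ) =ᵐ[μ]
        fun x => (b q.2 : G →ₘ[μ] ℝ) x + (b q.1 : G →ₘ[μ] ℝ) (x * q.2) := by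
      rw [hmul]
      filter_upwards [AEEqFun.coeFn_add (b q.2 : G →ₘ[μ] ℝ) (rightTranslate μ q.2 (b q.1)),
        coeFn_rightTranslate μ q.2 (b q.1 : G →ₘ[μ] ℝ)] with x i1 i2
      rw [i1, Pi.add_apply, i2]
    filter_upwards [e1, e3, e4, e5] with x i1 i3 i4 i5
    rw [i1, i3, i4, i5]
  have hmeas : MeasurableSet {z : (G × G) × G |
      B (z.1.2 * z.1.1, z.2) = B (z.1.2, z.2) + B (z.1.1, z.2 * z.1.2)} := by
    refine measurableSet_eq_fun (hBm.comp ?_) ((hBm.comp ?_).add (hBm.comp ?_)) <;> fun_prop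
  rw [Measure.ae_ae_comm hmeas] at h1
  -- After exchanging quantifiers, the cocycle identity at the frozen point `x₀` reads B(h, x₀g) =
  -- B(gh, x₀) - B(g, x₀). With y = x₀g this is f(yh) - f(y) for f(y) = B(x₀⁻¹y, x₀).
  obtain ⟨x₀, hx₀⟩ := h1.exists
  have hfm : Measurable fun y => B (x₀⁻¹ * y, x₀) := hBm.comp (by fun_prop)
  set f : G →ₘ[μ] ℝ := AEEqFun.mk _ hfm.aestronglyMeasurable with hf
  have hfc : f =ᵐ[μ] fun y => B (x₀⁻¹ * y, x₀) := AEEqFun.coeFn_mk _ _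
  have h2 : ∀ᵐ h ∂μ, (b h : G →ₘ[μ] ℝ) = rightTranslate μ h f - f := by
    filter_upwards [Measure.ae_ae_of_ae_prod hx₀, hB] with h e1 e2
    refine AEEqFun.ext (EventuallyEq.trans ?_ (coeFn_rightTranslate_sub h f).symm)
    filter_upwards [(measurePreserving_mul_left μ x₀⁻¹).quasiMeasurePreserving.ae e1, e2, hfc,
      (measurePreserving_mul_right μ h).quasiMeasurePreserving.ae hfc] with y i1 i2 i3 i4
    rw [i3, i4, ← i2, ← mul_assoc, i1, mul_inv_cancel_left]
    ring
  refine ⟨f, fun g => ?_⟩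
  -- To pass from almost every element to every `g`, choose `h` such that the formula holds at both
  -- `h` and `g * h`, and cancel in the cocycle identity.
  obtain ⟨h, e1, e2⟩ :=
    (h2.and ((measurePreserving_mul_left μ g).quasiMeasurePreserving.ae h2)).exists
  have e3 := hmul g h
  rw [e1, e2, rightTranslate_mul, map_sub] at e3
  exact (eq_sub_of_add_eq e3.symm).trans (by abel)

end Primitive


/-! ### Harmonic representatives of classes modulo `L^φ` and of cohomology classes -/

section Classes

variable {G : Type*} [Group G] [MetricSpace G] [IsTopologicalGroup G]
  [SecondCountableTopology G] [MeasurableSpace G] [BorelSpace G]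
  {μ : Measure G} [SFinite μ] [μ.IsMulRightInvariant] {S U : Set G} {φ : YoungFunction} {D : ℝ}

theorem norm_dirichlet (f : dirichlet μ S φ) :
    ‖f‖ = luxNorm φ ((μ.restrict S).prod μ) (diffMap μ S f) := rfl

/-- `f` is a limit of functions in `L^φ(G)` for the seminorm of `D_φ(G)`. -/
def IsOrliczLimit (μ : Measure G) [SFinite μ] [μ.IsMulRightInvariant] (S : Set G)
    (φ : YoungFunction) (f : G →ₘ[μ] ℝ) : Prop :=
  ∀ ε : ℝ, 0 < ε → ∃ u ∈ orlicz φ μ, luxNorm φ ((μ.restrict S).prod μ) (diffMap μ S (f - u)) < ε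

/-- Constants have zero seminorm, so the quotient by them changes no distance and the closure can be
tested on functions. -/
theorem mk_mem_closure_iff (hD : φ.DoublingWith D) (hS : μ S ≠ ∞) (f : dirichlet μ S φ) :
    (Submodule.Quotient.mk f : DirichletMod μ S φ) ∈ (orliczMod μ S φ).topologicalClosure ↔
      IsOrliczLimit μ S φ f := by
  rw [← SetLike.mem_coe, Submodule.topologicalClosure_coe, Metric.mem_closure_iff]
  refine forall₂_congr fun ε hε => ?_
  constructor
  · rintro ⟨_, ⟨u, hu, rfl⟩, hdist⟩
    rw [dist_eq_norm, Submodule.mkQ_apply, ← Submodule.Quotient.mk_sub] at hdist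
    obtain ⟨m, hm, hlt⟩ := Submodule.Quotient.norm_mk_lt
      (Submodule.Quotient.mk (f - u) : DirichletMod μ S φ) (sub_pos.2 hdist)
    rw [add_sub_cancel] at hlt
    refine ⟨u, hu, ?_⟩
    obtain ⟨c, hc⟩ := (Submodule.Quotient.eq _).1 hm
    rw [norm_dirichlet] at hlt
    have h0 := diffMap_const (μ := μ) (S := S) c
    rw [← hc, Submodule.coe_sub, map_sub, sub_eq_zero] at h0
    rwa [h0, Submodule.coe_sub] at hlt
  · rintro ⟨u, hu, hlt⟩
    set u' : dirichlet μ S φ := ⟨u, orlicz_le_dirichlet hD hS hu⟩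
    refine ⟨Submodule.Quotient.mk u', ⟨u', hu, rfl⟩, ?_⟩
    rw [dist_eq_norm, ← Submodule.Quotient.mk_sub]
    exact (Submodule.Quotient.norm_mk_le _ (f - u')).trans_lt hlt

/-- Integrating the slice bounds over `S` gives modular at most μ(S), which convexity absorbs into a
norm factor. This bridges bounds on cocycles over `S` and the Dirichlet seminorm. -/
theorem luxNorm_diffMap_le_of_forall_modular_le (hSm : MeasurableSet S)
    (hS : μ S ≠ ∞) {w : G →ₘ[μ] ℝ} {ε : ℝ} (hε : 0 < ε)
    (h : ∀ s ∈ S, modular φ μ (fun x => (rightTranslate μ s w - w : G →ₘ[μ] ℝ) x / ε) ≤ 1) :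
    w ∈ dirichlet μ S φ ∧
      luxNorm φ ((μ.restrict S).prod μ) (diffMap μ S w) ≤ max 1 (μ S).toReal * ε := by
  have h1 : modular φ ((μ.restrict S).prod μ) (fun p => diffMap μ S w p / ε) ≤ μ S := by
    rw [modular_diffMap]
    refine (setLIntegral_mono' hSm (g := fun _ => 1) fun s hs => ?_).trans_eq (setLIntegral_one S)
    refine le_of_eq_of_le ?_ (h s hs)
    exact modular_congr φ μ ((coeFn_rightTranslate_sub s w).symm.mono fun x hx => by
      simp only [← hx])
  refine ⟨⟨ε, hε, h1.trans_lt hS.lt_top⟩, ?_⟩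
  set c := max 1 (μ S).toReal with hc
  have hc1 : 1 ≤ c := le_max_left _ _
  have hc0 : 0 < c := by linarith
  refine luxNorm_le_of_modular_le (mul_pos hc0 hε) ?_
  have e : (fun p => diffMap μ S w p / (c * ε)) = fun p => c⁻¹ * (diffMap μ S w p / ε) := by
    funext p
    field_simp
  rw [e]
  calc _ ≤ ENNReal.ofReal c⁻¹ * modular φ ((μ.restrict S).prod μ) (fun p => diffMap μ S w p / ε) :=
        modular_smul_le φ _ (inv_nonneg.2 hc0.le) (inv_le_one_of_one_le₀ hc1) _
    _ ≤ ENNReal.ofReal c⁻¹ * ENNReal.ofReal c := by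
        gcongr
        refine h1.trans ?_
        rw [← ENNReal.ofReal_toReal hS]
        exact ENNReal.ofReal_le_ofReal (le_max_right _ _)
    _ = 1 := by
        rw [← ENNReal.ofReal_mul (inv_nonneg.2 hc0.le), inv_mul_cancel₀ hc0.ne', ENNReal.ofReal_one]

/-! ### Homogeneous cocycles and their primitives. -/

theorem coe_rightRegular (g : G) (u : orlicz φ μ) :
    (rightRegular μ φ g u : G →ₘ[μ] ℝ) = rightTranslate μ g u := rfl

theorem mem_cocycles_of_eq {ω : C(Fin 2 → G, orlicz φ μ)} {f : G →ₘ[μ] ℝ}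
    (h : ∀ x : Fin 2 → G, (ω x : G →ₘ[μ] ℝ) = rightTranslate μ (x 1) f - rightTranslate μ (x 0) f) :
    ω ∈ cocycles (rightRegular μ φ) 1 := by
  refine ⟨fun g x => Subtype.ext ?_, ?_⟩
  · rw [coe_rightRegular, h, h, map_sub, ← rightTranslate_mul, ← rightTranslate_mul,
      mul_inv_cancel_left, mul_inv_cancel_left]
  · refine LinearMap.mem_ker.2 ?_
    ext1 x
    apply Subtype.ext
    have e : cobound G (orlicz φ μ) 1 ω x = ω (fun j => x (Fin.succAbove 0 j)) -
        ω (fun j => x (Fin.succAbove 1 j)) + ω (fun j => x (Fin.succAbove 2 j)) := by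
      simp [cobound, Fin.sum_univ_three, sub_eq_add_neg]
    rw [e]
    simp only [Submodule.coe_add, Submodule.coe_sub, h, ContinuousMap.zero_apply,
      Submodule.coe_zero]
    simp [Fin.succAbove, Fin.lt_def]

theorem rightTranslate_sub_eq_of_mem_invCochains {ω : C(Fin 2 → G, orlicz φ μ)}
    (hω : ω ∈ invCochains (rightRegular μ φ) 1) {f : G →ₘ[μ] ℝ}
    (h : ∀ g, (ω ![1, g] : G →ₘ[μ] ℝ) = rightTranslate μ g f - f) (x : Fin 2 → G) :
    (ω x : G →ₘ[μ] ℝ) = rightTranslate μ (x 1) f - rightTranslate μ (x 0) f := by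
  have e : (fun j => (x 0)⁻¹ * x j) = ![1, (x 0)⁻¹ * x 1] := by
    ext j
    fin_cases j <;> simp
  rw [← hω (x 0) x, coe_rightRegular, e, h, map_sub, ← rightTranslate_mul, mul_inv_cancel_left]

/-- This is the cocycle condition at (1, g, gh), with invariance rewriting ω(g, gh) as π(g)ω(1, h).
-/
theorem map_mul_of_mem_cocycles {ω : C(Fin 2 → G, orlicz φ μ)}
    (hω : ω ∈ cocycles (rightRegular μ φ) 1) (g h : G) :
    (ω ![1, g * h] : G →ₘ[μ] ℝ) = ω ![1, g] + rightTranslate μ g (ω ![1, h]) := by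
  have e1 : rightRegular μ φ g (ω ![1, h]) = ω ![g, g * h] := by
    rw [← hω.1 g ![g, g * h]]
    congr 2
    ext j
    fin_cases j <;> simp
  have e2 : cobound G (orlicz φ μ) 1 ω ![1, g, g * h] =
      ω ![g, g * h] - ω ![1, g * h] + ω ![1, g] := by
    have i0 : (fun j => ![1, g, g * h] (Fin.succAbove 0 j)) = ![g, g * h] := by
      ext j
      fin_cases j <;> rfl
    have i1 : (fun j => ![1, g, g * h] (Fin.succAbove 1 j)) = ![1, g * h] := by
      ext j
      fin_cases j <;> rfl
    have i2 : (fun j => ![1, g, g * h] (Fin.succAbove 2 j)) = ![1, g] := by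
      ext j
      fin_cases j <;> rfl
    rw [← i0, ← i1, ← i2]
    simp [cobound, Fin.sum_univ_three, sub_eq_add_neg]
  rw [LinearMap.mem_ker.1 hω.2, ContinuousMap.zero_apply, ← e1] at e2
  have e3 : ω ![1, g * h] = ω ![1, g] + rightRegular μ φ g (ω ![1, h]) := by
    rw [← sub_eq_zero, ← neg_eq_zero, e2]
    abel
  rw [e3, Submodule.coe_add, coe_rightRegular]

theorem cobound_zero_apply (η : C(Fin 1 → G, orlicz φ μ)) (x : Fin 2 → G) :
    cobound G (orlicz φ μ) 0 η x = η (fun _ => x 1) - η (fun _ => x 0) := by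
  have i0 : (fun j => x (Fin.succAbove 0 j)) = fun _ : Fin 1 => x 1 := by
    ext j
    fin_cases j; rfl
  have i1 : (fun j => x (Fin.succAbove 1 j)) = fun _ : Fin 1 => x 0 := by
    ext j
    fin_cases j; rfl
  rw [← i0, ← i1]
  simp [cobound, Fin.sum_univ_two, sub_eq_add_neg]

theorem exists_eq_of_mem_coboundaries {ω : C(Fin 2 → G, orlicz φ μ)}
    (hω : ω ∈ coboundaries (rightRegular μ φ) 0) :
    ∃ u ∈ orlicz φ μ, ∀ x : Fin 2 → G,
      (ω x : G →ₘ[μ] ℝ) = rightTranslate μ (x 1) u - rightTranslate μ (x 0) u := by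
  obtain ⟨η, hη, rfl⟩ := hω
  refine ⟨η (fun _ => 1), (η _).2, fun x => ?_⟩
  have h : ∀ g : G, (η (fun _ => g) : G →ₘ[μ] ℝ) = rightTranslate μ g (η (fun _ => 1)) :=
    fun g => by
    rw [← hη g (fun _ => g), coe_rightRegular]
    simp
  rw [cobound_zero_apply, Submodule.coe_sub, h, h (x 0)]

/-- Uniform approximation on the compact set of pairs (1, s), s ∈ S, is enough: if the approximating
coboundary comes from `u`, it makes every π(s)(f - u) - (f - u) small, and these slices make up d(f
- u). -/
theorem isOrliczLimit_of_mem_closure_coboundaries (hSm : MeasurableSet S)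
    (hSc : IsCompact S) (hS : μ S ≠ ∞) {f : G →ₘ[μ] ℝ} {ω : C(Fin 2 → G, orlicz φ μ)}
    (h : ∀ x : Fin 2 → G, (ω x : G →ₘ[μ] ℝ) = rightTranslate μ (x 1) f - rightTranslate μ (x 0) f)
    (hω : ω ∈ (coboundaries (rightRegular μ φ) 0).topologicalClosure) :
    IsOrliczLimit μ S φ f := fun ε hε => by
  set c := max 1 (μ S).toReal with hc
  have hc0 : 0 < c := lt_of_lt_of_le one_pos (le_max_left _ _)
  set δ := ε / (2 * c) with hδ
  have hδ0 : 0 < δ := by positivity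
  set K : Set (Fin 2 → G) := (fun s => ![1, s]) '' S with hK
  have hKc : IsCompact K := hSc.image (by fun_prop)
  have h1 := ContinuousMap.tendsto_iff_forall_isCompact_tendstoUniformlyOn.1
    (tendsto_id (x := 𝓝 ω)) K hKc
  have h2 := Metric.tendstoUniformlyOn_iff.1 h1 δ hδ0
  obtain ⟨η, hη, hη'⟩ := ((mem_closure_iff_frequently.1 hω).and_eventually h2).exists
  obtain ⟨u, hu, hηu⟩ := exists_eq_of_mem_coboundaries hη
  refine ⟨u, hu, ?_⟩
  have := (luxNorm_diffMap_le_of_forall_modular_le (φ := φ) (w := f - u) hSm hS hδ0 fun s hs => ?_).2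
  · refine this.trans_lt ?_
    rw [← hc, hδ]
    calc c * (ε / (2 * c)) = ε / 2 := by field_simp
      _ < ε := half_lt_self hε
  · have h3 := hη' ![1, s] ⟨s, hs, rfl⟩
    rw [dist_eq_norm, id] at h3
    refine (modular_congr φ μ (Eventually.of_forall fun x => ?_)).trans_le
      (modular_div_le_one_of_luxNorm_lt (ω ![1, s] - η ![1, s]).2 h3)
    have e : ((ω ![1, s] - η ![1, s] : orlicz φ μ) : G →ₘ[μ] ℝ) =
        rightTranslate μ s (f - u) - (f - u) := by
      rw [Submodule.coe_sub, h, hηu, map_sub]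
      simp only [Matrix.cons_val_zero, Matrix.cons_val_one, map_one, Module.End.one_apply]
      abel
    rw [e]

/-- Every continuous cocycle comes from a Dirichlet function. -/
theorem exists_dirichlet_of_mem_cocycles [μ.IsMulLeftInvariant] [μ.IsOpenPosMeasure]
    (hSm : MeasurableSet S) (hSc : IsCompact S) (hS : μ S ≠ ∞) {ω : C(Fin 2 → G, orlicz φ μ)}
    (hω : ω ∈ cocycles (rightRegular μ φ) 1) :
    ∃ f ∈ dirichlet μ S φ, ∀ x : Fin 2 → G,
      (ω x : G →ₘ[μ] ℝ) = rightTranslate μ (x 1) f - rightTranslate μ (x 0) f := by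
  have hbc : Continuous fun g => ω ![1, g] := ω.continuous.comp (by fun_prop)
  obtain ⟨f, hf⟩ := exists_primitive (b := fun g => ω ![1, g]) hbc (map_mul_of_mem_cocycles hω)
  -- The scale `max 1 (M + 1)` used next is positive and strictly above every norm attained over
  -- `S`.
  obtain ⟨M, hM⟩ := (hSc.image hbc).isBounded.exists_norm_le
  refine ⟨f, (luxNorm_diffMap_le_of_forall_modular_le hSm hS
    (lt_of_lt_of_le one_pos (le_max_left 1 (M + 1))) fun s hs => ?_).1,
    rightTranslate_sub_eq_of_mem_invCochains hω.1 hf⟩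
  rw [← hf s]
  refine modular_div_le_one_of_luxNorm_lt (ω ![1, s]).2 ?_
  exact (lt_add_one _).trans_le ((add_le_add_left (hM _ ⟨s, hs, rfl⟩) 1).trans (le_max_right _ _))

/-! ### From Dirichlet functions to continuous cocycles and closures of coboundaries. -/

section Haar

variable [LocallyCompactSpace G] [μ.IsHaarMeasure]

/-- Translations are isometries, so ‖b(y) - b(x)‖ = ‖b(x⁻¹y)‖ and continuity at 1 suffices. -/
theorem continuous_of_eq_rightTranslate_sub (hD : φ.DoublingWith D) (hSm : MeasurableSet S)
    (hS : μ S ≠ ∞) (hUS : U ⊆ S) (hUo : IsOpen U) (hU1 : (1 : G) ∈ U) {f : G →ₘ[μ] ℝ}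
    (hf : f ∈ dirichlet μ S φ) {b : G → orlicz φ μ}
    (hb : ∀ g, (b g : G →ₘ[μ] ℝ) = rightTranslate μ g f - f) : Continuous b := by
  refine continuous_iff_continuousAt.2 fun x => ?_
  rw [ContinuousAt, tendsto_iff_norm_sub_tendsto_zero]
  have h1 := tendsto_luxNorm_rightTranslate_sub (μ := μ) hD hSm hS hUS hUo hU1 hf
  have h2 : Tendsto (fun y => x⁻¹ * y) (𝓝 x) (𝓝 1) := by
    have : ContinuousAt (fun y : G => x⁻¹ * y) x := by fun_prop
    simpa [ContinuousAt] using this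
  refine (h1.comp h2).congr fun y => ?_
  have e : ((b y - b x : orlicz φ μ) : G →ₘ[μ] ℝ) =
      rightTranslate μ x (rightTranslate μ (x⁻¹ * y) f - f) := by
    rw [Submodule.coe_sub, hb, hb, map_sub, ← rightTranslate_mul, mul_inv_cancel_left]
    abel
  change _ = luxNorm φ μ ((b y - b x : orlicz φ μ) : G →ₘ[μ] ℝ)
  rw [e, luxNorm_rightTranslate, Function.comp_apply]

theorem exists_cochain (hD : φ.DoublingWith D) (hSm : MeasurableSet S)
    (hS : μ S ≠ ∞) (hUS : U ⊆ S) (hUo : IsOpen U) (hU1 : (1 : G) ∈ U)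
    (hUgen : Subgroup.closure U = ⊤) {f : G →ₘ[μ] ℝ} (hf : f ∈ dirichlet μ S φ) :
    ∃ ω : C(Fin 2 → G, orlicz φ μ), ∀ x : Fin 2 → G,
      (ω x : G →ₘ[μ] ℝ) = rightTranslate μ (x 1) f - rightTranslate μ (x 0) f := by
  have hmem : ∀ g, rightTranslate μ g f - f ∈ orlicz φ μ := fun g => by
    obtain ⟨V, hV, C, -, H⟩ := exists_nhds_luxNorm_le (μ := μ) hD hSm hS hUS hUo hU1 hUgen g
    exact (H g (mem_of_mem_nhds hV) f hf).1
  set b : G → orlicz φ μ := fun g => ⟨rightTranslate μ g f - f, hmem g⟩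
  have hb : Continuous b :=
    continuous_of_eq_rightTranslate_sub hD hSm hS hUS hUo hU1 hf fun _ => rfl
  refine ⟨⟨fun x => b (x 1) - b (x 0), by fun_prop⟩, fun x => ?_⟩
  change (rightTranslate μ (x 1) f - f) - (rightTranslate μ (x 0) f - f) = _
  abel

theorem mem_coboundaries_of_eq (hD : φ.DoublingWith D) (hSm : MeasurableSet S)
    (hS : μ S ≠ ∞) (hUS : U ⊆ S) (hUo : IsOpen U) (hU1 : (1 : G) ∈ U)
    {ω : C(Fin 2 → G, orlicz φ μ)} {u : G →ₘ[μ] ℝ} (hu : u ∈ orlicz φ μ)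
    (h : ∀ x : Fin 2 → G, (ω x : G →ₘ[μ] ℝ) = rightTranslate μ (x 1) u - rightTranslate μ (x 0) u) :
    ω ∈ coboundaries (rightRegular μ φ) 0 := by
  set v : orlicz φ μ := ⟨u, hu⟩
  have hb : Continuous fun g => rightRegular μ φ g v - v :=
    continuous_of_eq_rightTranslate_sub hD hSm hS hUS hUo hU1 (orlicz_le_dirichlet hD hS hu)
      fun _ => rfl
  have hb' : Continuous fun g => rightRegular μ φ g v := by
    simpa using hb.add_const v
  refine ⟨⟨fun x => rightRegular μ φ (x 0) v, hb'.comp (continuous_apply 0)⟩, fun g x => ?_, ?_⟩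
  · change rightRegular μ φ g (rightRegular μ φ (g⁻¹ * x 0) v) = rightRegular μ φ (x 0) v
    rw [← Module.End.mul_apply, ← map_mul, mul_inv_cancel_left]
  · ext1 x
    apply Subtype.ext
    rw [cobound_zero_apply, h]
    rfl

/-- Approximants of `f` in L^φ give coboundaries. The operators f ↦ π(g)f - f have locally uniform
bounds in `g`, so these converge locally uniformly to `ω`, hence in the compact-open topology. -/
theorem mem_closure_coboundaries (hD : φ.DoublingWith D) (hSm : MeasurableSet S)
    (hS : μ S ≠ ∞) (hUS : U ⊆ S) (hUo : IsOpen U) (hU1 : (1 : G) ∈ U)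
    (hUgen : Subgroup.closure U = ⊤) {f : G →ₘ[μ] ℝ} (hf : f ∈ dirichlet μ S φ)
    (hlim : IsOrliczLimit μ S φ f) {ω : C(Fin 2 → G, orlicz φ μ)}
    (h : ∀ x : Fin 2 → G, (ω x : G →ₘ[μ] ℝ) = rightTranslate μ (x 1) f - rightTranslate μ (x 0) f) :
    ω ∈ (coboundaries (rightRegular μ φ) 0).topologicalClosure := by
  choose u hu hlt using fun n : ℕ => hlim (1 / ((n : ℝ) + 1)) (by positivity)
  have huD := fun n => orlicz_le_dirichlet (S := S) hD hS (hu n)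
  choose η hη using fun n => exists_cochain (μ := μ) hD hSm hS hUS hUo hU1 hUgen (huD n)
  refine mem_closure_of_tendsto (f := η) (b := atTop) ?_
    (Eventually.of_forall fun n => mem_coboundaries_of_eq hD hSm hS hUS hUo hU1 (hu n) (hη n))
  rw [ContinuousMap.tendsto_iff_tendstoLocallyUniformly, Metric.tendstoLocallyUniformly_iff]
  intro ε hε x
  obtain ⟨V₀, hV₀, C₀, hC₀, H₀⟩ :=
    exists_nhds_luxNorm_le (μ := μ) hD hSm hS hUS hUo hU1 hUgen (φ := φ) (x 0)
  obtain ⟨V₁, hV₁, C₁, hC₁, H₁⟩ :=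
    exists_nhds_luxNorm_le (μ := μ) hD hSm hS hUS hUo hU1 hUgen (φ := φ) (x 1)
  refine ⟨{y | y 0 ∈ V₀ ∧ y 1 ∈ V₁}, inter_mem ((continuous_apply 0).continuousAt hV₀)
    ((continuous_apply 1).continuousAt hV₁), ?_⟩
  have ht : Tendsto (fun n : ℕ => (C₁ + C₀) * (1 / ((n : ℝ) + 1))) atTop (𝓝 0) := by
    simpa using (tendsto_one_div_add_atTop_nhds_zero_nat (𝕜 := ℝ)).const_mul (C₁ + C₀)
  filter_upwards [ht.eventually_lt_const hε] with n hn y hy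
  have hfu : f - u n ∈ dirichlet μ S φ := (dirichlet μ S φ).sub_mem hf (huD n)
  obtain ⟨m₀, e₀⟩ := H₀ _ hy.1 _ hfu
  obtain ⟨m₁, e₁⟩ := H₁ _ hy.2 _ hfu
  have e : ((ω y - η n y : orlicz φ μ) : G →ₘ[μ] ℝ) =
      (rightTranslate μ (y 1) (f - u n) - (f - u n)) +
        (-1 : ℝ) • (rightTranslate μ (y 0) (f - u n) - (f - u n)) := by
    rw [Submodule.coe_sub, h, hη, map_sub, map_sub]
    module
  rw [dist_eq_norm]
  change luxNorm φ μ ((ω y - η n y : orlicz φ μ) : G →ₘ[μ] ℝ) < ε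
  rw [e]
  refine lt_of_le_of_lt ?_ hn
  refine (luxNorm_add_le φ μ m₁ ((orlicz φ μ).smul_mem _ m₀)).trans ?_
  rw [luxNorm_smul, abs_neg, abs_one, one_mul, add_mul]
  exact add_le_add (e₁.trans (mul_le_mul_of_nonneg_left (hlt n).le hC₁))
    (e₀.trans (mul_le_mul_of_nonneg_left (hlt n).le hC₀))

end Haar

end Classes


/-! ### Existence and uniqueness of harmonic representatives. -/

section Main

variable {G : Type*} [Group G] [MetricSpace G] [IsTopologicalGroup G]
  [SecondCountableTopology G] [MeasurableSpace G] [BorelSpace G]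
  {μ : Measure G} [SFinite μ] [μ.IsMulRightInvariant] {S U : Set G} {φ : YoungFunction} {D : ℝ}

/-- Every Dirichlet function is the sum of a limit of functions in `L^φ` and a harmonic function. -/
theorem exists_isHarmonic_sub [SigmaFinite μ] [μ.IsMulLeftInvariant] [μ.IsOpenPosMeasure]
    [μ.IsInvInvariant] (hD : φ.DoublingWith D) (hc : StrictConvexOn ℝ Set.univ φ)
    (hd : Differentiable ℝ φ) {l : ℝ} (hl : 2 ≤ l) (hφl : ∀ t, 2 * l * φ t ≤ φ (l * t))
    (hSm : MeasurableSet S) (hS : μ S ≠ ∞) (hSsymm : S⁻¹ = S) (hUS : U ⊆ S)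
    (hUo : IsOpen U) (hU1 : (1 : G) ∈ U) (hUgen : Subgroup.closure U = ⊤)
    (f : dirichlet μ S φ) :
    ∃ h : dirichlet μ S φ, IsHarmonic μ S φ (h : G →ₘ[μ] ℝ) ∧
      IsOrliczLimit μ S φ ((f - h : dirichlet μ S φ) : G →ₘ[μ] ℝ) := by
  obtain ⟨h, ⟨u, hu, hlim⟩, hmin⟩ := exists_minimal hD hc hl hφl hSsymm hUS hUo hU1 hUgen f
  refine ⟨h, isHarmonic_of_minimal hD hd hSm hS hSsymm h hmin, fun ε hε => ?_⟩
  obtain ⟨n, hn⟩ := ((tendsto_luxNorm_zero hD hlim).eventually_lt_const hε).exists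
  -- The minimizing sequence f + u n approaches `h`, so f - h is approximated by -u n.
  refine ⟨-u n, (orlicz φ μ).neg_mem (hu n), ?_⟩
  have e : ((f - h : dirichlet μ S φ) : G →ₘ[μ] ℝ) - -u n = (f : G →ₘ[μ] ℝ) + u n - h := by
    rw [Submodule.coe_sub]
    abel
  rwa [e]

/-- A class of `𝒟_φ(G)` modulo the closure of `𝓛^φ(G)` contains at most one harmonic class. -/
theorem IsHarmonicClass.eq_of_sub_mem [μ.IsMulLeftInvariant] [μ.IsOpenPosMeasure]
    [μ.IsInvInvariant] (hD : φ.DoublingWith D) (hc : StrictConvexOn ℝ Set.univ φ)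
    (hd : Differentiable ℝ φ)
    (hSm : MeasurableSet S) (hS : μ S ≠ ∞) (hSsymm : S⁻¹ = S) (hUS : U ⊆ S)
    (hUo : IsOpen U) (hU1 : (1 : G) ∈ U) (hUgen : Subgroup.closure U = ⊤)
    {h₁ h₂ : DirichletMod μ S φ} (hh₁ : IsHarmonicClass μ S φ h₁)
    (hh₂ : IsHarmonicClass μ S φ h₂) (h : h₁ - h₂ ∈ (orliczMod μ S φ).topologicalClosure) :
    h₁ = h₂ := by
  obtain ⟨f₁, rfl, hf₁⟩ := hh₁
  obtain ⟨f₂, rfl, hf₂⟩ := hh₂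
  rw [← Submodule.Quotient.mk_sub, mk_mem_closure_iff hD hS] at h
  obtain ⟨c, hc⟩ := exists_eq_const_of_diffMap_eq_zero hSsymm hUS hUo hU1 hUgen
    (diffMap_sub_eq_zero_of_isHarmonic hD hc hd hSm hS hSsymm hf₁ hf₂ h)
  exact (Submodule.Quotient.eq _).2 ⟨c, hc⟩

/-- Two classes representing the same reduced cohomology class differ by an element of the closure
of `𝓛^φ(G)`. -/
theorem Represents.sub_mem_closure (hD : φ.DoublingWith D) (hSm : MeasurableSet S)
    (hSc : IsCompact S) (hS : μ S ≠ ∞) {h₁ h₂ : DirichletMod μ S φ}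
    {c : ReducedCohomologySucc (rightRegular μ φ) 0} (hh₁ : Represents μ S φ h₁ c)
    (hh₂ : Represents μ S φ h₂ c) : h₁ - h₂ ∈ (orliczMod μ S φ).topologicalClosure := by
  obtain ⟨f₁, rfl, ω₁, hc₁, hω₁⟩ := hh₁
  obtain ⟨f₂, rfl, ω₂, hc₂, hω₂⟩ := hh₂
  rw [← Submodule.Quotient.mk_sub, mk_mem_closure_iff hD hS]
  have hmem := (Submodule.Quotient.eq _).1 (hc₁.trans hc₂.symm)
  refine isOrliczLimit_of_mem_closure_coboundaries (ω := (ω₁ - ω₂ : cocycles _ 1).1)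
    hSm hSc hS (fun x => ?_) hmem
  rw [Submodule.coe_sub, ContinuousMap.sub_apply, Submodule.coe_sub, hω₁, hω₂, Submodule.coe_sub,
    map_sub, map_sub]
  abel

end Main

end OrliczCoh

end

theorem mainTheorem4 {G : Type*} [Group G] [MetricSpace G] [IsTopologicalGroup G]
    [LocallyCompactSpace G] [SecondCountableTopology G] [MeasurableSpace G] [BorelSpace G]
    (hdist : ∀ g x y : G, dist (g * x) (g * y) = dist x y)
    (μ : Measure G) [μ.IsHaarMeasure] [μ.IsMulRightInvariant]
    (hμ : OrliczCoh.IsLocallyDoubling μ)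
    (S : Set G) (hS : IsCompact S) (hSsymm : S⁻¹ = S)
    (hSgen : ∃ U ⊆ S, IsOpen U ∧ (1 : G) ∈ U ∧ Subgroup.closure U = ⊤)
    (φ : OrliczCoh.YoungFunction) (hφN : φ.IsNFunction)
    (hφconv : StrictConvexOn ℝ Set.univ φ)
    (hφdiff : ∀ t : ℝ, t ≠ 0 → DifferentiableAt ℝ φ t)
    (hφdoubling : OrliczCoh.IsDoubling φ)
    (hψdoubling : OrliczCoh.IsDoubling φ.conjugate) :
    (∀ f : OrliczCoh.DirichletMod μ S φ,
      ∃ u ∈ (OrliczCoh.orliczMod μ S φ).topologicalClosure, ∃ h : OrliczCoh.DirichletMod μ S φ,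
        OrliczCoh.IsHarmonicClass μ S φ h ∧ f = u + h) ∧
    (∀ c : OrliczCoh.DirichletMod μ S φ ⧸ (OrliczCoh.orliczMod μ S φ).topologicalClosure,
      ∃! h : OrliczCoh.DirichletMod μ S φ,
        OrliczCoh.IsHarmonicClass μ S φ h ∧ Submodule.Quotient.mk h = c) ∧
    (∀ c : OrliczCoh.ReducedCohomologySucc (OrliczCoh.rightRegular μ φ) 0,
      ∃! h : OrliczCoh.DirichletMod μ S φ,
        OrliczCoh.IsHarmonicClass μ S φ h ∧ OrliczCoh.Represents μ S φ h c) := by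
  have hc := hφconv
  have hd := hφN.differentiable hφdiff
  obtain ⟨D, hD⟩ := OrliczCoh.YoungFunction.exists_doublingWith hφdoubling
  obtain ⟨l, hl, hφl⟩ := hφN.exists_two_mul_le hd hψdoubling
  obtain ⟨U, hUS, hUo, hU1, hUgen⟩ := hSgen
  have hSm : MeasurableSet S := hS.measurableSet
  have hSt : μ S ≠ ∞ := hS.measure_lt_top.ne
  have : μ.IsInvInvariant := OrliczCoh.isInvInvariant_of_isMulRightInvariant
  have hex : ∀ f : OrliczCoh.dirichlet μ S φ, ∃ h : OrliczCoh.dirichlet μ S φ,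
      OrliczCoh.IsHarmonic μ S φ (h : G →ₘ[μ] ℝ) ∧
      OrliczCoh.IsOrliczLimit μ S φ ((f - h : OrliczCoh.dirichlet μ S φ) : G →ₘ[μ] ℝ) := fun f =>
    OrliczCoh.exists_isHarmonic_sub hD hc hd hl hφl hSm hSt hSsymm hUS hUo hU1 hUgen f
  have huniq : ∀ h₁ h₂ : OrliczCoh.DirichletMod μ S φ, OrliczCoh.IsHarmonicClass μ S φ h₁ →
      OrliczCoh.IsHarmonicClass μ S φ h₂ →
      h₁ - h₂ ∈ (OrliczCoh.orliczMod μ S φ).topologicalClosure → h₁ = h₂ := fun h₁ h₂ =>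
    OrliczCoh.IsHarmonicClass.eq_of_sub_mem hD hc hd hSm hSt hSsymm hUS hUo hU1 hUgen
  have hdec : ∀ f : OrliczCoh.DirichletMod μ S φ,
      ∃ u ∈ (OrliczCoh.orliczMod μ S φ).topologicalClosure, ∃ h : OrliczCoh.DirichletMod μ S φ,
        OrliczCoh.IsHarmonicClass μ S φ h ∧ f = u + h := fun f => by
    obtain ⟨f, rfl⟩ := Submodule.Quotient.mk_surjective _ f
    obtain ⟨h, hh, hlim⟩ := hex f
    exact ⟨_, (OrliczCoh.mk_mem_closure_iff hD hSt _).2 hlim, _, ⟨h, rfl, hh⟩,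
      by rw [← Submodule.Quotient.mk_add, sub_add_cancel]⟩
  refine ⟨hdec, fun c => ?_, fun c => ?_⟩
  · obtain ⟨f, rfl⟩ := Submodule.Quotient.mk_surjective _ c
    obtain ⟨u, hu, h, hh, rfl⟩ := hdec f
    refine ⟨h, ⟨hh, ?_⟩, fun h' hh' => huniq _ _ hh'.1 hh ?_⟩
    · rw [Submodule.Quotient.mk_add, (Submodule.Quotient.mk_eq_zero _).2 hu, zero_add]
    · have h1 := hh'.2
      rw [Submodule.Quotient.mk_add, (Submodule.Quotient.mk_eq_zero _).2 hu, zero_add] at h1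
      exact (Submodule.Quotient.eq _).1 h1
  · obtain ⟨h, hh, hr⟩ : ∃ h, OrliczCoh.IsHarmonicClass μ S φ h ∧
        OrliczCoh.Represents μ S φ h c := by
      obtain ⟨ω, rfl⟩ := Submodule.Quotient.mk_surjective _ c
      obtain ⟨f, hf, hω⟩ := OrliczCoh.exists_dirichlet_of_mem_cocycles hSm hS hSt ω.2
      -- Replacing the primitive `f` by its harmonic part alters the cocycle by that of f - h, which
      -- lies in the closure of the coboundaries; the reduced class is unchanged.
      obtain ⟨h, hh, hlim⟩ := hex ⟨f, hf⟩
      obtain ⟨η, hη⟩ := OrliczCoh.exists_cochain hD hSm hSt hUS hUo hU1 hUgen h.2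
      refine ⟨_, ⟨h, rfl, hh⟩, h, rfl, ⟨η, OrliczCoh.mem_cocycles_of_eq hη⟩, Eq.symm ?_, hη⟩
      refine (Submodule.Quotient.eq _).2 ?_
      refine OrliczCoh.mem_closure_coboundaries hD hSm hSt hUS hUo hU1 hUgen
        ((OrliczCoh.dirichlet μ S φ).sub_mem hf h.2) hlim
        (ω := (ω : C(Fin 2 → G, OrliczCoh.orlicz φ μ)) - η) fun x => ?_
      rw [ContinuousMap.sub_apply, Submodule.coe_sub, hω, hη, map_sub, map_sub]
      abel
    exact ⟨h, ⟨hh, hr⟩, fun h' hh' => huniq _ _ hh'.1 hh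
      (hh'.2.sub_mem_closure hD hSm hS hSt hr)⟩
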